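/- Let $d\in\{2,3\}$ and let $\mathcal D\subset\mathbb R^d$ be the open bounded polyhedral domain tessellated by a finite conformal simplicial mesh with elements $K$ and internal edges (faces if $d=3$) $E$. Let $\mathrm{Re}\ge 0$, $\mathrm{Wi}>0$, $0\le\varepsilon<1$, $T>0$, let $N_T\ge1$ be an integer, $\Delta t=T/N_T$ and $t^n=n\Delta t$. Let - $V_h$ be the space of continuous, piecewise quadratic vector fields on $\overline{\mathcal D}$ that vanish on $\partial\mathcal D$; - $Q_h=\mathbb P_{1,disc}$ be the space of discontinuous piecewise linear scalar fields; - $S_h$ be either the space $(\mathbb P_{1,disc})^{d(d+1)/2}$ of discontinuous piecewise linear symmetric tensor fields, or the space $(\mathbb P_1+\mathbb P_0)^{d(d+1)/2}$ of sums of a continuous piecewise linear and a piecewise constant symmetric tensor field; - $\pi_h$ be the piecewise constant interpolation at barycenters, $\pi_h(\phi)|_K=\phi(\theta_K)$, where $\theta_K$ is the barycenter of $K$. Write $(\nabla u)_{ij}=\partial_j u_i$, $A:B=\sum_{i,j}A_{ij}B_{ij}$, and for $(u,p,\sigma),(v,q,\phi)\in V_h\times Q_h\times S_h$, a velocity $u^n$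 and a tensor field $s$, $$\begin{aligned} a(u^n,s;u,p,\sigma;v,q,\phi)=\ &\mathrm{Re}\Big(\tfrac{u-u^n}{\Delta t}+(u^n\cdot\nabla)u\Big)\cdot v-p\,\mathrm{div}\,v+q\,\mathrm{div}\,u+(1-\varepsilon)\nabla u:\nabla v+\tfrac{\varepsilon}{\mathrm{Wi}}\pi_h(\sigma):\nabla v\\ &+\tfrac{\sigma-s}{\Delta t}:\phi-\big(\nabla u\,\pi_h(\sigma)+\pi_h(\sigma)(\nabla u)^T\big):\phi+\tfrac1{\mathrm{Wi}}(\sigma-I):\phi .\end{aligned}$$ Let $(u_h^n,p_h^n,\sigma_h^n)\in V_h\times Q_h\times S_h$ for $0\le n\le N_T$, where the initial velocity is discretely divergence free, $\int_{\mathcal D}q\,\mathrm{div}\,u_h^0=0$ for all $q\in Q_h$. Suppose that this sequence solves one of the following two schemes, for all $0\le n<N_T$ and all $(v,q,\phi)\in V_h\times Q_h\times S_h$: 1. (characteristics) $$\int_{\mathcal D}a\big(u_h^n,\ \pi_h(\sigma_h^n)\circ X^n(t^n);\ u_h^{n+1},p_h^{n+1},\sigma_h^{n+1};\ v,q,\phi\big)=0,$$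 where $X^n(t):\mathcal D\to\mathcal D$ is the backward flow, $\frac{d}{dt}X^n(t,x)=u_h^n(X^n(t,x))$ for $t\in[t^n,t^{n+1}]$, $X^n(t^{n+1},x)=x$; 2. (discontinuous Galerkin) $$\sum_K\int_K a\big(u_h^n,\ \sigma_h^n;\ u_h^{n+1},p_h^{n+1},\sigma_h^{n+1};\ v,q,\phi\big)+\sum_E\int_E|u_h^n\cdot n_E|\,[\![\pi_h(\sigma_h^{n+1})]\!]:\phi^+=0,$$ where $n_E$ is a unit normal to $E$, $\phi^\pm(x)=\lim_{\delta\to0^\pm}\phi(x+\delta u_h^n(x))$ and $[\![\phi]\!]=\phi^+-\phi^-$. Suppose that $\pi_h(\sigma_h^n)$ is positive definite on every element for all $0\le n\le N_T$. Then the free energy $$F_h^n=\frac{\mathrm{Re}}2\int_{\mathcal D}|u_h^n|^2+\frac{\varepsilon}{2\mathrm{Wi}}\int_{\mathcal D}\mathrm{tr}\big(\pi_h(\sigma_h^n)-\ln\pi_h(\sigma_h^n)-I\big)$$ satisfies, for all $0\le n<N_T$, $$F_h^{n+1}-F_h^n+\int_{\mathcal D}\frac{\mathrm{Re}}2|u_h^{n+1}-u_h^n|^2+\Delta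 t\int_{\mathcal D}\Big[(1-\varepsilon)|\nabla u_h^{n+1}|^2+\frac{\varepsilon}{2\mathrm{Wi}^2}\mathrm{tr}\big(\pi_h(\sigma_h^{n+1})+\pi_h(\sigma_h^{n+1})^{-1}-2I\big)\Big]\le0.$$ In particular, the sequence $(F_h^n)_{0\le n\le N_T}$ is non-increasing. -/

import Mathlib

noncomputable section

namespace OldroydB

open MeasureTheory Filter Topology Set
open scoped Matrix

/-- Euclidean space `ℝ^d`. -/
abbrev Pt (d : ℕ) := EuclideanSpace ℝ (Fin d)

/-- Real `d × d` tensors. -/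
abbrev Tensor (d : ℕ) := Matrix (Fin d) (Fin d) ℝ

/-! ### Meshes -/

/-- A conformal simplicial mesh: a finite, pure `d`-dimensional simplicial complex in `ℝ^d`
(two simplices meet exactly along the convex hull of their common vertices). -/
structure Mesh (d : ℕ) extends Geometry.SimplicialComplex ℝ (Pt d) where
  finite_faces : faces.Finite
  pure : ∀ s ∈ faces, ∃ K ∈ faces, s ⊆ K ∧ K.card = d + 1

variable {d : ℕ}

namespace Mesh

/-- The elements `K` of the mesh, given by their `d + 1` vertices. -/
def cells (𝒯 : Mesh d) : Finset (Finset (Pt d)) :=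
  𝒯.finite_faces.toFinset.filter fun K => K.card = d + 1

open Classical in
/-- The internal edges (`d = 2`) or internal faces (`d = 3`): the `(d - 1)`-dimensional simplices
shared by two distinct elements. -/
def internalFaces (𝒯 : Mesh d) : Finset (Finset (Pt d)) :=
  𝒯.finite_faces.toFinset.filter fun e =>
    e.card = d ∧ ∃ K ∈ 𝒯.cells, ∃ L ∈ 𝒯.cells, K ≠ L ∧ e ⊆ K ∧ e ⊆ L

/-- The open bounded polyhedral domain `𝒟` that the mesh tessellates; its closure is the union
`𝒯.space` of the closed elements. -/
def domain (𝒯 : Mesh d) : Set (Pt d) :=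
  interior 𝒯.space

end Mesh

/-- The open simplex spanned by the vertices `K`. -/
def openCell (K : Finset (Pt d)) : Set (Pt d) :=
  interior (convexHull ℝ (K : Set (Pt d)))

/-- The barycenter `θ_K`. -/
def barycenter (K : Finset (Pt d)) : Pt d :=
  K.centroid ℝ id

/-! ### Finite element spaces

Discontinuous piecewise polynomials are functions whose restriction to every open element is
polynomial; their values on the (Lebesgue-null) skeleton of the mesh are irrelevant. -/

/-- `f ∈ ℙ_{k,disc}` (and `ℙ₀` for `k = 0`). -/
def IsPiecewisePoly (𝒯 : Mesh d) (k : ℕ) (f : Pt d → ℝ) : Prop :=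
  ∀ K ∈ 𝒯.cells, ∃ P : MvPolynomial (Fin d) ℝ, P.totalDegree ≤ k ∧
    ∀ x ∈ openCell K, f x = MvPolynomial.eval (fun i => x i) P

/-- `(ℙ₂)^d` with the no-slip condition: vector fields that are continuous on the closed domain,
elementwise polynomial of degree at most two, and zero on `∂𝒟`. -/
def velocitySpace (𝒯 : Mesh d) : Set (Pt d → Pt d) :=
  {v | ContinuousOn v 𝒯.space ∧ (∀ i, IsPiecewisePoly 𝒯 2 fun x => v x i) ∧
    ∀ x ∈ frontier 𝒯.domain, v x = 0}

/-- `ℙ_{1,disc}`. -/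
def pressureSpace (𝒯 : Mesh d) : Set (Pt d → ℝ) :=
  {q | IsPiecewisePoly 𝒯 1 q}

/-- `(ℙ_{k,disc})^{d(d+1)/2}`: symmetric tensor fields with entries in `ℙ_{k,disc}`. -/
def symTensorDisc (𝒯 : Mesh d) (k : ℕ) : Set (Pt d → Tensor d) :=
  {φ | (∀ i j, IsPiecewisePoly 𝒯 k fun x => φ x i j) ∧
    ∀ K ∈ 𝒯.cells, ∀ x ∈ openCell K, (φ x).IsSymm}

/-- `(ℙ₁ + ℙ₀)^{d(d+1)/2}`: sums of a continuous piecewise linear and of a piecewise constant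
symmetric tensor field. -/
def symTensorP1P0 (𝒯 : Mesh d) : Set (Pt d → Tensor d) :=
  {φ | ∃ g ∈ symTensorDisc 𝒯 1, ∃ c ∈ symTensorDisc 𝒯 0, ContinuousOn g 𝒯.space ∧
    ∀ K ∈ 𝒯.cells, ∀ x ∈ openCell K, φ x = g x + c x}

/-- The `ℙ₀` Lagrange interpolation `π_h` at the barycenters: `π_h(f) = f(θ_K)` on `K`. -/
def piH {M : Type*} [AddCommMonoid M] (𝒯 : Mesh d) (f : Pt d → M) (x : Pt d) : M :=
  ∑ K ∈ 𝒯.cells, (openCell K).indicator (fun _ => f (barycenter K)) x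

/-! ### Differential and algebraic operations -/

/-- The velocity gradient `(∇u)_{ij} = ∂u_i / ∂x_j`. -/
def grad (u : Pt d → Pt d) (x : Pt d) : Tensor d :=
  Matrix.of fun i j => (fderiv ℝ u x (EuclideanSpace.single j 1)) i

/-- The divergence `div u = ∑ ∂u_i / ∂x_i`. -/
def diverg (u : Pt d → Pt d) (x : Pt d) : ℝ :=
  (grad u x).trace

/-- The double contraction `A : B = ∑ A_{ij} B_{ij}`. -/
def ddot (A B : Tensor d) : ℝ :=
  ∑ i, ∑ j, A i j * B i j

/-- The matrix logarithm (spectral functional calculus applied to `Real.log`). -/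
def matLog (A : Tensor d) : Tensor d :=
  cfc Real.log A

/-- Membership in `(ℙ₂)^d_{div = 0}` of a field of `(ℙ₂)^d`: `∫ q div u = 0` for all
`q ∈ ℙ_{1,disc}`. -/
def IsDiscretelyDivFree (𝒯 : Mesh d) (u : Pt d → Pt d) : Prop :=
  ∀ q ∈ pressureSpace 𝒯, ∫ x in 𝒯.domain, q x * diverg u x = 0

/-! ### The two schemes -/

/-- The integrand common to both schemes; `sOld` is the old stress in the discrete time derivative
of the stress. -/
def schemeDensity (𝒯 : Mesh d) (Re Wi ε dt : ℝ) (uOld : Pt d → Pt d) (sOld : Pt d → Tensor d)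
    (u : Pt d → Pt d) (p : Pt d → ℝ) (s : Pt d → Tensor d)
    (v : Pt d → Pt d) (q : Pt d → ℝ) (φ : Pt d → Tensor d) (x : Pt d) : ℝ :=
  Re * inner ℝ (dt⁻¹ • (u x - uOld x) + fderiv ℝ u x (uOld x)) (v x)
    - p x * diverg v x + q x * diverg u x
    + (1 - ε) * ddot (grad u x) (grad v x)
    + ε / Wi * ddot (piH 𝒯 s x) (grad v x)
    + ddot (dt⁻¹ • (s x - sOld x)) (φ x)
    - ddot (grad u x * piH 𝒯 s x + piH 𝒯 s x * (grad u x)ᵀ) (φ x)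
    + 1 / Wi * ddot (s x - 1) (φ x)

/-- `X` is the backward flow of `u` on `[t₀, t₁]`: for `x ∈ 𝒟` the curve `X(·, x)` stays in `𝒟`,
`d/dt X(t, x) = u(X(t, x))` on `[t₀, t₁]`, and `X(t₁, x) = x`. -/
def IsBackwardFlow (𝒯 : Mesh d) (u : Pt d → Pt d) (t₀ t₁ : ℝ) (X : ℝ → Pt d → Pt d) : Prop :=
  ∀ x ∈ 𝒯.domain, X t₁ x = x ∧ ∀ t ∈ Icc t₀ t₁, X t x ∈ 𝒯.domain ∧
    HasDerivWithinAt (fun r => X r x) (u (X t x)) (Icc t₀ t₁) t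

/-- One step of the scheme with the characteristic method; `S` is the stress space and `X₀` is
the backward flow at the initial time of the step. -/
def CharacteristicStep (𝒯 : Mesh d) (Re Wi ε dt : ℝ) (S : Set (Pt d → Tensor d))
    (X₀ : Pt d → Pt d) (uOld : Pt d → Pt d) (sOld : Pt d → Tensor d)
    (u : Pt d → Pt d) (p : Pt d → ℝ) (s : Pt d → Tensor d) : Prop :=
  ∀ v ∈ velocitySpace 𝒯, ∀ q ∈ pressureSpace 𝒯, ∀ φ ∈ S,
    ∫ x in 𝒯.domain,
      schemeDensity 𝒯 Re Wi ε dt uOld (fun y => piH 𝒯 sOld (X₀ y)) u p s v q φ x = 0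

/-- `ν` assigns to every internal face a unit normal vector (of arbitrary orientation). -/
def IsUnitNormal (𝒯 : Mesh d) (ν : Finset (Pt d) → Pt d) : Prop :=
  ∀ e ∈ 𝒯.internalFaces, ‖ν e‖ = 1 ∧ ∀ x ∈ e, ∀ y ∈ e, inner ℝ (x - y) (ν e) = 0

/-- The downstream value `φ⁺(x) = lim_{δ → 0⁺} φ(x + δ u(x))`. -/
def downstream (u : Pt d → Pt d) (φ : Pt d → Tensor d) (x : Pt d) : Tensor d :=
  limUnder (𝓝[>] (0 : ℝ)) fun δ => φ (x + δ • u x)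

/-- The upstream value `φ⁻(x) = lim_{δ → 0⁻} φ(x + δ u(x))`. -/
def upstream (u : Pt d → Pt d) (φ : Pt d → Tensor d) (x : Pt d) : Tensor d :=
  limUnder (𝓝[<] (0 : ℝ)) fun δ => φ (x + δ • u x)

/-- The jump `⟦φ⟧ = φ⁺ - φ⁻`. -/
def jump (u : Pt d → Pt d) (φ : Pt d → Tensor d) (x : Pt d) : Tensor d :=
  downstream u φ x - upstream u φ x

/-- One step of the scheme with the discontinuous Galerkin method; faces carry the
`(d - 1)`-dimensional surface measure. -/
def DGStep (𝒯 : Mesh d) (Re Wi ε dt : ℝ) (S : Set (Pt d → Tensor d))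
    (ν : Finset (Pt d) → Pt d) (uOld : Pt d → Pt d) (sOld : Pt d → Tensor d)
    (u : Pt d → Pt d) (p : Pt d → ℝ) (s : Pt d → Tensor d) : Prop :=
  ∀ v ∈ velocitySpace 𝒯, ∀ q ∈ pressureSpace 𝒯, ∀ φ ∈ S,
    (∑ K ∈ 𝒯.cells, ∫ x in convexHull ℝ (K : Set (Pt d)),
        schemeDensity 𝒯 Re Wi ε dt uOld sOld u p s v q φ x)
      + ∑ e ∈ 𝒯.internalFaces, ∫ x in convexHull ℝ (e : Set (Pt d)),
          |inner ℝ (uOld x) (ν e)| * ddot (jump uOld (piH 𝒯 s) x) (downstream uOld φ x)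
            ∂(Measure.euclideanHausdorffMeasure (d - 1)) = 0

/-! ### Free energy -/

/-- `F(u, σ) = Re/2 ∫ |u|² + ε/(2 Wi) ∫ tr (σ - ln σ - I)`. -/
def freeEnergy (𝒯 : Mesh d) (Re Wi ε : ℝ) (u : Pt d → Pt d) (s : Pt d → Tensor d) : ℝ :=
  Re / 2 * (∫ x in 𝒯.domain, ‖u x‖ ^ 2)
    + ε / (2 * Wi) * ∫ x in 𝒯.domain, (s x - matLog (s x) - 1).trace

/-- The free energy dissipation inequality at each of the `NT` steps, and the monotonicity of the
free energies, both with `π_h(σ)` in place of the stress. -/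
def FreeEnergyDissipation (𝒯 : Mesh d) (Re Wi ε dt : ℝ) (NT : ℕ)
    (u : ℕ → Pt d → Pt d) (σ : ℕ → Pt d → Tensor d) : Prop :=
  (∀ n < NT,
    freeEnergy 𝒯 Re Wi ε (u (n + 1)) (piH 𝒯 (σ (n + 1)))
      - freeEnergy 𝒯 Re Wi ε (u n) (piH 𝒯 (σ n))
      + (∫ x in 𝒯.domain, Re / 2 * ‖u (n + 1) x - u n x‖ ^ 2)
      + dt * (∫ x in 𝒯.domain,
          ((1 - ε) * ddot (grad (u (n + 1)) x) (grad (u (n + 1)) x)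
            + ε / (2 * Wi ^ 2) *
              (piH 𝒯 (σ (n + 1)) x + (piH 𝒯 (σ (n + 1)) x)⁻¹ - (2 : ℝ) • 1).trace)) ≤ 0) ∧
  ∀ m n, m ≤ n → n ≤ NT →
    freeEnergy 𝒯 Re Wi ε (u n) (piH 𝒯 (σ n)) ≤ freeEnergy 𝒯 Re Wi ε (u m) (piH 𝒯 (σ m))

end OldroydB

end

noncomputable section

namespace OldroydB

open MeasureTheory Filter Topology Set
open scoped Matrix

variable {d : ℕ} {𝒯 : Mesh d} {K L : Finset (Pt d)}

/-! ### Elements of the mesh -/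

/-! The estimate comes from testing the scheme with `v = uⁿ⁺¹`, `q = pⁿ⁺¹` and `φ = κ (I -
π_h(σⁿ⁺¹)⁻¹)`, `κ = ε / (2 Wi)`. This `φ` is the gradient of the entropy at the new stress; being
symmetric and piecewise constant, it is admissible in both stress spaces.

Algebra (`schemeDensity_test`). The two pressure terms cancel. The upper-convected term equals the
elastic power in the momentum equation up to a multiple of `div u` (`ddot_upper_convected`). The
divergence of a `ℙ₂` field is in `ℙ_{1,disc}`, so discretely divergence free fields are divergence
free almost everywhere, and that multiple vanishes. Convection does no work, because the velocity,
extended by zero, is Lipschitz and divergence free (`integral_inner_convection_eq_zero`). Since `φ`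
is constant on each element and the stress is linear there, the barycenter rule replaces the stress
by `π_h` exactly (`integral_affine_openCell`).

Entropy. `G(A) = tr A - ln det A` is convex on positive definite tensors with gradient `I - A⁻¹`, so
`G(A) - G(B) ≤ (A - B) : (I - A⁻¹)` (`traceSubLogDet_sub_le`). With `A` the new stress, the discrete
time derivative bounds the entropy increment, once the transport of the old stress is shown not to
create entropy; this is the only point at which the schemes differ.

Characteristics: the flow of a Lipschitz divergence free field preserves integrals, since `∫ f ∘
Φ_t` has right derivative `∫ ∇(f ∘ Φ_t) · W = 0` (`IsFlow.integral_comp_eq`). Hence the foot map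
does not increase the volume of cells, and as `G ≥ 0` the transported entropy is at most the old one
(`entropy_transport_le`).

Discontinuous Galerkin: convexity across a face bounds each jump term below by minus `κ` times the
entropy-weighted fluxes out of its two cells (`le_integral_jump`). Regrouped by elements, these
fluxes sum to zero by the divergence theorem on a simplex (`integral_diverg_simplex`) and the
no-slip condition (`sum_internalFaces_flux`). -/

lemma Mesh.mem_cells {𝒯 : Mesh d} {K : Finset (Pt d)} :
    K ∈ 𝒯.cells ↔ K ∈ 𝒯.faces ∧ K.card = d + 1 := by
  simp [Mesh.cells]

/-- The vertices of an element form an affine basis. -/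
def cellBasis {𝒯 : Mesh d} {K : Finset (Pt d)} (hK : K ∈ 𝒯.cells) : AffineBasis K ℝ (Pt d) where
  toFun := (↑)
  ind' := 𝒯.indep (Mesh.mem_cells.1 hK).1
  tot' := by
    have h := 𝒯.indep (Mesh.mem_cells.1 hK).1
    rw [h.affineSpan_eq_top_iff_card_eq_finrank_add_one]
    simp [(Mesh.mem_cells.1 hK).2]

@[simp] lemma cellBasis_apply (hK : K ∈ 𝒯.cells) (i : K) : cellBasis hK i = i := rfl

lemma range_cellBasis (hK : K ∈ 𝒯.cells) : range (cellBasis hK) = (K : Set (Pt d)) := by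
  ext x; simp

lemma mem_openCell_iff (hK : K ∈ 𝒯.cells) {x : Pt d} :
    x ∈ openCell K ↔ ∀ i, 0 < (cellBasis hK).coord i x := by
  rw [openCell, ← range_cellBasis hK, AffineBasis.interior_convexHull]; rfl

lemma mem_closedCell_iff (hK : K ∈ 𝒯.cells) {x : Pt d} :
    x ∈ convexHull ℝ (K : Set (Pt d)) ↔ ∀ i, 0 ≤ (cellBasis hK).coord i x := by
  rw [← range_cellBasis hK, AffineBasis.convexHull_eq_nonneg_coord]; rfl

lemma barycenter_mem_openCell (hK : K ∈ 𝒯.cells) : barycenter K ∈ openCell K := by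
  have h := (cellBasis hK).centroid_mem_interior_convexHull
  rw [range_cellBasis] at h
  have e : Finset.univ.centroid ℝ (cellBasis hK) = barycenter K := by
    exact Finset.centroid_univ ℝ K
  rwa [e] at h

lemma isOpen_openCell (K : Finset (Pt d)) : IsOpen (openCell K) := isOpen_interior

lemma isCompact_convexHull (K : Finset (Pt d)) : IsCompact (convexHull ℝ (K : Set (Pt d))) :=
  K.finite_toSet.isCompact_convexHull ℝ

lemma isClosed_convexHull (K : Finset (Pt d)) : IsClosed (convexHull ℝ (K : Set (Pt d))) :=
  (isCompact_convexHull K).isClosed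

lemma openCell_subset (K : Finset (Pt d)) : openCell K ⊆ convexHull ℝ (K : Set (Pt d)) :=
  interior_subset

lemma closure_openCell (hK : K ∈ 𝒯.cells) :
    closure (openCell K) = convexHull ℝ (K : Set (Pt d)) := by
  rw [openCell, (convex_convexHull ℝ _).closure_interior_eq_closure_of_nonempty_interior
    ⟨_, barycenter_mem_openCell hK⟩, (isClosed_convexHull K).closure_eq]

lemma volume_closedCell_diff (K : Finset (Pt d)) :
    volume (convexHull ℝ (K : Set (Pt d)) \ openCell K) = 0 := by
  have := (convex_convexHull ℝ (K : Set (Pt d))).addHaar_frontier volume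
  rwa [(isClosed_convexHull K).frontier_eq] at this

lemma openCell_ae_eq (K : Finset (Pt d)) :
    openCell K =ᵐ[volume] convexHull ℝ (K : Set (Pt d)) := by
  refine (LE.le.eventuallyLE (openCell_subset K)).antisymm ?_
  exact ae_le_set.2 (volume_closedCell_diff K)

/-- By conformity the common interior is the interior of the hull of `K ∩ L`, which has at most `d`
points and so cannot affinely span the space. -/
lemma disjoint_openCell (hK : K ∈ 𝒯.cells) (hL : L ∈ 𝒯.cells) (h : K ≠ L) :
    Disjoint (openCell K) (openCell L) := by
  classical
  rw [Set.disjoint_iff_inter_eq_empty, openCell, openCell, ← interior_inter,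
    𝒯.convexHull_inter_convexHull (Mesh.mem_cells.1 hK).1 (Mesh.mem_cells.1 hL).1]
  by_contra hne
  have hsp := affineSpan_eq_top_of_nonempty_interior (Set.nonempty_iff_ne_empty.2 hne)
  rw [← Finset.coe_inter] at hsp
  have hc : (K ∩ L).card < d + 1 := by
    rw [← (Mesh.mem_cells.1 hK).2]
    refine Finset.card_lt_card ⟨Finset.inter_subset_left, fun hs => h ?_⟩
    refine Finset.eq_of_subset_of_card_le (fun x hx => (Finset.mem_inter.1 (hs hx)).2) ?_
    rw [(Mesh.mem_cells.1 hK).2, (Mesh.mem_cells.1 hL).2]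
  have hne' : (K ∩ L).Nonempty := by
    by_contra h0
    rw [Finset.not_nonempty_iff_eq_empty] at h0
    simp [h0] at hsp
  have := hne'.to_subtype
  have hdim := finrank_vectorSpan_range_add_one_le ℝ (Subtype.val : (K ∩ L : Finset (Pt d)) → Pt d)
  have hr : range (Subtype.val : (K ∩ L : Finset (Pt d)) → Pt d) = ((K ∩ L : Finset (Pt d)) : Set (Pt d)) :=
    Subtype.range_coe
  rw [← direction_affineSpan, hr, hsp, AffineSubspace.direction_top, finrank_top,
    finrank_euclideanSpace_fin, Fintype.card_coe] at hdim
  omega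

lemma piH_eq {M : Type*} [AddCommMonoid M] (hK : K ∈ 𝒯.cells) (f : Pt d → M) {x : Pt d}
    (hx : x ∈ openCell K) : piH 𝒯 f x = f (barycenter K) := by
  classical
  rw [piH, Finset.sum_eq_single_of_mem K hK, indicator_of_mem hx]
  intro L hL hLK
  exact indicator_of_notMem (fun h => (disjoint_openCell hL hK hLK).le_bot ⟨h, hx⟩) _

lemma space_eq (𝒯 : Mesh d) : 𝒯.space = ⋃ K ∈ 𝒯.cells, convexHull ℝ (K : Set (Pt d)) := by
  refine Subset.antisymm ?_ ?_
  · intro x hx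
    obtain ⟨s, hs, hx⟩ := 𝒯.mem_space_iff.1 hx
    obtain ⟨K, hK, hsK, hc⟩ := 𝒯.pure s hs
    exact mem_biUnion (Mesh.mem_cells.2 ⟨hK, hc⟩) (convexHull_mono (by exact_mod_cast hsK) hx)
  · exact iUnion₂_subset fun K hK => 𝒯.convexHull_subset_space (Mesh.mem_cells.1 hK).1

lemma isCompact_space (𝒯 : Mesh d) : IsCompact 𝒯.space := by
  rw [space_eq]
  exact 𝒯.cells.isCompact_biUnion fun K _ => isCompact_convexHull K

lemma openCell_subset_domain (hK : K ∈ 𝒯.cells) : openCell K ⊆ 𝒯.domain :=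
  interior_mono (𝒯.convexHull_subset_space (Mesh.mem_cells.1 hK).1)

lemma domain_subset_space (𝒯 : Mesh d) : 𝒯.domain ⊆ 𝒯.space := interior_subset

lemma isOpen_domain (𝒯 : Mesh d) : IsOpen 𝒯.domain := isOpen_interior

/-- Purity excludes lower dimensional pieces: the space is a union of full dimensional cells, each
the closure of its interior. -/
lemma closure_domain (𝒯 : Mesh d) : closure 𝒯.domain = 𝒯.space := by
  refine Subset.antisymm (closure_minimal (domain_subset_space 𝒯) (isCompact_space 𝒯).isClosed) ?_
  rw [space_eq]
  refine iUnion₂_subset fun K hK => ?_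
  rw [← closure_openCell hK]
  exact closure_mono (openCell_subset_domain hK)

lemma frontier_domain (𝒯 : Mesh d) : frontier 𝒯.domain = 𝒯.space \ 𝒯.domain := by
  rw [(isOpen_domain 𝒯).frontier_eq, closure_domain]

lemma volume_space_diff (𝒯 : Mesh d) : volume (𝒯.space \ ⋃ K ∈ 𝒯.cells, openCell K) = 0 := by
  refine measure_mono_null (t := ⋃ K ∈ 𝒯.cells, convexHull ℝ (K : Set (Pt d)) \ openCell K) ?_ ?_
  · rintro x ⟨hx, hx'⟩
    rw [space_eq] at hx
    simp only [mem_iUnion, exists_prop, not_exists, not_and] at hx hx'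
    obtain ⟨K, hK, hx⟩ := hx
    exact mem_biUnion hK ⟨hx, hx' K hK⟩
  · exact (measure_biUnion_null_iff 𝒯.cells.countable_toSet).2 fun K _ => volume_closedCell_diff K

lemma biUnion_openCell_ae_eq_domain (𝒯 : Mesh d) :
    (⋃ K ∈ 𝒯.cells, openCell K) =ᵐ[volume] 𝒯.domain := by
  refine (LE.le.eventuallyLE (iUnion₂_subset fun K hK =>
    openCell_subset_domain hK)).antisymm ?_
  exact ae_le_set.2 (measure_mono_null (sdiff_subset_sdiff_left (domain_subset_space 𝒯))
    (volume_space_diff 𝒯))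

lemma ae_mem_openCell (𝒯 : Mesh d) :
    ∀ᵐ x ∂(volume.restrict 𝒯.domain), ∃ K ∈ 𝒯.cells, x ∈ openCell K := by
  rw [ae_restrict_iff' (isOpen_domain 𝒯).measurableSet]
  filter_upwards [biUnion_openCell_ae_eq_domain 𝒯] with x hx hxd
  have : x ∈ ⋃ K ∈ 𝒯.cells, openCell K := by
    have := hx.symm.mp hxd
    exact this
  simpa using this

lemma setIntegral_domain_eq_sum {E : Type*} [NormedAddCommGroup E] [NormedSpace ℝ E]
    {f : Pt d → E} (hf : ∀ K ∈ 𝒯.cells, IntegrableOn f (openCell K)) :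
    ∫ x in 𝒯.domain, f x = ∑ K ∈ 𝒯.cells, ∫ x in openCell K, f x := by
  rw [← setIntegral_congr_set (biUnion_openCell_ae_eq_domain 𝒯)]
  exact integral_biUnion_finset _ (fun K _ => (isOpen_openCell K).measurableSet)
    (fun K hK L hL h => disjoint_openCell hK hL h) hf

lemma integrableOn_domain {E : Type*} [NormedAddCommGroup E] {f : Pt d → E}
    (hf : ∀ K ∈ 𝒯.cells, IntegrableOn f (openCell K)) : IntegrableOn f 𝒯.domain := by
  refine IntegrableOn.congr_set_ae ?_ (biUnion_openCell_ae_eq_domain 𝒯).symm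
  exact (integrableOn_finset_iUnion (s := 𝒯.cells)).2 hf

/-! ### Polynomials -/

lemma totalDegree_pderiv_le (i : Fin d) (P : MvPolynomial (Fin d) ℝ) {k : ℕ}
    (hP : P.totalDegree ≤ k + 1) : (MvPolynomial.pderiv i P).totalDegree ≤ k := by
  classical
  rw [MvPolynomial.totalDegree, Finset.sup_le_iff]
  intro m hm
  rw [MvPolynomial.mem_support_iff, MvPolynomial.coeff_pderiv] at hm
  have h1 : m + Finsupp.single i 1 ∈ P.support :=
    MvPolynomial.mem_support_iff.2 (left_ne_zero_of_mul hm)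
  have h2 := (MvPolynomial.le_totalDegree h1).trans hP
  rw [Finsupp.sum_add_index' (fun _ => rfl) (fun _ _ _ => rfl)] at h2
  simpa using h2

lemma hasFDerivAt_eval (P : MvPolynomial (Fin d) ℝ) (x : Pt d) :
    HasFDerivAt (fun y : Pt d => MvPolynomial.eval (fun i => y i) P)
      (∑ i, MvPolynomial.eval (fun i => x i) (MvPolynomial.pderiv i P) •
        (EuclideanSpace.proj i : Pt d →L[ℝ] ℝ)) x := by
  induction P using MvPolynomial.induction_on with
  | C a => simpa using hasFDerivAt_const a x
  | add p q hp hq =>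
    simp only [map_add, add_smul, Finset.sum_add_distrib]
    exact hp.add hq
  | mul_X p i hp =>
    have hX : HasFDerivAt (fun y : Pt d => y i) (EuclideanSpace.proj i : Pt d →L[ℝ] ℝ) x :=
      (EuclideanSpace.proj i : Pt d →L[ℝ] ℝ).hasFDerivAt
    have := hp.mul hX
    simp only [map_mul, MvPolynomial.eval_X, MvPolynomial.pderiv_mul, map_add]
    convert! this using 1
    simp only [add_smul, Finset.sum_add_distrib, Finset.smul_sum, MvPolynomial.pderiv_X]
    rw [add_comm]
    congr 1
    · rw [Finset.sum_eq_single i]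
      · simp
      · intro j _ hj; simp [Ne.symm hj]
      · simp
    · exact Finset.sum_congr rfl fun j _ => by rw [smul_smul, mul_comm]

lemma contDiff_eval (P : MvPolynomial (Fin d) ℝ) (n : ℕ∞) :
    ContDiff ℝ n (fun y : Pt d => MvPolynomial.eval (fun i => y i) P) := by
  induction P using MvPolynomial.induction_on with
  | C a => simpa using contDiff_const
  | add p q hp hq => simpa using hp.add hq
  | mul_X p i hp =>
    simpa using hp.mul ((EuclideanSpace.proj i : Pt d →L[ℝ] ℝ).contDiff)

/-- All partial derivatives are constants; subtracting the linear form they define leaves a function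
with zero derivative. -/
lemma exists_affine_of_totalDegree_le_one (P : MvPolynomial (Fin d) ℝ) (hP : P.totalDegree ≤ 1) :
    ∃ A : Pt d →ᵃ[ℝ] ℝ, ∀ x : Pt d, MvPolynomial.eval (fun i => x i) P = A x := by
  have hc : ∀ i, ∃ c, MvPolynomial.pderiv i P = MvPolynomial.C c := fun i =>
    ⟨_, MvPolynomial.totalDegree_eq_zero_iff_eq_C.1 (Nat.le_zero.1 (totalDegree_pderiv_le i P hP))⟩
  choose c hc using hc
  set ℓ : Pt d →L[ℝ] ℝ := ∑ i, c i • (EuclideanSpace.proj i : Pt d →L[ℝ] ℝ) with hℓ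
  have hd : ∀ x : Pt d, HasFDerivAt
      (fun y : Pt d => MvPolynomial.eval (fun i => y i) P - ℓ y) (0 : Pt d →L[ℝ] ℝ) x := by
    intro x
    convert! (hasFDerivAt_eval P x).sub ℓ.hasFDerivAt using 1
    simp [hc, hℓ]
  have hconst := is_const_of_fderiv_eq_zero (𝕜 := ℝ) (fun x => (hd x).differentiableAt)
    (fun x => (hd x).fderiv)
  refine ⟨ℓ.toLinearMap.toAffineMap +
    AffineMap.const ℝ (Pt d) (MvPolynomial.eval (fun i => (0 : Pt d) i) P), fun x => ?_⟩
  have := hconst x 0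
  simp only [map_zero, sub_zero] at this
  simp; simp at this; linarith

/-! ### Piecewise continuous functions -/

/-- Functions that agree on every open element with a continuous function on `ℝ^d`. -/
def IsPiecewiseCont {E : Type*} [TopologicalSpace E] (𝒯 : Mesh d) (f : Pt d → E) : Prop :=
  ∀ K ∈ 𝒯.cells, ∃ g : Pt d → E, Continuous g ∧ EqOn f g (openCell K)

namespace IsPiecewiseCont

variable {E F G : Type*} [TopologicalSpace E] [TopologicalSpace F] [TopologicalSpace G]

lemma const (c : E) : IsPiecewiseCont 𝒯 fun _ => c := fun _ _ => ⟨_, continuous_const, fun _ _ => rfl⟩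

lemma comp {f : Pt d → E} (hf : IsPiecewiseCont 𝒯 f) {H : E → F} (hH : Continuous H) :
    IsPiecewiseCont 𝒯 fun x => H (f x) := fun K hK => by
  obtain ⟨g, hg, h⟩ := hf K hK
  exact ⟨_, hH.comp hg, fun x hx => congrArg H (h hx)⟩

lemma comp₂ {f : Pt d → E} {g : Pt d → F} (hf : IsPiecewiseCont 𝒯 f) (hg : IsPiecewiseCont 𝒯 g)
    {H : E → F → G} (hH : Continuous (Function.uncurry H)) :
    IsPiecewiseCont 𝒯 fun x => H (f x) (g x) := fun K hK => by
  obtain ⟨f', hf', h⟩ := hf K hK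
  obtain ⟨g', hg', h'⟩ := hg K hK
  exact ⟨fun x => H (f' x) (g' x), hH.comp (hf'.prodMk hg'), fun x hx => by
    simp only [h hx, h' hx]⟩

lemma add [Add E] [ContinuousAdd E] {f g : Pt d → E} (hf : IsPiecewiseCont 𝒯 f)
    (hg : IsPiecewiseCont 𝒯 g) : IsPiecewiseCont 𝒯 fun x => f x + g x :=
  hf.comp₂ hg (H := fun a b => a + b) continuous_add

lemma sub [AddGroup E] [IsTopologicalAddGroup E] {f g : Pt d → E} (hf : IsPiecewiseCont 𝒯 f)
    (hg : IsPiecewiseCont 𝒯 g) : IsPiecewiseCont 𝒯 fun x => f x - g x :=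
  hf.comp₂ hg (H := fun a b => a - b) continuous_sub

lemma mul [Mul E] [ContinuousMul E] {f g : Pt d → E} (hf : IsPiecewiseCont 𝒯 f)
    (hg : IsPiecewiseCont 𝒯 g) : IsPiecewiseCont 𝒯 fun x => f x * g x :=
  hf.comp₂ hg (H := fun a b => a * b) continuous_mul

lemma const_mul [Mul E] [ContinuousMul E] {f : Pt d → E} (hf : IsPiecewiseCont 𝒯 f) (c : E) :
    IsPiecewiseCont 𝒯 fun x => c * f x :=
  (const c).mul hf

lemma matrix {f : Pt d → Tensor d} (hf : ∀ i j, IsPiecewiseCont 𝒯 fun x => f x i j) :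
    IsPiecewiseCont 𝒯 f := fun K hK => by
  choose g hg h using fun i j => hf i j K hK
  exact ⟨fun x => Matrix.of fun i j => g i j x,
    continuous_matrix fun i j => hg i j, fun x hx => by ext i j; exact h i j hx⟩

lemma piH (f : Pt d → E) [AddCommMonoid E] : IsPiecewiseCont 𝒯 (piH 𝒯 f) :=
  fun K hK => ⟨fun _ => f (barycenter K), continuous_const, fun _ hx => piH_eq hK f hx⟩

lemma integrableOn_openCell {E : Type*} [NormedAddCommGroup E] {f : Pt d → E}
    (hf : IsPiecewiseCont 𝒯 f) (hK : K ∈ 𝒯.cells) : IntegrableOn f (openCell K) := by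
  obtain ⟨g, hg, h⟩ := hf K hK
  refine IntegrableOn.congr_fun ?_ h.symm (isOpen_openCell K).measurableSet
  exact (hg.continuousOn.integrableOn_compact (isCompact_convexHull K)).mono_set (openCell_subset K)

lemma integrableOn_domain {E : Type*} [NormedAddCommGroup E] {f : Pt d → E}
    (hf : IsPiecewiseCont 𝒯 f) : IntegrableOn f 𝒯.domain :=
  OldroydB.integrableOn_domain fun _ hK => hf.integrableOn_openCell hK

lemma setIntegral_domain {E : Type*} [NormedAddCommGroup E] [NormedSpace ℝ E] {f : Pt d → E}
    (hf : IsPiecewiseCont 𝒯 f) :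
    ∫ x in 𝒯.domain, f x = ∑ K ∈ 𝒯.cells, ∫ x in openCell K, f x :=
  setIntegral_domain_eq_sum fun _ hK => hf.integrableOn_openCell hK

end IsPiecewiseCont

lemma IsPiecewisePoly.isPiecewiseCont {k : ℕ} {f : Pt d → ℝ} (hf : IsPiecewisePoly 𝒯 k f) :
    IsPiecewiseCont 𝒯 f := fun K hK => by
  obtain ⟨P, -, h⟩ := hf K hK
  exact ⟨_, (contDiff_eval P 0).continuous, h⟩

/-! ### The barycenter rule -/

/-- The affine involution that exchanges two vertices and fixes the others. -/
def swapVertices {ι : Type*} (b : AffineBasis ι ℝ (Pt d)) (i j : ι) (x : Pt d) : Pt d :=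
  x + (b.coord i x - b.coord j x) • (b j - b i)

section swap
variable {ι : Type*} (b : AffineBasis ι ℝ (Pt d)) (i j : ι)

lemma coord_add_smul (k : ι) (x v : Pt d) (c : ℝ) :
    b.coord k (x + c • v) = b.coord k x + c * (b.coord k).linear v := by
  have := (b.coord k).map_vadd x (c • v)
  simp only [vadd_eq_add, map_smul, smul_eq_mul] at this
  rw [add_comm x, this, add_comm]

lemma coord_linear_sub (k : ι) (x y : Pt d) :
    (b.coord k).linear (x - y) = b.coord k x - b.coord k y := by
  simpa using (b.coord k).linearMap_vsub x y

lemma coord_swapVertices [DecidableEq ι] (k : ι) (x : Pt d) :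
    b.coord k (swapVertices b i j x) = b.coord (Equiv.swap i j k) x := by
  rw [swapVertices, coord_add_smul, coord_linear_sub, b.coord_apply, b.coord_apply]
  by_cases hij : i = j
  · subst hij; simp
  by_cases hki : k = i
  · subst hki; simp [hij]
  by_cases hkj : k = j
  · subst hkj; simp [hki]
  simp [hki, hkj, Equiv.swap_apply_of_ne_of_ne hki hkj]

lemma swapVertices_involutive [Finite ι] : Function.Involutive (swapVertices b i j) := by
  classical
  intro x
  refine b.ext_elem fun k => ?_
  rw [coord_swapVertices, coord_swapVertices, Equiv.swap_apply_self]

lemma continuous_swapVertices [Finite ι] : Continuous (swapVertices b i j) := by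
  have h : ∀ k, Continuous (b.coord k) := fun k => continuous_barycentric_coord b k
  exact continuous_id.add (((h i).sub (h j)).smul continuous_const)

/-- The linear part squares to the identity, so its determinant has absolute value one; no formula
for the determinant is needed. -/
lemma measurePreserving_swapVertices [Finite ι] :
    MeasurePreserving (swapVertices b i j) (volume : Measure (Pt d)) volume := by
  set ℓ : Pt d →ₗ[ℝ] ℝ := (b.coord i).linear - (b.coord j).linear
  set A : Pt d →ₗ[ℝ] Pt d := LinearMap.id + ℓ.smulRight (b j - b i) with hA
  have hs : ∀ x, swapVertices b i j x = A x + swapVertices b i j 0 := fun x => by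
    have h : ∀ k, b.coord k x = (b.coord k).linear x + b.coord k 0 := fun k => by
      simpa using (b.coord k).map_vadd 0 x
    simp only [swapVertices, hA, LinearMap.add_apply, LinearMap.id_apply,
      LinearMap.smulRight_apply, h i, h j, ℓ, LinearMap.sub_apply]
    module
  have hinv : A ∘ₗ A = LinearMap.id := by
    ext1 x
    have h1 := swapVertices_involutive b i j x
    have h0 := swapVertices_involutive b i j 0
    rw [hs, hs x, map_add] at h1
    rw [hs] at h0
    rwa [add_assoc, h0, add_zero] at h1
  have hdet : |LinearMap.det A| = 1 := by
    have := congrArg LinearMap.det hinv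
    rw [LinearMap.det_comp, LinearMap.det_id] at this
    have h2 : |LinearMap.det A| * |LinearMap.det A| = 1 := by rw [← abs_mul, this, abs_one]
    nlinarith [abs_nonneg (LinearMap.det A)]
  have hAm : MeasurePreserving A (volume : Measure (Pt d)) volume := by
    refine ⟨A.continuous_of_finiteDimensional.measurable, ?_⟩
    rw [Measure.map_linearMap_addHaar_eq_smul_addHaar _ (fun h => by simp [h] at hdet)]
    rw [abs_inv, hdet]; simp
  have := (measurePreserving_add_right (volume : Measure (Pt d)) (swapVertices b i j 0)).comp hAm
  convert! this using 1
  ext1 x; exact hs x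

end swap

/-- Exchanging two vertices preserves volume, maps the cell to itself and exchanges the two
barycentric coordinates. -/
lemma integral_coord_eq (hK : K ∈ 𝒯.cells) (i j : K) :
    ∫ x in openCell K, (cellBasis hK).coord i x = ∫ x in openCell K, (cellBasis hK).coord j x := by
  classical
  set b := cellBasis hK
  have hpre : swapVertices b i j ⁻¹' openCell K = openCell K := by
    ext x
    simp only [mem_preimage, mem_openCell_iff hK]
    refine ⟨fun h k => ?_, fun h k => ?_⟩
    · have := h (Equiv.swap i j k)
      rwa [coord_swapVertices, Equiv.swap_apply_self] at this
    · rw [coord_swapVertices]; exact h _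
  have hemb : MeasurableEmbedding (swapVertices b i j) :=
    (Homeomorph.mk ((swapVertices_involutive b i j).toPerm) (continuous_swapVertices b i j)
      (continuous_swapVertices b i j)).measurableEmbedding
  have := (measurePreserving_swapVertices b i j).setIntegral_preimage_emb hemb
    (b.coord i) (openCell K)
  rw [hpre] at this
  rw [← this]
  refine setIntegral_congr_fun (isOpen_openCell K).measurableSet fun x _ => ?_
  simp [coord_swapVertices]

lemma affine_eq_sum_coord {ι : Type*} [Fintype ι] (b : AffineBasis ι ℝ (Pt d)) (A : Pt d →ᵃ[ℝ] ℝ)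
    (x : Pt d) : A x = ∑ i, b.coord i x * A (b i) := by
  conv_lhs => rw [← b.affineCombination_coord_eq_self x]
  rw [Finset.map_affineCombination _ _ _ (b.sum_coord_apply_eq_one x),
    Finset.affineCombination_eq_linear_combination _ _ _ (b.sum_coord_apply_eq_one x)]
  simp

/-- The integral of an affine function over a simplex is given by its value at the barycenter. -/
lemma integral_affine_openCell (hK : K ∈ 𝒯.cells) (A : Pt d →ᵃ[ℝ] ℝ) :
    ∫ x in openCell K, A x = volume.real (openCell K) * A (barycenter K) := by
  set b := cellBasis hK
  have hint : ∀ i, IntegrableOn (b.coord i) (openCell K) := fun i =>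
    ((continuous_barycentric_coord b i).continuousOn.integrableOn_compact
      (isCompact_convexHull K)).mono_set (openCell_subset K)
  have i₀ : K := b.nonempty.some
  have hI : ∀ i, ∫ x in openCell K, b.coord i x = ∫ x in openCell K, b.coord i₀ x :=
    fun i => integral_coord_eq hK i i₀
  have hsum : ∀ B : Pt d →ᵃ[ℝ] ℝ,
      ∫ x in openCell K, B x = (∫ x in openCell K, b.coord i₀ x) * ∑ i, B (b i) := fun B => by
    rw [integral_congr_ae (.of_forall fun x => affine_eq_sum_coord b B x),
      integral_finsetSum _ fun i _ => (hint i).mul_const _]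
    simp_rw [integral_mul_const, hI, Finset.mul_sum]
  -- The constant function 1 identifies the common integral of the barycentric coordinates as `|K| /
  -- (d + 1)`.
  have h1 := hsum (AffineMap.const ℝ (Pt d) 1)
  have hcard : Fintype.card K = d + 1 := by simp [(Mesh.mem_cells.1 hK).2]
  have hpos : (0 : ℝ) < d + 1 := by positivity
  simp only [AffineMap.const_apply, integral_const, Finset.sum_const, Finset.card_univ, hcard,
    smul_eq_mul, mul_one, nsmul_eq_mul, Nat.cast_add, Nat.cast_one, measureReal_restrict_apply_univ]
    at h1
  have hθ : ∀ i, b.coord i (barycenter K) = (d + 1 : ℝ)⁻¹ := fun i => by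
    have e : Finset.univ.centroid ℝ b = barycenter K := Finset.centroid_univ ℝ K
    rw [← e, b.coord_apply_centroid (Finset.mem_univ i), Finset.card_univ, hcard]
    simp
  rw [hsum, h1, affine_eq_sum_coord b A (barycenter K)]
  simp_rw [hθ, ← Finset.mul_sum]
  field_simp

lemma integral_openCell_of_isPiecewisePoly_one {f : Pt d → ℝ} (hf : IsPiecewisePoly 𝒯 1 f)
    (hK : K ∈ 𝒯.cells) :
    ∫ x in openCell K, f x = volume.real (openCell K) * f (barycenter K) := by
  obtain ⟨P, hP, h⟩ := hf K hK
  obtain ⟨A, hA⟩ := exists_affine_of_totalDegree_le_one P hP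
  rw [h _ (barycenter_mem_openCell hK), hA, ← integral_affine_openCell hK]
  exact setIntegral_congr_fun (isOpen_openCell K).measurableSet fun x hx => by
    rw [h x hx, hA]

/-! ### Lipschitz functions from finite closed covers -/

/-- The space is convex although the pieces need not be. Along a segment, every piece that contains
`γ s` for `s` slightly larger than `t` already contains `γ t`, because there are finitely many
pieces and they are closed. So right slopes are bounded by the Lipschitz constant, and the mean
value inequality applies without differentiability. -/
lemma lipschitzWith_of_finite_closed_cover {E F : Type*} [NormedAddCommGroup E] [NormedSpace ℝ E]
    [NormedAddCommGroup F] {f : E → F} (hf : Continuous f) {S : Set (Set E)} (hS : S.Finite)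
    (hcl : ∀ C ∈ S, IsClosed C) (hcov : ∀ x, ∃ C ∈ S, x ∈ C) {M : NNReal}
    (hM : ∀ C ∈ S, LipschitzOnWith M f C) : LipschitzWith M f := by
  refine LipschitzWith.of_dist_le_mul fun x y => ?_
  set γ : ℝ → E := fun t => x + t • (y - x) with hγ
  have hγc : Continuous γ := by fun_prop
  have hγd : ∀ s t, dist (γ s) (γ t) = |s - t| * dist x y := fun s t => by
    simp only [hγ, dist_eq_norm]
    rw [add_sub_add_left_eq_sub, ← sub_smul, norm_smul, Real.norm_eq_abs, norm_sub_rev x y]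
  have hcont : Continuous fun t => dist (f (γ t)) (f x) := by fun_prop
  have key := image_le_of_liminf_slope_right_le_deriv_boundary
    (f := fun t => dist (f (γ t)) (f x)) (a := 0) (b := 1) hcont.continuousOn
    (B := fun t => (M * dist x y) * t) (B' := fun _ => M * dist x y) (by simp [hγ])
    (by fun_prop) (fun t _ => by simpa using ((hasDerivAt_id t).const_mul _).hasDerivWithinAt) ?_
  · have := key (right_mem_Icc.2 zero_le_one)
    simpa [hγ, dist_comm] using this
  intro t _ r hr
  have hev : ∀ᶠ s in 𝓝[>] t, ∀ C ∈ S, γ t ∉ C → γ s ∉ C := by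
    refine (eventually_all_finite hS).2 fun C hC => ?_
    by_cases h : γ t ∈ C
    · simp [h]
    · filter_upwards [nhdsWithin_le_nhds
        (hγc.continuousAt.preimage_mem_nhds ((hcl C hC).isOpen_compl.mem_nhds h))] with s hs _
      exact hs
  refine Eventually.frequently ?_
  filter_upwards [hev, self_mem_nhdsWithin] with s hs hts
  obtain ⟨C, hC, hsC⟩ := hcov (γ s)
  have htC : γ t ∈ C := by
    by_contra h
    exact hs C hC h hsC
  have hst : 0 < s - t := sub_pos.2 hts
  have h1 := (hM C hC).dist_le_mul _ hsC _ htC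
  rw [hγd, abs_of_pos hst] at h1
  have h2 := dist_triangle (f (γ s)) (f (γ t)) (f x)
  rw [slope_def_field, div_lt_iff₀ hst]
  nlinarith

/-! ### Velocity fields -/

/-- The vector field with polynomial components `P`. -/
def polyField (P : Fin d → MvPolynomial (Fin d) ℝ) (x : Pt d) : Pt d :=
  WithLp.toLp 2 fun i => MvPolynomial.eval (fun j => x j) (P i)

lemma contDiff_polyField (P : Fin d → MvPolynomial (Fin d) ℝ) (n : ℕ∞) :
    ContDiff ℝ n (polyField P) :=
  contDiff_euclidean.2 fun i => contDiff_eval (P i) n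

lemma grad_polyField (P : Fin d → MvPolynomial (Fin d) ℝ) (x : Pt d) (i j : Fin d) :
    grad (polyField P) x i j = MvPolynomial.eval (fun k => x k) (MvPolynomial.pderiv j (P i)) := by
  have h : HasFDerivAt (fun y => polyField P y i)
      ((EuclideanSpace.proj i : Pt d →L[ℝ] ℝ) ∘L fderiv ℝ (polyField P) x) x :=
    (EuclideanSpace.proj i : Pt d →L[ℝ] ℝ).hasFDerivAt.comp x
      ((contDiff_polyField P 1).differentiable one_ne_zero x).hasFDerivAt
  have h2 := congrArg (fun A : Pt d →L[ℝ] ℝ => A (EuclideanSpace.single j 1))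
    (h.unique (hasFDerivAt_eval (P i) x))
  simp only [ContinuousLinearMap.comp_apply, sum_apply, smul_apply, smul_eq_mul] at h2
  refine h2.trans ?_
  rw [Finset.sum_eq_single j]
  · simp
  · intro k _ hk; simp [hk]
  · simp

/-- Continuity extends the polynomial formula from the open cell to its closure; the values on
facets are needed for the fluxes. -/
lemma exists_polyField_of_mem_velocitySpace {u : Pt d → Pt d} (hu : u ∈ velocitySpace 𝒯)
    (hK : K ∈ 𝒯.cells) : ∃ P : Fin d → MvPolynomial (Fin d) ℝ, (∀ i, (P i).totalDegree ≤ 2) ∧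
      EqOn u (polyField P) (convexHull ℝ (K : Set (Pt d))) := by
  choose P hP h using fun i => hu.2.1 i K hK
  refine ⟨P, hP, ?_⟩
  have h1 : EqOn u (polyField P) (openCell K) := fun x hx => by ext i; exact h i x hx
  rw [← closure_openCell hK]
  refine h1.of_subset_closure ?_ (contDiff_polyField P 0).continuous.continuousOn subset_closure
    Subset.rfl
  rw [closure_openCell hK]
  exact hu.1.mono (𝒯.convexHull_subset_space (Mesh.mem_cells.1 hK).1)

lemma fderiv_eq_of_eqOn_openCell {E : Type*} [NormedAddCommGroup E] [NormedSpace ℝ E]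
    {u v : Pt d → E} (h : EqOn u v (openCell K)) {x : Pt d} (hx : x ∈ openCell K) :
    fderiv ℝ u x = fderiv ℝ v x :=
  (h.eventuallyEq_of_mem ((isOpen_openCell K).mem_nhds hx)).fderiv_eq

lemma grad_eq_of_eqOn_openCell {u v : Pt d → Pt d} (h : EqOn u v (openCell K)) {x : Pt d}
    (hx : x ∈ openCell K) : grad u x = grad v x := by
  rw [grad, grad, fderiv_eq_of_eqOn_openCell h hx]

section velocity

variable {u : Pt d → Pt d}

lemma isPiecewiseCont_velocity (hu : u ∈ velocitySpace 𝒯) : IsPiecewiseCont 𝒯 u := fun K hK => by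
  obtain ⟨P, -, h⟩ := exists_polyField_of_mem_velocitySpace hu hK
  exact ⟨_, (contDiff_polyField P 0).continuous, h.mono (openCell_subset K)⟩

lemma isPiecewiseCont_fderiv (hu : u ∈ velocitySpace 𝒯) : IsPiecewiseCont 𝒯 (fderiv ℝ u) :=
  fun K hK => by
  obtain ⟨P, -, h⟩ := exists_polyField_of_mem_velocitySpace hu hK
  exact ⟨fderiv ℝ (polyField P), (contDiff_polyField P 1).continuous_fderiv one_ne_zero,
    fun x hx => fderiv_eq_of_eqOn_openCell (h.mono (openCell_subset K)) hx⟩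

lemma isPiecewiseCont_grad (hu : u ∈ velocitySpace 𝒯) : IsPiecewiseCont 𝒯 (grad u) := by
  refine (isPiecewiseCont_fderiv hu).comp
    (H := fun A => Matrix.of fun i j => (A (EuclideanSpace.single j 1)) i) ?_
  refine continuous_matrix fun i j => ?_
  exact ((EuclideanSpace.proj i : Pt d →L[ℝ] ℝ).continuous).comp
    (ContinuousLinearMap.apply ℝ (Pt d) (EuclideanSpace.single j (1 : ℝ))).continuous

lemma isPiecewiseCont_diverg (hu : u ∈ velocitySpace 𝒯) : IsPiecewiseCont 𝒯 (diverg u) :=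
  (isPiecewiseCont_grad hu).comp (H := Matrix.trace) (by fun_prop)

/-- Differentiation lowers the degree from 2 to 1, and the pressures need not be continuous. So `div
u` is itself an admissible test pressure. -/
lemma diverg_mem_pressureSpace (hu : u ∈ velocitySpace 𝒯) : diverg u ∈ pressureSpace 𝒯 := by
  intro K hK
  obtain ⟨P, hP, h⟩ := exists_polyField_of_mem_velocitySpace hu hK
  refine ⟨∑ i, MvPolynomial.pderiv i (P i), ?_, fun x hx => ?_⟩
  · exact MvPolynomial.totalDegree_finsetSum_le fun i _ => totalDegree_pderiv_le i _ (hP i)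
  · rw [diverg, grad_eq_of_eqOn_openCell (h.mono (openCell_subset K)) hx, map_sum]
    exact Finset.sum_congr rfl fun i _ => grad_polyField P x i i

/-- Since `div` maps the velocity space to the pressure space, discretely divergence free fields
are divergence free. -/
lemma IsDiscretelyDivFree.diverg_ae_eq_zero (hdiv : IsDiscretelyDivFree 𝒯 u)
    (hu : u ∈ velocitySpace 𝒯) : ∀ᵐ x ∂(volume.restrict 𝒯.domain), diverg u x = 0 := by
  have h := hdiv _ (diverg_mem_pressureSpace hu)
  rw [integral_eq_zero_iff_of_nonneg (fun x => mul_self_nonneg _)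
    ((isPiecewiseCont_diverg hu).mul (isPiecewiseCont_diverg hu)).integrableOn_domain] at h
  filter_upwards [h] with x hx
  simpa using hx

/-- Extension by zero outside the closed domain. -/
def zeroExt (𝒯 : Mesh d) (u : Pt d → Pt d) : Pt d → Pt d := 𝒯.space.indicator u

lemma zeroExt_of_mem {x : Pt d} (hx : x ∈ 𝒯.space) : zeroExt 𝒯 u x = u x := indicator_of_mem hx u

lemma frontier_space (𝒯 : Mesh d) : frontier 𝒯.space = frontier 𝒯.domain := by
  rw [frontier_domain, (isCompact_space 𝒯).isClosed.frontier_eq]; rfl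

lemma zeroExt_of_notMem_domain (hu : u ∈ velocitySpace 𝒯) {x : Pt d} (hx : x ∉ 𝒯.domain) :
    zeroExt 𝒯 u x = 0 := by
  by_cases h : x ∈ 𝒯.space
  · rw [zeroExt_of_mem h]
    exact hu.2.2 x (by rw [frontier_domain]; exact ⟨h, hx⟩)
  · exact indicator_of_notMem h u

lemma continuous_zeroExt (hu : u ∈ velocitySpace 𝒯) : Continuous (zeroExt 𝒯 u) := by
  refine continuous_indicator (fun x hx => hu.2.2 x ?_) ?_
  · rwa [← frontier_space]
  · rw [(isCompact_space 𝒯).isClosed.closure_eq]; exact hu.1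

lemma hasCompactSupport_zeroExt (𝒯 : Mesh d) (u : Pt d → Pt d) :
    HasCompactSupport (zeroExt 𝒯 u) :=
  HasCompactSupport.intro (isCompact_space 𝒯) fun _ hx => indicator_of_notMem hx u

lemma exists_lipschitzWith_zeroExt (hu : u ∈ velocitySpace 𝒯) :
    ∃ M, LipschitzWith M (zeroExt 𝒯 u) := by
  have hcell : ∀ K ∈ 𝒯.cells, ∃ M, LipschitzOnWith M (zeroExt 𝒯 u)
      (convexHull ℝ (K : Set (Pt d))) := fun K hK => by
    obtain ⟨P, -, h⟩ := exists_polyField_of_mem_velocitySpace hu hK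
    obtain ⟨M, hM⟩ := (contDiff_polyField P 1).contDiffOn.exists_lipschitzOnWith one_ne_zero
      (convex_convexHull ℝ (K : Set (Pt d))) (isCompact_convexHull K)
    have he : ∀ x ∈ convexHull ℝ (K : Set (Pt d)), zeroExt 𝒯 u x = polyField P x := fun x hx => by
      rw [zeroExt_of_mem (𝒯.convexHull_subset_space (Mesh.mem_cells.1 hK).1 hx), h hx]
    exact ⟨M, fun x hx y hy => by rw [he x hx, he y hy]; exact hM hx hy⟩
  choose! M hM using hcell
  refine ⟨𝒯.cells.sup M, lipschitzWith_of_finite_closed_cover (continuous_zeroExt hu)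
    -- The complement of the domain is added to the cells: it is closed, and the extension vanishes
    -- there, on the boundary by the no-slip condition.
    (S := insert 𝒯.domainᶜ ((fun K : Finset (Pt d) => convexHull ℝ (K : Set (Pt d))) '' 𝒯.cells))
    ((𝒯.cells.finite_toSet.image _).insert _) ?_ ?_ ?_⟩
  · rintro C (rfl | ⟨K, hK, rfl⟩)
    · exact (isOpen_domain 𝒯).isClosed_compl
    · exact isClosed_convexHull K
  · intro x
    by_cases h : x ∈ 𝒯.domain
    · have h' := domain_subset_space 𝒯 h
      rw [space_eq] at h'
      simp only [mem_iUnion, exists_prop] at h'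
      obtain ⟨K, hK, hx⟩ := h'
      exact ⟨_, Or.inr ⟨K, hK, rfl⟩, hx⟩
    · exact ⟨_, Or.inl rfl, h⟩
  · rintro C (rfl | ⟨K, hK, rfl⟩)
    · intro x hx y hy
      rw [zeroExt_of_notMem_domain hu hx, zeroExt_of_notMem_domain hu hy]
      simp
    · exact (hM K hK).weaken (Finset.le_sup (f := M) hK)

lemma eqOn_zeroExt_openCell (hK : K ∈ 𝒯.cells) : EqOn (zeroExt 𝒯 u) u (openCell K) :=
  fun _ hx => zeroExt_of_mem (domain_subset_space 𝒯 (openCell_subset_domain hK hx))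

lemma diverg_zeroExt_ae_eq_zero (h : ∀ᵐ x ∂(volume.restrict 𝒯.domain), diverg u x = 0) :
    ∀ᵐ x, diverg (zeroExt 𝒯 u) x = 0 := by
  rw [ae_restrict_iff' (isOpen_domain 𝒯).measurableSet] at h
  have h' : ∀ᵐ x : Pt d, x ∉ 𝒯.space \ ⋃ K ∈ 𝒯.cells, openCell K :=
    measure_eq_zero_iff_ae_notMem.1 (volume_space_diff 𝒯)
  filter_upwards [h, h'] with x hx hx'
  by_cases hs : x ∈ 𝒯.space
  · have : x ∈ ⋃ K ∈ 𝒯.cells, openCell K := by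
      by_contra hc
      exact hx' ⟨hs, hc⟩
    simp only [mem_iUnion, exists_prop] at this
    obtain ⟨K, hK, hxK⟩ := this
    rw [diverg, grad_eq_of_eqOn_openCell (eqOn_zeroExt_openCell hK) hxK]
    exact hx (openCell_subset_domain hK hxK)
  · have : zeroExt 𝒯 u =ᶠ[𝓝 x] fun _ => 0 := by
      filter_upwards [(isCompact_space 𝒯).isClosed.isOpen_compl.mem_nhds hs] with y hy
      exact indicator_of_notMem hy u
    simp [diverg, grad, this.fderiv_eq, Matrix.trace]

end velocity

/-! ### Integration by parts -/

/-- A Lipschitz divergence free field with compact support is orthogonal to gradients. -/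
lemma integral_fderiv_apply_eq_zero {W : Pt d → Pt d} {M : NNReal} (hW : LipschitzWith M W)
    (hWc : HasCompactSupport W) (hdiv : ∀ᵐ x, diverg W x = 0) {g : Pt d → ℝ} {N : NNReal}
    (hg : LipschitzWith N g) (hgc : HasCompactSupport g) : ∫ x, fderiv ℝ g x (W x) = 0 := by
  have hWi : ∀ i, LipschitzWith M fun x => W x i := fun i =>
    LipschitzWith.of_dist_le_mul fun x y =>
      (EuclideanSpace.dist_eq (W x) (W y) ▸ Real.le_sqrt_of_sq_le (by
        exact Finset.single_le_sum (f := fun i => dist (W x i) (W y i) ^ 2)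
          (fun _ _ => sq_nonneg _) (Finset.mem_univ i))).trans (hW.dist_le_mul x y)
  have hWic : ∀ i, HasCompactSupport fun x => W x i := fun i =>
    hWc.comp_left (g := fun v : Pt d => v i) rfl
  set e : Fin d → Pt d := fun i => EuclideanSpace.single i 1
  -- Integration by parts for Lipschitz functions, one coordinate direction at a time; Rademacher's
  -- theorem later reassembles the line derivatives into `∇g · W` and `div W`.
  have hparts : ∀ i, ∫ x, lineDeriv ℝ g x (e i) * W x i =
      - ∫ x, lineDeriv ℝ (fun y => W y i) x (e i) * g x := fun i => by
    rw [hg.integral_lineDeriv_mul_eq (hWi i) (hWic i), ← integral_neg]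
    simp [lineDeriv_neg]
  have hint1 : ∀ i, Integrable fun x => lineDeriv ℝ g x (e i) * W x i := fun i => by
    refine Integrable.bdd_mul (c := N * ‖e i‖) ((hWi i).continuous.integrable_of_hasCompactSupport (hWic i))
      (hg.memLp_lineDeriv (μ := volume) (e i)).1 (.of_forall fun x => norm_lineDeriv_le_of_lipschitz ℝ hg)
  have hint2 : ∀ i, Integrable fun x => lineDeriv ℝ (fun y => W y i) x (e i) * g x := fun i => by
    refine Integrable.bdd_mul (c := M * ‖e i‖) (hg.continuous.integrable_of_hasCompactSupport hgc)
      ((hWi i).memLp_lineDeriv (μ := volume) (e i)).1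
      (.of_forall fun x => norm_lineDeriv_le_of_lipschitz ℝ (hWi i))
  have h1 : ∀ᵐ x, fderiv ℝ g x (W x) = ∑ i, lineDeriv ℝ g x (e i) * W x i := by
    filter_upwards [hg.ae_differentiableAt] with x hx
    simp_rw [fun i => hx.lineDeriv_eq_fderiv (v := e i)]
    conv_lhs => rw [← (EuclideanSpace.basisFun (Fin d) ℝ).sum_repr (W x)]
    simp [e, mul_comm]
  have h2 : ∀ᵐ x, ∑ i, lineDeriv ℝ (fun y => W y i) x (e i) * g x = 0 := by
    filter_upwards [hdiv, hW.ae_differentiableAt] with x hx hd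
    rw [← Finset.sum_mul]
    have : ∀ i, lineDeriv ℝ (fun y => W y i) x (e i) = grad W x i i := fun i => by
      have h : HasFDerivAt (fun y => W y i)
          ((EuclideanSpace.proj i : Pt d →L[ℝ] ℝ) ∘L fderiv ℝ W x) x :=
        (EuclideanSpace.proj i : Pt d →L[ℝ] ℝ).hasFDerivAt.comp x hd.hasFDerivAt
      exact (h.hasLineDerivAt (e i)).lineDeriv
    simp_rw [this]
    rw [show ∑ i, grad W x i i = diverg W x from rfl, hx, zero_mul]
  rw [integral_congr_ae h1, integral_finsetSum _ fun i _ => hint1 i]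
  simp_rw [hparts]
  rw [Finset.sum_neg_distrib, ← integral_finsetSum _ fun i _ => hint2 i, integral_congr_ae h2]
  simp

/-! ### Flows of divergence free Lipschitz fields preserve the volume -/

/-- `Φ` is the forward flow of `W` on `[0, τ]`. -/
structure IsFlow (W : Pt d → Pt d) (τ : ℝ) (Φ : ℝ → Pt d → Pt d) : Prop where
  zero : ∀ x, Φ 0 x = x
  deriv : ∀ x, ∀ t ∈ Icc 0 τ, HasDerivWithinAt (fun r => Φ r x) (W (Φ t x)) (Icc 0 τ) t

namespace IsFlow

variable {W : Pt d → Pt d} {τ : ℝ} {Φ : ℝ → Pt d → Pt d} {M : NNReal}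

lemma continuousOn (h : IsFlow W τ Φ) (x : Pt d) : ContinuousOn (fun r => Φ r x) (Icc 0 τ) :=
  fun t ht => (h.deriv x t ht).continuousWithinAt

lemma deriv_right (h : IsFlow W τ Φ) (x : Pt d) {t : ℝ} (ht : t ∈ Ico 0 τ) :
    HasDerivWithinAt (fun r => Φ r x) (W (Φ t x)) (Ici t) t :=
  (h.deriv x t (Ico_subset_Icc_self ht)).mono_of_mem_nhdsWithin (Icc_mem_nhdsGE_of_mem ht)

lemma dist_le (h : IsFlow W τ Φ) (hW : LipschitzWith M W) (x y : Pt d) {t : ℝ}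
    (ht : t ∈ Icc 0 τ) : dist (Φ t x) (Φ t y) ≤ dist x y * Real.exp (M * t) := by
  have := dist_le_of_trajectories_ODE (v := fun _ => W) (fun _ => hW) (h.continuousOn x)
    (fun t ht => h.deriv_right x ht) (h.continuousOn y) (fun t ht => h.deriv_right y ht)
    (δ := dist x y) (by rw [h.zero, h.zero]) t ht
  simpa using this

lemma lipschitzWith (h : IsFlow W τ Φ) (hW : LipschitzWith M W) {t : ℝ} (ht : t ∈ Icc 0 τ) :
    LipschitzWith (Real.exp (M * t)).toNNReal (Φ t) :=
  LipschitzWith.of_dist_le_mul fun x y => by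
    rw [Real.coe_toNNReal _ (Real.exp_nonneg _), mul_comm]
    exact h.dist_le hW x y ht

/-- Both sides solve the same autonomous equation with the same value at `s = 0`, so uniqueness for
a Lipschitz field applies. -/
lemma add (h : IsFlow W τ Φ) (hW : LipschitzWith M W) (x : Pt d) {t s : ℝ} (ht : 0 ≤ t)
    (hs : 0 ≤ s) (hts : t + s ≤ τ) : Φ (t + s) x = Φ s (Φ t x) := by
  have hsub : Icc 0 s ⊆ Icc 0 τ := Icc_subset_Icc_right (by linarith)
  have hmaps : MapsTo (fun r => t + r) (Icc 0 s) (Icc 0 τ) := fun r hr =>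
    ⟨add_nonneg ht hr.1, by linarith [hr.2]⟩
  refine ODE_solution_unique (v := fun _ => W) (f := fun r => Φ (t + r) x)
    (g := fun r => Φ r (Φ t x)) (a := 0) (b := s) (fun _ => hW) ?_ ?_ ?_ ?_ ?_ ⟨hs, le_rfl⟩
  · exact (h.continuousOn x).comp (by fun_prop) hmaps
  · intro r hr
    have h1 := h.deriv_right x (t := t + r) ⟨add_nonneg ht hr.1, by linarith [hr.2]⟩
    have h2 : HasDerivWithinAt (fun r => t + r) 1 (Ici r) r :=
      ((hasDerivAt_id r).const_add t).hasDerivWithinAt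
    have h3 := h1.scomp r h2 (fun y hy => add_le_add_right hy t)
    rw [one_smul] at h3
    exact h3
  · exact (h.continuousOn _).mono hsub
  · exact fun r hr => h.deriv_right _ ⟨hr.1, by linarith [hr.2]⟩
  · simp [h.zero]

lemma eq_self (h : IsFlow W τ Φ) (hW : LipschitzWith M W) {x : Pt d} (hx : W x = 0) {t : ℝ}
    (ht : t ∈ Icc 0 τ) : Φ t x = x := by
  refine ODE_solution_unique (v := fun _ => W) (f := fun r => Φ r x) (g := fun _ => x)
    (fun _ => hW) (h.continuousOn x) (fun r hr => h.deriv_right x hr) continuousOn_const ?_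
    (h.zero x) ht
  intro r _
  rw [hx]
  exact hasDerivWithinAt_const _ _ _

lemma norm_sub_le (h : IsFlow W τ Φ) {B : ℝ} (hB : ∀ x, ‖W x‖ ≤ B) (x : Pt d) {t : ℝ}
    (ht : t ∈ Icc 0 τ) : ‖Φ t x - x‖ ≤ B * t := by
  have := norm_image_sub_le_of_norm_deriv_right_le_segment (h.continuousOn x)
    (fun r hr => h.deriv_right x hr) (fun r _ => hB _) t ht
  simpa [h.zero] using this

lemma comp_eq_zero (h : IsFlow W τ Φ) (hW : LipschitzWith M W) {f : Pt d → ℝ} {t : ℝ}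
    (ht : t ∈ Icc 0 τ) {x : Pt d} (hx : x ∉ tsupport f ∪ tsupport W) : f (Φ t x) = 0 := by
  rw [mem_union, not_or] at hx
  rw [h.eq_self hW (image_eq_zero_of_notMem_tsupport hx.2) ht,
    image_eq_zero_of_notMem_tsupport hx.1]

section integral

variable (h : IsFlow W τ Φ) (hW : LipschitzWith M W) (hWc : HasCompactSupport W)
  {f : Pt d → ℝ} {N : NNReal} (hf : LipschitzWith N f) (hfc : HasCompactSupport f)
include h hW hWc

include hfc in
lemma hasCompactSupport_comp {t : ℝ} (ht : t ∈ Icc 0 τ) : HasCompactSupport fun x => f (Φ t x) :=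
  HasCompactSupport.intro (hfc.isCompact.union hWc.isCompact) fun _ hx =>
    h.comp_eq_zero hW ht hx

include hf hfc in
lemma integrable_comp {t : ℝ} (ht : t ∈ Icc 0 τ) : Integrable fun x => f (Φ t x) :=
  (hf.continuous.comp (h.lipschitzWith hW ht).continuous).integrable_of_hasCompactSupport
    (h.hasCompactSupport_comp hW hWc hfc ht)

include hf hfc in
lemma continuousOn_integral : ContinuousOn (fun t => ∫ x, f (Φ t x)) (Icc 0 τ) := by
  obtain ⟨B, hB⟩ := hfc.exists_bound_of_continuous hf.continuous
  have hS := hfc.isCompact.union hWc.isCompact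
  refine continuousOn_of_dominated
    (bound := (tsupport f ∪ tsupport W).indicator fun _ => B) ?_ ?_ ?_ ?_
  · exact fun t ht => (h.integrable_comp hW hWc hf hfc ht).1
  · refine fun t ht => .of_forall fun x => ?_
    by_cases hx : x ∈ tsupport f ∪ tsupport W
    · rw [indicator_of_mem hx]; exact hB _
    · rw [indicator_of_notMem hx, h.comp_eq_zero hW ht hx, norm_zero]
  · exact (integrable_indicator_iff hS.measurableSet).2
      (continuous_const.continuousOn.integrableOn_compact hS)
  · exact .of_forall fun x => hf.continuous.comp_continuousOn (h.continuousOn x)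

/-- The difference quotients converge to `∇g · W` wherever `g` is differentiable, hence almost
everywhere. They are bounded by `N B` on the support of `W` and vanish off it, where points do not
move. The limit `∫ ∇g · W` is zero by integration by parts. -/
lemma tendsto_integral_slope (hdiv : ∀ᵐ x, diverg W x = 0) (hτ : 0 < τ) {g : Pt d → ℝ}
    (hg : LipschitzWith N g) (hgc : HasCompactSupport g) :
    Tendsto (fun s => ∫ x, s⁻¹ * (g (Φ s x) - g x)) (𝓝[>] 0) (𝓝 0) := by
  obtain ⟨B, hB⟩ := hWc.exists_bound_of_continuous hW.continuous
  have hmem : ∀ᶠ s in 𝓝[>] (0 : ℝ), s ∈ Ioc 0 τ := Ioc_mem_nhdsGT hτ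
  suffices Tendsto (fun s => ∫ x, s⁻¹ * (g (Φ s x) - g x)) (𝓝[>] 0)
      (𝓝 (∫ x, fderiv ℝ g x (W x))) by
    rwa [integral_fderiv_apply_eq_zero hW hWc hdiv hg hgc] at this
  refine tendsto_integral_filter_of_dominated_convergence
    ((tsupport W).indicator fun _ => N * B) ?_ ?_ ?_ ?_
  · filter_upwards [hmem] with s hs
    exact ((((hg.continuous.comp (h.lipschitzWith hW (Ioc_subset_Icc_self hs)).continuous).sub
      hg.continuous).const_mul _)).aestronglyMeasurable
  · filter_upwards [hmem] with s hs
    refine .of_forall fun x => ?_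
    by_cases hx : x ∈ tsupport W
    · rw [indicator_of_mem hx, norm_mul, norm_inv, Real.norm_of_nonneg hs.1.le,
        inv_mul_le_iff₀ hs.1]
      have h1 := hg.norm_sub_le (Φ s x) x
      have h2 := h.norm_sub_le hB x (Ioc_subset_Icc_self hs)
      calc _ ≤ _ := h1
        _ ≤ N * (B * s) := by gcongr
        _ = _ := by ring
    · rw [indicator_of_notMem hx, h.eq_self hW (image_eq_zero_of_notMem_tsupport hx)
        (Ioc_subset_Icc_self hs)]
      simp
  · exact (integrable_indicator_iff (isClosed_tsupport W).measurableSet).2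
      (continuous_const.continuousOn.integrableOn_compact hWc.isCompact)
  · filter_upwards [hg.ae_differentiableAt] with x hx
    have h1 := h.deriv_right x (t := 0) ⟨le_rfl, hτ⟩
    rw [h.zero] at h1
    have h2 : HasFDerivAt g (fderiv ℝ g x) (Φ 0 x) := by rw [h.zero]; exact hx.hasFDerivAt
    have h3 := h2.comp_hasDerivWithinAt (0 : ℝ) h1
    have h4 := hasDerivWithinAt_iff_tendsto_slope.1 h3
    rw [Ici_sdiff_left] at h4
    refine h4.congr fun s => ?_
    simp [slope_def_field, h.zero, div_eq_inv_mul]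

include hf hfc in
/-- The flow of a divergence free Lipschitz field preserves integrals. -/
lemma integral_comp_eq (hdiv : ∀ᵐ x, diverg W x = 0) {t : ℝ} (ht : t ∈ Icc 0 τ) :
    ∫ x, f (Φ t x) = ∫ x, f x := by
  have := constant_of_has_deriv_right_zero (h.continuousOn_integral hW hWc hf hfc) ?_ t ht
  · simpa [h.zero] using this
  intro s hs
  have hs' := Ico_subset_Icc_self hs
  -- By the semigroup law `f ∘ Φ_r = (f ∘ Φ_s) ∘ Φ_{r - s}`, so the right derivative at `s` is the
  -- one at time 0 for the Lipschitz function `f ∘ Φ_s`. Only Lipschitz dependence on the initial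
  -- point is used, never differentiability of the flow.
  have hflow : IsFlow W (τ - s) Φ := ⟨h.zero, fun x r hr => by
    have hsub : Icc 0 (τ - s) ⊆ Icc 0 τ := Icc_subset_Icc_right (by linarith [hs.1])
    exact (h.deriv x r (hsub hr)).mono hsub⟩
  have hsl := hflow.tendsto_integral_slope hW hWc hdiv (sub_pos.2 hs.2)
    (hf.comp (h.lipschitzWith hW hs')) (h.hasCompactSupport_comp hW hWc hfc hs')
  rw [hasDerivWithinAt_iff_tendsto_slope, Ici_sdiff_left]
  have hshift : Tendsto (fun r => r - s) (𝓝[>] s) (𝓝[>] 0) := by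
    refine tendsto_nhdsWithin_iff.2 ⟨?_, ?_⟩
    · have : Tendsto (fun r => r - s) (𝓝 s) (𝓝 (s - s)) := (continuous_id.sub continuous_const).tendsto s
      rw [sub_self] at this
      exact this.mono_left nhdsWithin_le_nhds
    · filter_upwards [self_mem_nhdsWithin] with r hr
      exact sub_pos.2 (mem_Ioi.1 hr)
  refine (hsl.comp hshift).congr' ?_
  filter_upwards [Ioc_mem_nhdsGT hs.2] with r hr
  have hr' : r ∈ Icc 0 τ := ⟨hs.1.trans hr.1.le, hr.2⟩
  simp only [Function.comp_apply]
  rw [integral_const_mul, slope_def_field, div_eq_inv_mul, ← integral_sub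
    (h.integrable_comp hW hWc hf hfc hr') (h.integrable_comp hW hWc hf hfc hs')]
  congr 1
  refine integral_congr_ae (.of_forall fun x => ?_)
  simp only
  rw [← h.add hW x (sub_nonneg.2 hr.1.le) hs.1 (by linarith [hr.2]), sub_add_cancel]

/-- The indicator of `C` is dominated by Lipschitz functions supported in the `δ`-thickening, whose
integrals the flow preserves; then `δ → 0`. -/
lemma volume_preimage_le (hdiv : ∀ᵐ x, diverg W x = 0) {t : ℝ} (ht : t ∈ Icc 0 τ)
    {C : Set (Pt d)} (hC : IsCompact C) : volume (Φ t ⁻¹' C) ≤ volume C := by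
  rcases C.eq_empty_or_nonempty with rfl | hne
  · simp
  refine ge_of_tendsto ((tendsto_measure_cthickening_of_isCompact (μ := volume) hC).mono_left
    (nhdsWithin_le_nhds (s := Ioi 0))) ?_
  filter_upwards [self_mem_nhdsWithin] with δ hδ
  have hδ : 0 < δ := hδ
  set f : Pt d → ℝ := fun x => max 0 (1 - δ⁻¹ * Metric.infDist x C) with hfdef
  have hf : LipschitzWith (Real.toNNReal δ⁻¹) f := by
    have h1 : LipschitzWith (Real.toNNReal δ⁻¹) fun x : Pt d => 1 - δ⁻¹ * Metric.infDist x C := by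
      refine LipschitzWith.of_dist_le_mul fun x y => ?_
      have := (Metric.lipschitz_infDist_pt C).dist_le_mul x y
      rw [Real.coe_toNNReal _ (by positivity), Real.dist_eq, sub_sub_sub_cancel_left, ← mul_sub,
        abs_mul, abs_of_pos (inv_pos.2 hδ), abs_sub_comm, ← Real.dist_eq]
      simpa using mul_le_mul_of_nonneg_left this (inv_pos.2 hδ).le
    exact h1.const_max 0
  have hf0 : ∀ x, x ∉ Metric.cthickening δ C → f x = 0 := fun x hx => by
    have hx : δ < Metric.infDist x C := by
      by_contra! hle
      obtain ⟨y, hy, hxy⟩ := hC.exists_infDist_eq_dist hne x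
      exact hx (Metric.mem_cthickening_of_dist_le x y δ C hy (hxy ▸ hle))
    refine max_eq_left ?_
    rw [sub_nonpos, ← div_eq_inv_mul, one_le_div hδ]
    exact hx.le
  have hfc : HasCompactSupport f := HasCompactSupport.intro hC.cthickening hf0
  have hf_nonneg : ∀ x, 0 ≤ f x := fun x => le_max_left _ _
  have hf1 : ∀ x, f x ≤ 1 := fun x =>
    max_le zero_le_one (by have := Metric.infDist_nonneg (x := x) (s := C); simp; positivity)
  have hfC : ∀ x ∈ C, f x = 1 := fun x hx => by simp [hfdef, Metric.infDist_zero_of_mem hx]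
  have hΦ := (h.lipschitzWith hW ht).continuous
  calc volume (Φ t ⁻¹' C) = ∫⁻ x, (Φ t ⁻¹' C).indicator 1 x := by
        rw [lintegral_indicator_one (hC.isClosed.preimage hΦ).measurableSet]
    _ ≤ ∫⁻ x, ENNReal.ofReal (f (Φ t x)) := lintegral_mono fun x => by
        by_cases hx : Φ t x ∈ C
        · simp [hx, hfC _ hx]
        · simp [hx]
    _ = ENNReal.ofReal (∫ x, f x) := by
        rw [← ofReal_integral_eq_lintegral_ofReal (h.integrable_comp hW hWc hf hfc ht)
          (.of_forall fun x => hf_nonneg _), h.integral_comp_eq hW hWc hf hfc hdiv ht]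
    _ = ∫⁻ x, ENNReal.ofReal (f x) := ofReal_integral_eq_lintegral_ofReal
        (hf.continuous.integrable_of_hasCompactSupport hfc) (.of_forall hf_nonneg)
    _ ≤ ∫⁻ x, (Metric.cthickening δ C).indicator 1 x := lintegral_mono fun x => by
        by_cases hx : x ∈ Metric.cthickening δ C
        · simp [hx, hf1]
        · simp [hx, hf0 x hx]
    _ = volume (Metric.cthickening δ C) :=
        lintegral_indicator_one Metric.isClosed_cthickening.measurableSet

end integral

end IsFlow

/-! ### Inequalities for positive definite tensors -/

lemma ddot_eq_trace (A B : Tensor d) : ddot A B = (A * Bᵀ).trace := by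
  simp [ddot, Matrix.trace, Matrix.mul_apply]

lemma ddot_sub_left (A A' B : Tensor d) : ddot (A - A') B = ddot A B - ddot A' B := by
  simp [ddot_eq_trace, sub_mul]

lemma ddot_smul_left (c : ℝ) (A B : Tensor d) : ddot (c • A) B = c * ddot A B := by
  simp [ddot_eq_trace]

lemma ddot_smul_right (c : ℝ) (A B : Tensor d) : ddot A (c • B) = c * ddot A B := by
  simp [ddot_eq_trace]

lemma ddot_self_nonneg (A : Tensor d) : 0 ≤ ddot A A :=
  Finset.sum_nonneg fun _ _ => Finset.sum_nonneg fun _ _ => mul_self_nonneg _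

lemma continuous_ddot : Continuous fun p : Tensor d × Tensor d => ddot p.1 p.2 := by
  unfold ddot; fun_prop

/-- The entropic energy `tr σ - ln det σ`. -/
def traceSubLogDet (A : Tensor d) : ℝ := A.trace - Real.log A.det

lemma isSymm_of_posDef {A : Tensor d} (hA : A.PosDef) : A.IsSymm := by
  have := hA.1
  rwa [Matrix.IsHermitian, Matrix.conjTranspose_eq_transpose_of_trivial] at this

/-- Each eigenvalue satisfies `λ - ln λ ≥ 1`. -/
lemma card_le_traceSubLogDet {A : Tensor d} (hA : A.PosDef) : (d : ℝ) ≤ traceSubLogDet A := by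
  have h1 : A.trace = ∑ i, hA.1.eigenvalues i := by
    simpa using hA.1.trace_eq_sum_eigenvalues
  have h2 : A.det = ∏ i, hA.1.eigenvalues i := by
    simpa using hA.1.det_eq_prod_eigenvalues
  rw [traceSubLogDet, h1, h2, Real.log_prod fun i _ => (hA.eigenvalues_pos i).ne',
    ← Finset.sum_sub_distrib]
  calc (d : ℝ) = ∑ _i : Fin d, (1 : ℝ) := by simp
    _ ≤ _ := Finset.sum_le_sum fun i _ => by
        linarith [Real.log_le_sub_one_of_pos (hA.eigenvalues_pos i)]

lemma trace_matLog {A : Tensor d} (hA : A.PosDef) : (matLog A).trace = Real.log A.det := by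
  have h2 : A.det = ∏ i, hA.1.eigenvalues i := by
    simpa using hA.1.det_eq_prod_eigenvalues
  rw [h2, Real.log_prod fun i _ => (hA.eigenvalues_pos i).ne', matLog, hA.1.cfc_eq,
    Matrix.IsHermitian.cfc, Unitary.conjStarAlgAut_apply, Matrix.trace_mul_comm, ← mul_assoc]
  simp [Matrix.trace]

lemma trace_sub_matLog_sub_one {A : Tensor d} (hA : A.PosDef) :
    (A - matLog A - 1).trace = traceSubLogDet A - d := by
  simp [trace_matLog hA, traceSubLogDet]

open scoped MatrixOrder in
lemma exists_eq_transpose_mul_self {A : Tensor d} (hA : A.PosDef) :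
    ∃ C : Tensor d, IsUnit C ∧ A = Cᵀ * C := by
  obtain ⟨C, hC⟩ := CStarAlgebra.nonneg_iff_eq_star_mul_self.1 hA.posSemidef.nonneg
  rw [Matrix.star_eq_conjTranspose, Matrix.conjTranspose_eq_transpose_of_trivial] at hC
  refine ⟨C, (Matrix.isUnit_iff_isUnit_det C).2 (isUnit_iff_ne_zero.2 fun h0 => ?_), hC⟩
  have := hA.det_pos
  rw [hC, Matrix.det_mul, h0, mul_zero] at this
  exact lt_irrefl _ this

/-- The convexity inequality for `G`, whose gradient at `A` is `I - A⁻¹`. With `A⁻¹ = Cᵀ C`, the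
tensor `C B Cᵀ` is positive definite with trace `tr (B A⁻¹)` and determinant `det B / det A`, so the
claim is `G(C B Cᵀ) ≥ d` rearranged. -/
lemma traceSubLogDet_sub_le {A B : Tensor d} (hA : A.PosDef) (hB : B.PosDef) :
    traceSubLogDet A - traceSubLogDet B ≤ ddot (A - B) (1 - A⁻¹) := by
  obtain ⟨C, hC, hCA⟩ := exists_eq_transpose_mul_self hA.inv
  have hM : (C * B * Cᵀ).PosDef := by
    have := hB.mul_mul_conjTranspose_same (B := C) (by
      exact Matrix.vecMul_injective_of_isUnit hC)
    rwa [Matrix.conjTranspose_eq_transpose_of_trivial] at this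
  have hdetA := hA.det_pos
  have hdetB := hB.det_pos
  have hunit : IsUnit A.det := hdetA.ne'.isUnit
  have h := card_le_traceSubLogDet hM
  have ht : (C * B * Cᵀ).trace = (B * A⁻¹).trace := by
    rw [Matrix.trace_mul_comm, ← mul_assoc, ← hCA, Matrix.trace_mul_comm]
  have hd : (C * B * Cᵀ).det = A.det⁻¹ * B.det := by
    have : A⁻¹.det = C.det * C.det := by rw [hCA]; simp
    rw [Matrix.det_nonsing_inv, Ring.inverse_eq_inv'] at this
    rw [Matrix.det_mul, Matrix.det_mul, Matrix.det_transpose, this]; ring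
  rw [traceSubLogDet, ht, hd, Real.log_mul (inv_ne_zero hdetA.ne') hdetB.ne', Real.log_inv] at h
  have hs : (1 - A⁻¹)ᵀ = 1 - A⁻¹ := by
    rw [Matrix.transpose_sub, Matrix.transpose_one, (isSymm_of_posDef hA.inv).eq]
  rw [ddot_eq_trace, hs, sub_mul, mul_sub, mul_sub, mul_one, mul_one,
    Matrix.mul_nonsing_inv A hunit]
  simp only [Matrix.trace_sub, Matrix.trace_one, Fintype.card_fin, traceSubLogDet]
  linarith

lemma ddot_sub_one {A : Tensor d} (hA : A.PosDef) :
    ddot (A - 1) (1 - A⁻¹) = (A + A⁻¹ - (2 : ℝ) • 1).trace := by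
  have hs : (1 - A⁻¹)ᵀ = 1 - A⁻¹ := by
    rw [Matrix.transpose_sub, Matrix.transpose_one, (isSymm_of_posDef hA.inv).eq]
  rw [ddot_eq_trace, hs, sub_mul, mul_sub, mul_one, one_mul,
    Matrix.mul_nonsing_inv A hA.det_pos.ne'.isUnit]
  simp
  ring

/-- Adding `G(A) ≥ d` and `G(A⁻¹) ≥ d` cancels the logarithms. This gives the sign of the stress
dissipation. -/
lemma trace_add_inv_nonneg {A : Tensor d} (hA : A.PosDef) :
    0 ≤ (A + A⁻¹ - (2 : ℝ) • 1).trace := by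
  have h1 := card_le_traceSubLogDet hA
  have h2 := card_le_traceSubLogDet hA.inv
  rw [traceSubLogDet] at h1 h2
  rw [Matrix.det_nonsing_inv, Ring.inverse_eq_inv', Real.log_inv] at h2
  simp
  linarith

/-- The contribution of the extra stress to the momentum balance cancels the one of the
upper-convected derivative to the stress balance, up to a multiple of the divergence. -/
lemma ddot_upper_convected {A : Tensor d} (hA : A.PosDef) (g : Tensor d) :
    ddot (g * A + A * gᵀ) (1 - A⁻¹) = 2 * ddot A g - 2 * g.trace := by
  have hs : (1 - A⁻¹)ᵀ = 1 - A⁻¹ := by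
    rw [Matrix.transpose_sub, Matrix.transpose_one, (isSymm_of_posDef hA.inv).eq]
  have hu : IsUnit A.det := hA.det_pos.ne'.isUnit
  have h1 : (g * A).trace = (A * gᵀ).trace := by
    rw [← Matrix.trace_transpose, Matrix.transpose_mul, (isSymm_of_posDef hA).eq]
  have h2 : (A * gᵀ * A⁻¹).trace = g.trace := by
    rw [Matrix.trace_mul_comm, ← mul_assoc, Matrix.nonsing_inv_mul A hu, one_mul,
      Matrix.trace_transpose]
  rw [ddot_eq_trace, ddot_eq_trace, hs, mul_sub, mul_one, add_mul, mul_assoc g,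
    Matrix.mul_nonsing_inv A hu, mul_one]
  simp only [Matrix.trace_sub, Matrix.trace_add, h1, h2]
  ring

/-! ### The test tensor field -/

lemma isPiecewisePoly_of_const {f : Pt d → ℝ} {k : ℕ}
    (h : ∀ K ∈ 𝒯.cells, ∃ c, ∀ x ∈ openCell K, f x = c) : IsPiecewisePoly 𝒯 k f := fun K hK => by
  obtain ⟨c, hc⟩ := h K hK
  exact ⟨MvPolynomial.C c, by simp, fun x hx => by simp [hc x hx]⟩

lemma piH_mem_symTensorDisc {f : Pt d → Tensor d} (k : ℕ)
    (hf : ∀ K ∈ 𝒯.cells, (f (barycenter K)).IsSymm) : piH 𝒯 f ∈ symTensorDisc 𝒯 k := by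
  refine ⟨fun i j => isPiecewisePoly_of_const fun K hK => ⟨f (barycenter K) i j, fun x hx => ?_⟩,
    fun K hK x hx => ?_⟩
  · rw [piH_eq hK f hx]
  · rw [piH_eq hK f hx]; exact hf K hK

/-- Symmetric piecewise constants lie in both stress spaces; in `ℙ₁ + ℙ₀` the continuous summand is
taken to be zero. -/
lemma piH_mem_stressSpace {S : Set (Pt d → Tensor d)}
    (hS : S = symTensorDisc 𝒯 1 ∨ S = symTensorP1P0 𝒯) {f : Pt d → Tensor d}
    (hf : ∀ K ∈ 𝒯.cells, (f (barycenter K)).IsSymm) : piH 𝒯 f ∈ S := by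
  rcases hS with rfl | rfl
  · exact piH_mem_symTensorDisc 1 hf
  · refine ⟨fun _ => 0, ⟨fun i j => isPiecewisePoly_of_const fun K _ => ⟨0, fun _ _ => rfl⟩,
      fun K _ x _ => Matrix.isSymm_zero⟩, _, piH_mem_symTensorDisc 0 hf, continuousOn_const,
      fun K _ x _ => by simp⟩

lemma isPiecewisePoly_of_mem_stressSpace {S : Set (Pt d → Tensor d)}
    (hS : S = symTensorDisc 𝒯 1 ∨ S = symTensorP1P0 𝒯) {s : Pt d → Tensor d} (hs : s ∈ S)
    (i j : Fin d) : IsPiecewisePoly 𝒯 1 fun x => s x i j := by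
  rcases hS with rfl | rfl
  · exact hs.1 i j
  · obtain ⟨g, hg, c, hc, -, h⟩ := hs
    intro K hK
    obtain ⟨P, hP, h1⟩ := hg.1 i j K hK
    obtain ⟨Q, hQ, h2⟩ := hc.1 i j K hK
    refine ⟨P + Q, (MvPolynomial.totalDegree_add _ _).trans (max_le hP (hQ.trans zero_le_one)),
      fun x hx => ?_⟩
    rw [map_add, ← h1 x hx, ← h2 x hx]
    exact congrFun (congrFun (h K hK x hx) i) j

/-- The test tensor field `κ (I - π_h(s)⁻¹)`. -/
def testTensor (𝒯 : Mesh d) (κ : ℝ) (s : Pt d → Tensor d) : Pt d → Tensor d :=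
  piH 𝒯 fun y => κ • (1 - (s y)⁻¹)

lemma testTensor_eq (hK : K ∈ 𝒯.cells) (κ : ℝ) (s : Pt d → Tensor d) {x : Pt d}
    (hx : x ∈ openCell K) : testTensor 𝒯 κ s x = κ • (1 - (s (barycenter K))⁻¹) :=
  piH_eq hK _ hx

lemma testTensor_mem {S : Set (Pt d → Tensor d)}
    (hS : S = symTensorDisc 𝒯 1 ∨ S = symTensorP1P0 𝒯) (κ : ℝ) {s : Pt d → Tensor d}
    (hpos : ∀ K ∈ 𝒯.cells, (s (barycenter K)).PosDef) : testTensor 𝒯 κ s ∈ S :=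
  piH_mem_stressSpace hS fun K hK =>
    (Matrix.isSymm_one.sub (isSymm_of_posDef (hpos K hK).inv)).smul κ

/-! ### Elementwise integrals -/

lemma integral_ddot_openCell {s : Pt d → Tensor d}
    (hs : ∀ i j, IsPiecewisePoly 𝒯 1 fun x => s x i j) (B : Tensor d) (hK : K ∈ 𝒯.cells) :
    ∫ x in openCell K, ddot (s x) B = volume.real (openCell K) * ddot (s (barycenter K)) B := by
  have hint : ∀ i j, IntegrableOn (fun x => s x i j * B i j) (openCell K) := fun i j =>
    ((hs i j).isPiecewiseCont.integrableOn_openCell hK).mul_const _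
  simp only [ddot]
  rw [integral_finsetSum _ fun i _ => integrable_finsetSum _ fun j _ => hint i j, Finset.mul_sum]
  refine Finset.sum_congr rfl fun i _ => ?_
  rw [integral_finsetSum _ fun j _ => hint i j, Finset.mul_sum]
  refine Finset.sum_congr rfl fun j _ => ?_
  rw [integral_mul_const, integral_openCell_of_isPiecewisePoly_one (hs i j) hK, mul_assoc]

lemma isPiecewiseCont_ddot {f g : Pt d → Tensor d} (hf : IsPiecewiseCont 𝒯 f)
    (hg : IsPiecewiseCont 𝒯 g) : IsPiecewiseCont 𝒯 fun x => ddot (f x) (g x) :=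
  hf.comp₂ hg (H := ddot) continuous_ddot

/-- The test tensor is constant on each cell, so the integrand is affine there and the barycenter
rule is exact. -/
lemma integral_ddot_testTensor {τ : Pt d → Tensor d}
    (hτ : ∀ i j, IsPiecewisePoly 𝒯 1 fun x => τ x i j) (κ : ℝ) (s : Pt d → Tensor d) :
    ∫ x in 𝒯.domain, ddot (τ x) (testTensor 𝒯 κ s x) = κ * ∑ K ∈ 𝒯.cells,
      volume.real (openCell K) * ddot (τ (barycenter K)) (1 - (s (barycenter K))⁻¹) := by
  have hτc : IsPiecewiseCont 𝒯 τ := IsPiecewiseCont.matrix fun i j => (hτ i j).isPiecewiseCont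
  have hφc : IsPiecewiseCont 𝒯 (testTensor 𝒯 κ s) := IsPiecewiseCont.piH _
  rw [(isPiecewiseCont_ddot hτc hφc).setIntegral_domain, Finset.mul_sum]
  refine Finset.sum_congr rfl fun K hK => ?_
  rw [setIntegral_congr_fun (g := fun x => ddot (τ x) (κ • (1 - (s (barycenter K))⁻¹)))
    (isOpen_openCell K).measurableSet fun x hx => by simp only [testTensor_eq hK _ s hx],
    integral_ddot_openCell hτ _ hK, ddot_smul_right]
  ring

lemma setIntegral_domain_of_eqOn_openCell {E : Type*} [NormedAddCommGroup E] [NormedSpace ℝ E]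
    [CompleteSpace E] {f : Pt d → E} {c : Finset (Pt d) → E}
    (h : ∀ K ∈ 𝒯.cells, ∀ x ∈ openCell K, f x = c K) :
    ∫ x in 𝒯.domain, f x = ∑ K ∈ 𝒯.cells, volume.real (openCell K) • c K := by
  have hf : IsPiecewiseCont 𝒯 f := fun K hK => ⟨_, continuous_const, h K hK⟩
  rw [hf.setIntegral_domain]
  refine Finset.sum_congr rfl fun K hK => ?_
  rw [setIntegral_congr_fun (isOpen_openCell K).measurableSet (h K hK), setIntegral_const]

/-- The transport term does not contribute to the kinetic energy. -/
lemma integral_inner_convection_eq_zero {u w : Pt d → Pt d} (hu : u ∈ velocitySpace 𝒯)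
    (hw : w ∈ velocitySpace 𝒯) (hdiv : ∀ᵐ x ∂(volume.restrict 𝒯.domain), diverg w x = 0) :
    ∫ x in 𝒯.domain, inner ℝ (fderiv ℝ u x (w x)) (u x) = 0 := by
  obtain ⟨M, hM⟩ := exists_lipschitzWith_zeroExt hw
  obtain ⟨N, hN⟩ := exists_lipschitzWith_zeroExt hu
  obtain ⟨B, hB⟩ := (hasCompactSupport_zeroExt 𝒯 u).exists_bound_of_continuous
    (continuous_zeroExt hu)
  set U := zeroExt 𝒯 u with hU
  have hB0 : 0 ≤ B := (norm_nonneg _).trans (hB 0)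
  -- The integrand is half of `w · ∇|u|²`. The function `|U|²` is globally Lipschitz because `U` is
  -- Lipschitz and bounded by `B`.
  set g : Pt d → ℝ := fun x => inner ℝ (U x) (U x) with hg
  have hglip : LipschitzWith (2 * B * N).toNNReal g := LipschitzWith.of_dist_le_mul fun x y => by
    rw [Real.coe_toNNReal _ (by positivity), Real.dist_eq]
    have e : g x - g y = inner ℝ (U x - U y) (U x) + inner ℝ (U y) (U x - U y) := by
      simp only [hg, inner_sub_left, inner_sub_right, real_inner_comm]; ring
    have h1 := abs_real_inner_le_norm (U x - U y) (U x)
    have h2 := abs_real_inner_le_norm (U y) (U x - U y)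
    have h3 := hN.dist_le_mul x y
    rw [dist_eq_norm] at h3
    calc |g x - g y| ≤ ‖U x - U y‖ * ‖U x‖ + ‖U y‖ * ‖U x - U y‖ := by
          rw [e]; exact (abs_add_le _ _).trans (add_le_add h1 h2)
      _ ≤ (N * dist x y) * B + B * (N * dist x y) := by
          gcongr
          · exact hB x
          · exact hB y
      _ = _ := by ring
  have hgc : HasCompactSupport g :=
    (hasCompactSupport_zeroExt 𝒯 u).comp_left (g := fun v : Pt d => inner ℝ v v) (by simp)
  have key := integral_fderiv_apply_eq_zero hM (hasCompactSupport_zeroExt 𝒯 w)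
    (diverg_zeroExt_ae_eq_zero hdiv) hglip hgc
  rw [← setIntegral_eq_integral_of_forall_compl_eq_zero (s := 𝒯.domain)
    (fun x hx => by rw [zeroExt_of_notMem_domain hw hx, map_zero])] at key
  have : ∫ x in 𝒯.domain, fderiv ℝ g x (zeroExt 𝒯 w x) =
      ∫ x in 𝒯.domain, 2 * inner ℝ (fderiv ℝ u x (w x)) (u x) := by
    refine integral_congr_ae ?_
    filter_upwards [ae_mem_openCell 𝒯] with x ⟨K, hK, hx⟩
    obtain ⟨P, -, h⟩ := exists_polyField_of_mem_velocitySpace hu hK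
    have hUu : U =ᶠ[𝓝 x] u :=
      (eqOn_zeroExt_openCell hK).eventuallyEq_of_mem ((isOpen_openCell K).mem_nhds hx)
    have hud : DifferentiableAt ℝ U x := by
      have h1 : U =ᶠ[𝓝 x] polyField P := hUu.trans
        ((h.mono (openCell_subset K)).eventuallyEq_of_mem ((isOpen_openCell K).mem_nhds hx))
      exact h1.differentiableAt_iff.2 ((contDiff_polyField P 1).differentiable one_ne_zero x)
    rw [eqOn_zeroExt_openCell hK hx, hg, fderiv_inner_apply ℝ hud hud, hUu.fderiv_eq,
      hUu.eq_of_nhds, real_inner_comm]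
    ring
  rw [this, integral_const_mul] at key
  linarith

/-! ### The energy identity -/

section energy

variable {Re Wi ε dt : ℝ} {u uo : Pt d → Pt d} {p : Pt d → ℝ} {s so : Pt d → Tensor d}

/-- The factor `κ = ε / (2 Wi)` makes the upper-convected contribution `2 κ π_h(s) : ∇u` cancel the
elastic term of the momentum equation. The time derivative is expanded by `2 (a - b) · a = |a|² -
|b|² + |a - b|²`. -/
lemma schemeDensity_test (hWi : 0 < Wi) (hdt : 0 < dt) (hK : K ∈ 𝒯.cells)
    (hpos : (s (barycenter K)).PosDef) {x : Pt d} (hx : x ∈ openCell K) (hdiv : diverg u x = 0) :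
    schemeDensity 𝒯 Re Wi ε dt uo so u p s u p (testTensor 𝒯 (ε / (2 * Wi)) s) x =
      Re / (2 * dt) * (‖u x‖ ^ 2 - ‖uo x‖ ^ 2 + ‖u x - uo x‖ ^ 2)
        + Re * inner ℝ (fderiv ℝ u x (uo x)) (u x) + (1 - ε) * ddot (grad u x) (grad u x)
        + dt⁻¹ * ddot (s x) (testTensor 𝒯 (ε / (2 * Wi)) s x)
        - dt⁻¹ * ddot (so x) (testTensor 𝒯 (ε / (2 * Wi)) s x)
        + 1 / Wi * ddot (s x - 1) (testTensor 𝒯 (ε / (2 * Wi)) s x) := by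
  have h1 : ddot (grad u x * piH 𝒯 s x + piH 𝒯 s x * (grad u x)ᵀ)
      (testTensor 𝒯 (ε / (2 * Wi)) s x) = ε / Wi * ddot (piH 𝒯 s x) (grad u x) := by
    rw [piH_eq hK s hx, testTensor_eq hK _ s hx, ddot_smul_right, ddot_upper_convected hpos,
      show (grad u x).trace = 0 from hdiv]
    field_simp
    ring
  have h2 : inner ℝ (dt⁻¹ • (u x - uo x)) (u x) =
      1 / (2 * dt) * (‖u x‖ ^ 2 - ‖uo x‖ ^ 2 + ‖u x - uo x‖ ^ 2) := by
    rw [real_inner_smul_left, norm_sub_sq_real, inner_sub_left, real_inner_self_eq_norm_sq,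
      real_inner_comm]
    field_simp
    ring
  rw [schemeDensity, inner_add_left, h1, h2, ddot_smul_left, ddot_sub_left (s x) (so x)]
  field_simp
  ring

/-- The sum over the elements of `|K| G(π_h(s))` with `G(σ) = tr σ - ln det σ`. -/
def entropy (𝒯 : Mesh d) (s : Pt d → Tensor d) : ℝ :=
  ∑ K ∈ 𝒯.cells, volume.real (openCell K) * traceSubLogDet (s (barycenter K))

/-- Uses `tr ln A = ln det A`. The constant `∑ |K| d` disappears in differences of free energies. -/
lemma freeEnergy_piH (hpos : ∀ K ∈ 𝒯.cells, (s (barycenter K)).PosDef) :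
    freeEnergy 𝒯 Re Wi ε u (piH 𝒯 s) = Re / 2 * (∫ x in 𝒯.domain, ‖u x‖ ^ 2) +
      ε / (2 * Wi) * (entropy 𝒯 s - ∑ K ∈ 𝒯.cells, volume.real (openCell K) * d) := by
  rw [freeEnergy, entropy, ← Finset.sum_sub_distrib,
    setIntegral_domain_of_eqOn_openCell (f := fun x => (piH 𝒯 s x - matLog (piH 𝒯 s x) - 1).trace)
      (c := fun K => traceSubLogDet (s (barycenter K)) - d) fun K hK x hx => by
        rw [piH_eq hK s hx, trace_sub_matLog_sub_one (hpos K hK)]]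
  simp only [smul_eq_mul, mul_sub]

/-- The discrete energy balance: `J` collects the contributions of the transport of the stress. -/
lemma free_energy_step (hWi : 0 < Wi) (hdt : 0 < dt)
    (hu : u ∈ velocitySpace 𝒯) (huo : uo ∈ velocitySpace 𝒯)
    (hdiv : ∀ᵐ x ∂(volume.restrict 𝒯.domain), diverg u x = 0)
    (hdivo : ∀ᵐ x ∂(volume.restrict 𝒯.domain), diverg uo x = 0)
    (hs : ∀ i j, IsPiecewisePoly 𝒯 1 fun x => s x i j)
    (hpos : ∀ K ∈ 𝒯.cells, (s (barycenter K)).PosDef) {τ : Pt d → Tensor d}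
    (hposo : ∀ K ∈ 𝒯.cells, (τ (barycenter K)).PosDef)
    (hso : IntegrableOn (fun x => ddot (so x) (testTensor 𝒯 (ε / (2 * Wi)) s x)) 𝒯.domain)
    {J : ℝ}
    (hstep : (∫ x in 𝒯.domain,
      schemeDensity 𝒯 Re Wi ε dt uo so u p s u p (testTensor 𝒯 (ε / (2 * Wi)) s) x) + J = 0)
    (hJ : ε / (2 * Wi) * (entropy 𝒯 s - entropy 𝒯 τ) ≤
      ε / (2 * Wi) * ∑ K ∈ 𝒯.cells, volume.real (openCell K) *
        ddot (s (barycenter K)) (1 - (s (barycenter K))⁻¹)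
      - (∫ x in 𝒯.domain, ddot (so x) (testTensor 𝒯 (ε / (2 * Wi)) s x)) + dt * J) :
    freeEnergy 𝒯 Re Wi ε u (piH 𝒯 s) - freeEnergy 𝒯 Re Wi ε uo (piH 𝒯 τ)
      + (∫ x in 𝒯.domain, Re / 2 * ‖u x - uo x‖ ^ 2)
      + dt * (∫ x in 𝒯.domain, ((1 - ε) * ddot (grad u x) (grad u x)
          + ε / (2 * Wi ^ 2) * (piH 𝒯 s x + (piH 𝒯 s x)⁻¹ - (2 : ℝ) • 1).trace)) ≤ 0 := by
  set φ := testTensor 𝒯 (ε / (2 * Wi)) s with hφ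
  have hsc : IsPiecewiseCont 𝒯 s := IsPiecewiseCont.matrix fun i j => (hs i j).isPiecewiseCont
  have hφc : IsPiecewiseCont 𝒯 φ := IsPiecewiseCont.piH _
  have hsq : ∀ {v : Pt d → Pt d}, IsPiecewiseCont 𝒯 v → IsPiecewiseCont 𝒯 fun x => ‖v x‖ ^ 2 :=
    fun hv => hv.comp (H := fun y => ‖y‖ ^ 2) (by fun_prop)
  have huc := isPiecewiseCont_velocity hu
  have huoc := isPiecewiseCont_velocity huo
  have hgc := isPiecewiseCont_grad hu
  have i1 := (hsq huc).integrableOn_domain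
  have i2 := (hsq huoc).integrableOn_domain
  have i3 := (hsq (huc.sub huoc)).integrableOn_domain
  have i4 : IntegrableOn (fun x => inner ℝ (fderiv ℝ u x (uo x)) (u x)) 𝒯.domain := by
    refine IsPiecewiseCont.integrableOn_domain (((isPiecewiseCont_fderiv hu).comp₂ huoc
      (H := fun A y => A y) ?_).comp₂ huc (H := fun y z => inner ℝ y z) ?_)
    · exact isBoundedBilinearMap_apply.continuous
    · exact continuous_inner
  have i5 := (isPiecewiseCont_ddot hgc hgc).integrableOn_domain
  have i6 := (isPiecewiseCont_ddot hsc hφc).integrableOn_domain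
  have i7 := (isPiecewiseCont_ddot (hsc.sub (IsPiecewiseCont.const 1)) hφc).integrableOn_domain
  have hA : ∫ x in 𝒯.domain, ddot (s x) (φ x) = ε / (2 * Wi) * ∑ K ∈ 𝒯.cells,
      volume.real (openCell K) * ddot (s (barycenter K)) (1 - (s (barycenter K))⁻¹) :=
    integral_ddot_testTensor hs _ s
  set D := ∑ K ∈ 𝒯.cells, volume.real (openCell K) *
    (s (barycenter K) + (s (barycenter K))⁻¹ - (2 : ℝ) • 1).trace with hD
  have hone : ∫ x in 𝒯.domain, ddot (1 : Tensor d) (φ x) = ε / (2 * Wi) * ∑ K ∈ 𝒯.cells,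
      volume.real (openCell K) * ddot 1 (1 - (s (barycenter K))⁻¹) := by
    rw [setIntegral_domain_of_eqOn_openCell
      (c := fun K => ε / (2 * Wi) * ddot 1 (1 - (s (barycenter K))⁻¹)) fun K hK x hx => by
        rw [hφ, testTensor_eq hK _ s hx, ddot_smul_right], Finset.mul_sum]
    exact Finset.sum_congr rfl fun K _ => by rw [smul_eq_mul]; ring
  have hC : ∫ x in 𝒯.domain, ddot (s x - 1) (φ x) = ε / (2 * Wi) * D := by
    simp_rw [ddot_sub_left]
    rw [integral_sub i6 (isPiecewiseCont_ddot (IsPiecewiseCont.const 1) hφc).integrableOn_domain,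
      hA, hone, ← mul_sub, ← Finset.sum_sub_distrib, hD]
    congr 1
    refine Finset.sum_congr rfl fun K hK => ?_
    rw [← mul_sub, ← ddot_sub_left, ddot_sub_one (hpos K hK)]
  have hden : ∫ x in 𝒯.domain, schemeDensity 𝒯 Re Wi ε dt uo so u p s u p φ x =
      Re / (2 * dt) * ((∫ x in 𝒯.domain, ‖u x‖ ^ 2) - (∫ x in 𝒯.domain, ‖uo x‖ ^ 2)
        + ∫ x in 𝒯.domain, ‖u x - uo x‖ ^ 2)
      + Re * (∫ x in 𝒯.domain, inner ℝ (fderiv ℝ u x (uo x)) (u x))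
      + (1 - ε) * (∫ x in 𝒯.domain, ddot (grad u x) (grad u x))
      + dt⁻¹ * (∫ x in 𝒯.domain, ddot (s x) (φ x))
      - dt⁻¹ * (∫ x in 𝒯.domain, ddot (so x) (φ x))
      + 1 / Wi * (∫ x in 𝒯.domain, ddot (s x - 1) (φ x)) := by
    have j1 := ((i1.sub i2).add i3).const_mul (Re / (2 * dt))
    have j2 := j1.add (i4.const_mul Re)
    have j3 := j2.add (i5.const_mul (1 - ε))
    have j4 := j3.add (i6.const_mul dt⁻¹)
    have j5 := j4.sub (hso.const_mul dt⁻¹)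
    -- The pointwise identity needs `x` off the skeleton and `div u = 0` at `x`, hence holds only
    -- almost everywhere.
    have hae : ∀ᵐ x ∂(volume.restrict 𝒯.domain),
        schemeDensity 𝒯 Re Wi ε dt uo so u p s u p φ x =
          Re / (2 * dt) * (‖u x‖ ^ 2 - ‖uo x‖ ^ 2 + ‖u x - uo x‖ ^ 2)
          + Re * inner ℝ (fderiv ℝ u x (uo x)) (u x) + (1 - ε) * ddot (grad u x) (grad u x)
          + dt⁻¹ * ddot (s x) (φ x) - dt⁻¹ * ddot (so x) (φ x)
          + 1 / Wi * ddot (s x - 1) (φ x) := by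
      filter_upwards [ae_mem_openCell 𝒯, hdiv] with x ⟨K, hK, hx⟩ hx0
      exact schemeDensity_test hWi hdt hK (hpos K hK) hx hx0
    rw [integral_congr_ae hae]
    refine (integral_add j5 (i7.const_mul (1 / Wi))).trans ?_
    congr 1
    · refine (integral_sub j4 (hso.const_mul dt⁻¹)).trans ?_
      congr 1
      · refine (integral_add j3 (i6.const_mul dt⁻¹)).trans ?_
        congr 1
        · refine (integral_add j2 (i5.const_mul (1 - ε))).trans ?_
          congr 1
          · refine (integral_add j1 (i4.const_mul Re)).trans ?_
            congr 1
            · exact (integral_const_mul _ _).trans (congrArg _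
                ((integral_add (i1.sub i2) i3).trans (congrArg₂ _ (integral_sub i1 i2) rfl)))
            · exact integral_const_mul _ _
          · exact integral_const_mul _ _
        · exact integral_const_mul _ _
      · exact integral_const_mul _ _
    · exact integral_const_mul _ _
  have hdiss : ∫ x in 𝒯.domain, ((1 - ε) * ddot (grad u x) (grad u x)
      + ε / (2 * Wi ^ 2) * (piH 𝒯 s x + (piH 𝒯 s x)⁻¹ - (2 : ℝ) • 1).trace) =
      (1 - ε) * (∫ x in 𝒯.domain, ddot (grad u x) (grad u x)) + ε / (2 * Wi ^ 2) * D := by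
    have hpw : ∀ K ∈ 𝒯.cells, ∀ x ∈ openCell K,
        (piH 𝒯 s x + (piH 𝒯 s x)⁻¹ - (2 : ℝ) • 1).trace =
        (s (barycenter K) + (s (barycenter K))⁻¹ - (2 : ℝ) • 1).trace := fun K hK x hx => by
      rw [piH_eq hK s hx]
    have i8 : IntegrableOn (fun x => (piH 𝒯 s x + (piH 𝒯 s x)⁻¹ - (2 : ℝ) • 1).trace) 𝒯.domain :=
      IsPiecewiseCont.integrableOn_domain fun K hK => ⟨_, continuous_const, hpw K hK⟩
    rw [integral_add (i5.const_mul _) (i8.const_mul _), integral_const_mul, integral_const_mul,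
      setIntegral_domain_of_eqOn_openCell hpw]
    simp only [smul_eq_mul, hD]
  rw [integral_inner_convection_eq_zero hu huo hdivo, hA, hC] at hden
  rw [hden] at hstep
  rw [freeEnergy_piH hpos, freeEnergy_piH hposo, integral_const_mul, hdiss]
  set I₁ := ∫ x in 𝒯.domain, ‖u x‖ ^ 2
  set I₂ := ∫ x in 𝒯.domain, ‖uo x‖ ^ 2
  set I₃ := ∫ x in 𝒯.domain, ‖u x - uo x‖ ^ 2
  set I₄ := ∫ x in 𝒯.domain, ddot (grad u x) (grad u x)
  set B := ∫ x in 𝒯.domain, ddot (so x) (φ x)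
  set A := ε / (2 * Wi) * ∑ K ∈ 𝒯.cells,
      volume.real (openCell K) * ddot (s (barycenter K)) (1 - (s (barycenter K))⁻¹)
  have hmul := congrArg (fun z => dt * z) hstep
  have e : dt * (Re / (2 * dt) * (I₁ - I₂ + I₃) + Re * 0 + (1 - ε) * I₄ + dt⁻¹ * A - dt⁻¹ * B
      + 1 / Wi * (ε / (2 * Wi) * D) + J) = Re / 2 * (I₁ - I₂ + I₃) + dt * ((1 - ε) * I₄
        + ε / (2 * Wi ^ 2) * D) + A - B + dt * J := by
    field_simp
    ring
  simp only [mul_zero] at hmul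
  linarith

end energy

/-! ### The scheme with the characteristic method -/

lemma diverg_neg (u : Pt d → Pt d) (x : Pt d) : diverg (fun y => -u y) x = -diverg u x := by
  have h : fderiv ℝ (fun y => -u y) x = -fderiv ℝ u x := fderiv_neg
  simp [diverg, grad, h, Matrix.trace]

section backward

variable {u : Pt d → Pt d} {t₀ t₁ : ℝ} {X : ℝ → Pt d → Pt d}

open Classical in
/-- The time-reversed backward flow, extended by the identity outside the domain. -/
def reversedFlow (𝒯 : Mesh d) (t₁ : ℝ) (X : ℝ → Pt d → Pt d) (r : ℝ) (x : Pt d) : Pt d :=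
  if x ∈ 𝒯.domain then X (t₁ - r) x else x

lemma IsBackwardFlow.isFlow (hX : IsBackwardFlow 𝒯 u t₀ t₁ X) (hu : u ∈ velocitySpace 𝒯) :
    IsFlow (fun y => -zeroExt 𝒯 u y) (t₁ - t₀) (reversedFlow 𝒯 t₁ X) where
  zero x := by
    by_cases hx : x ∈ 𝒯.domain
    · simp [reversedFlow, hx, (hX x hx).1]
    · simp [reversedFlow, hx]
  deriv x t ht := by
    by_cases hx : x ∈ 𝒯.domain
    · have hmem : t₁ - t ∈ Icc t₀ t₁ := ⟨by linarith [ht.2], by linarith [ht.1]⟩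
      obtain ⟨h1, h2⟩ := (hX x hx).2 (t₁ - t) hmem
      have h3 : HasDerivWithinAt (fun r => t₁ - r) (-1) (Icc 0 (t₁ - t₀)) t :=
        ((hasDerivAt_id t).const_sub t₁).hasDerivWithinAt
      have h4 := h2.scomp t h3 (fun r hr => ⟨by linarith [hr.2], by linarith [hr.1]⟩)
      simp only [reversedFlow, hx, if_true]
      rw [zeroExt_of_mem (domain_subset_space 𝒯 h1), ← neg_one_smul ℝ]
      exact h4
    -- Outside the domain the extended field vanishes, so the constant curve solves the equation.
    · simp only [reversedFlow, hx, if_false, zeroExt_of_notMem_domain hu hx, neg_zero]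
      exact hasDerivWithinAt_const _ _ _

lemma reversedFlow_of_mem {x : Pt d} (hx : x ∈ 𝒯.domain) :
    reversedFlow 𝒯 t₁ X (t₁ - t₀) x = X t₀ x := by
  simp [reversedFlow, hx]

/-- `Y` is a measurable map that does not increase the volume of compact sets. -/
structure IsVolumeNonincreasing (Y : Pt d → Pt d) : Prop where
  measurable : Measurable Y
  volume_preimage_le : ∀ C, IsCompact C → volume (Y ⁻¹' C) ≤ volume C

lemma IsBackwardFlow.isVolumeNonincreasing (hX : IsBackwardFlow 𝒯 u t₀ t₁ X)
    (hu : u ∈ velocitySpace 𝒯) (ht : t₀ ≤ t₁)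
    (hdiv : ∀ᵐ x ∂(volume.restrict 𝒯.domain), diverg u x = 0) :
    IsVolumeNonincreasing (reversedFlow 𝒯 t₁ X (t₁ - t₀)) := by
  obtain ⟨M, hM⟩ := exists_lipschitzWith_zeroExt hu
  have hflow := hX.isFlow hu
  have hmem : t₁ - t₀ ∈ Icc 0 (t₁ - t₀) := ⟨sub_nonneg.2 ht, le_rfl⟩
  refine ⟨(hflow.lipschitzWith hM.neg hmem).continuous.measurable, fun C hC =>
    hflow.volume_preimage_le hM.neg (hasCompactSupport_zeroExt 𝒯 u).neg ?_ hmem hC⟩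
  filter_upwards [diverg_zeroExt_ae_eq_zero hdiv] with x hx
  rw [diverg_neg, hx, neg_zero]

end backward

/-! ### Piecewise constants transported by a volume nonincreasing map -/

lemma measurable_piH (f : Pt d → ℝ) : Measurable (piH 𝒯 f) :=
  Finset.measurable_fun_sum _ fun K _ =>
    measurable_const.indicator (isOpen_openCell K).measurableSet

lemma norm_piH_le (f : Pt d → ℝ) (x : Pt d) :
    ‖piH 𝒯 f x‖ ≤ ∑ K ∈ 𝒯.cells, ‖f (barycenter K)‖ :=
  (norm_sum_le _ _).trans (Finset.sum_le_sum fun _ _ => norm_indicator_le_norm_self _ _)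

lemma piH_apply_apply (s : Pt d → Tensor d) (x : Pt d) (i j : Fin d) :
    piH 𝒯 s x i j = piH 𝒯 (fun y => s y i j) x := by
  classical
  simp only [piH, Matrix.sum_apply]
  refine Finset.sum_congr rfl fun K _ => ?_
  by_cases h : x ∈ openCell K <;> simp [h]

lemma volume_domain_lt_top (𝒯 : Mesh d) : volume 𝒯.domain < ⊤ :=
  (measure_mono (domain_subset_space 𝒯)).trans_lt (isCompact_space 𝒯).measure_lt_top

section transport

variable {Y : Pt d → Pt d}

lemma integrableOn_piH_comp (hY : Measurable Y) (f : Pt d → ℝ) :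
    IntegrableOn (fun x => piH 𝒯 f (Y x)) 𝒯.domain :=
  IntegrableOn.of_bound (volume_domain_lt_top 𝒯)
    ((measurable_piH f).comp hY).aestronglyMeasurable _ (.of_forall fun _ => norm_piH_le f _)

/-- The transported stress jumps inside cells, so `IsPiecewiseCont` is unavailable; its entries are
measurable and bounded on a domain of finite volume. -/
lemma integrableOn_ddot_piH_comp (hY : Measurable Y) (s φ : Pt d → Tensor d) :
    IntegrableOn (fun x => ddot (piH 𝒯 s (Y x)) (piH 𝒯 φ x)) 𝒯.domain := by
  refine integrable_finsetSum _ fun i _ => integrable_finsetSum _ fun j _ => ?_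
  simp only [piH_apply_apply]
  exact (integrableOn_piH_comp measurable_id (fun y => φ y i j)).bdd_mul
    ((measurable_piH _).comp hY).aestronglyMeasurable (.of_forall fun x => norm_piH_le _ _)

lemma volume_preimage_openCell_le (hY : IsVolumeNonincreasing Y) (K : Finset (Pt d)) :
    volume (Y ⁻¹' openCell K) ≤ volume (openCell K) := by
  rw [measure_congr (openCell_ae_eq K)]
  exact (measure_mono (preimage_mono (openCell_subset K))).trans
    (hY.volume_preimage_le _ (isCompact_convexHull K))

/-- The boundary of each cell is compact and null, so its preimage under `Y` is null as well. -/
lemma ae_comp_mem_openCell (hY : IsVolumeNonincreasing Y) (hmaps : MapsTo Y 𝒯.domain 𝒯.domain) :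
    ∀ᵐ x ∂(volume.restrict 𝒯.domain), ∃ K ∈ 𝒯.cells, Y x ∈ openCell K := by
  rw [ae_restrict_iff' (isOpen_domain 𝒯).measurableSet]
  have h0 : ∀ᵐ x, ∀ K ∈ 𝒯.cells, x ∉ Y ⁻¹' (convexHull ℝ (K : Set (Pt d)) \ openCell K) := by
    refine (eventually_all_finset _).2 fun K _ => measure_eq_zero_iff_ae_notMem.1 ?_
    refine le_antisymm ?_ zero_le
    rw [← volume_closedCell_diff K]
    exact hY.volume_preimage_le _ ((isCompact_convexHull K).diff (isOpen_openCell K))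
  filter_upwards [h0] with x hx hxd
  have h1 := domain_subset_space 𝒯 (hmaps hxd)
  rw [space_eq] at h1
  simp only [mem_iUnion, exists_prop] at h1
  obtain ⟨K, hK, h2⟩ := h1
  exact ⟨K, hK, by_contra fun h3 => hx K hK ⟨h2, h3⟩⟩

/-- For nonnegative values, a one-sided bound on the volumes of the preimages of the cells is
enough. -/
lemma setIntegral_piH_comp_le (hY : IsVolumeNonincreasing Y) {f : Pt d → ℝ}
    (hf : ∀ K ∈ 𝒯.cells, 0 ≤ f (barycenter K)) :
    ∫ x in 𝒯.domain, piH 𝒯 f (Y x) ≤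
      ∑ K ∈ 𝒯.cells, volume.real (openCell K) * f (barycenter K) := by
  have hmeas : ∀ K : Finset (Pt d), MeasurableSet (Y ⁻¹' openCell K) := fun K =>
    hY.measurable (isOpen_openCell K).measurableSet
  have hfin : ∀ K : Finset (Pt d), volume (openCell K) < ⊤ := fun K =>
    (measure_mono (openCell_subset K)).trans_lt (isCompact_convexHull K).measure_lt_top
  have : IsFiniteMeasure (volume.restrict 𝒯.domain) := ⟨by
    simpa using volume_domain_lt_top 𝒯⟩
  have e : ∀ x, piH 𝒯 f (Y x) =
      ∑ K ∈ 𝒯.cells, (Y ⁻¹' openCell K).indicator (fun _ => f (barycenter K)) x := fun x => rfl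
  simp_rw [e]
  rw [integral_finsetSum _ fun K _ => (integrable_const _).indicator (hmeas K)]
  refine Finset.sum_le_sum fun K hK => ?_
  rw [integral_indicator_const _ (hmeas K), smul_eq_mul]
  refine mul_le_mul_of_nonneg_right ?_ (hf K hK)
  refine ENNReal.toReal_mono (hfin K).ne ?_
  exact (Measure.restrict_apply_le _ _).trans (volume_preimage_openCell_le hY K)

/-- Transport of the old stress by a volume preserving map decreases the entropy. -/
lemma entropy_transport_le {κ : ℝ} (hκ : 0 ≤ κ) (hY : IsVolumeNonincreasing Y)
    (hmaps : MapsTo Y 𝒯.domain 𝒯.domain) {s τ so : Pt d → Tensor d}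
    (hpos : ∀ K ∈ 𝒯.cells, (s (barycenter K)).PosDef)
    (hposo : ∀ K ∈ 𝒯.cells, (τ (barycenter K)).PosDef)
    (hso : ∀ x ∈ 𝒯.domain, so x = piH 𝒯 τ (Y x)) :
    κ * (entropy 𝒯 s - entropy 𝒯 τ) ≤
      κ * ∑ K ∈ 𝒯.cells, volume.real (openCell K) *
        ddot (s (barycenter K)) (1 - (s (barycenter K))⁻¹)
      - (∫ x in 𝒯.domain, ddot (so x) (testTensor 𝒯 κ s x)) := by
  have h1 : ∫ x in 𝒯.domain, ddot (so x) (testTensor 𝒯 κ s x) =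
      ∫ x in 𝒯.domain, ddot (piH 𝒯 τ (Y x)) (testTensor 𝒯 κ s x) :=
    setIntegral_congr_fun (isOpen_domain 𝒯).measurableSet fun x hx => by
      simp only [hso x hx]
  set A : Pt d → ℝ := piH 𝒯 fun y => κ * (ddot (s y) (1 - (s y)⁻¹) - traceSubLogDet (s y)) with hA
  set B : Pt d → ℝ := fun x => piH 𝒯 (fun y => κ * traceSubLogDet (τ y)) (Y x) with hB
  have hAi : IntegrableOn A 𝒯.domain := (IsPiecewiseCont.piH _).integrableOn_domain
  have hBi : IntegrableOn B 𝒯.domain := integrableOn_piH_comp hY.measurable _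
  have h2 : ∫ x in 𝒯.domain, ddot (piH 𝒯 τ (Y x)) (testTensor 𝒯 κ s x) ≤
      ∫ x in 𝒯.domain, (A x + B x) := by
    refine integral_mono_ae (integrableOn_ddot_piH_comp hY.measurable _ _) (hAi.add hBi) ?_
    filter_upwards [ae_mem_openCell 𝒯, ae_comp_mem_openCell hY hmaps] with x ⟨K, hK, hx⟩ ⟨L, hL, hx'⟩
    simp only [hA, hB]
    rw [piH_eq hL τ hx', testTensor_eq hK _ _ hx, piH_eq hK _ hx, piH_eq hL _ hx', ddot_smul_right]
    -- Convexity is applied between the new stress on the cell `K` of `x` and the old stress on the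
    -- cell `L` of the foot `Y x`.
    have := traceSubLogDet_sub_le (hpos K hK) (hposo L hL)
    rw [ddot_sub_left] at this
    nlinarith
  have h3 : ∫ x in 𝒯.domain, A x = κ * (∑ K ∈ 𝒯.cells, volume.real (openCell K) *
      ddot (s (barycenter K)) (1 - (s (barycenter K))⁻¹)) - κ * entropy 𝒯 s := by
    rw [setIntegral_domain_of_eqOn_openCell (f := A) fun K hK x hx => piH_eq hK _ hx, entropy,
      ← mul_sub, ← Finset.sum_sub_distrib, Finset.mul_sum]
    exact Finset.sum_congr rfl fun K _ => by rw [smul_eq_mul]; ring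
  have h4 : ∫ x in 𝒯.domain, B x ≤ κ * entropy 𝒯 τ := by
    -- The required nonnegativity of the old entropy density comes from `G ≥ d`.
    refine (setIntegral_piH_comp_le hY fun K hK => mul_nonneg hκ
      ((Nat.cast_nonneg d).trans (card_le_traceSubLogDet (hposo K hK)))).trans_eq ?_
    rw [entropy, Finset.mul_sum]
    exact Finset.sum_congr rfl fun K _ => by ring
  rw [integral_add hAi hBi] at h2
  rw [h1]
  linarith

end transport

/-! ### The incompressibility equation extracted from the characteristic scheme -/

lemma zero_mem_velocitySpace (𝒯 : Mesh d) : (fun _ => 0 : Pt d → Pt d) ∈ velocitySpace 𝒯 :=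
  ⟨continuousOn_const, fun _ => isPiecewisePoly_of_const fun _ _ => ⟨0, fun _ _ => rfl⟩,
    fun _ _ => rfl⟩

lemma piH_zero {M : Type*} [AddCommMonoid M] : piH 𝒯 (fun _ => (0 : M)) = fun _ => 0 := by
  ext x; simp [piH]

/-- With zero velocity and stress tests only the incompressibility equation survives, so the
divergence condition passes from the initial velocity to every step. -/
lemma schemeDensity_zero_test {Re Wi ε dt : ℝ} {uo u : Pt d → Pt d} {so s : Pt d → Tensor d}
    {p q : Pt d → ℝ} (x : Pt d) :
    schemeDensity 𝒯 Re Wi ε dt uo so u p s (fun _ => 0) q (fun _ => 0) x = q x * diverg u x := by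
  have hg : grad (fun _ => 0 : Pt d → Pt d) x = 0 := by ext i j; simp [grad]
  simp [schemeDensity, diverg, hg, ddot]

lemma CharacteristicStep.isDiscretelyDivFree {Re Wi ε dt : ℝ} {S : Set (Pt d → Tensor d)}
    {X₀ uo u : Pt d → Pt d} {so s : Pt d → Tensor d} {p : Pt d → ℝ}
    (hS : S = symTensorDisc 𝒯 1 ∨ S = symTensorP1P0 𝒯)
    (h : CharacteristicStep 𝒯 Re Wi ε dt S X₀ uo so u p s) : IsDiscretelyDivFree 𝒯 u := by
  intro q hq
  have := h _ (zero_mem_velocitySpace 𝒯) q hq _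
    (piH_mem_stressSpace (f := fun _ => 0) hS fun _ _ => Matrix.isSymm_zero)
  simpa [piH_zero, schemeDensity_zero_test] using this

/-! ### Integration over cones -/

section cone

open scoped Pointwise

variable {n : Pt d} (hn : ‖n‖ = 1) (a : Pt d)

/-- Orthogonal coordinates `(t, z) ↦ a + t n + z` with `z ⊥ n`. -/
def planeCoord (n a : Pt d) (q : ℝ × (ℝ ∙ n)ᗮ) : Pt d := a + (q.1 • n + (q.2 : Pt d))

lemma continuous_planeCoord : Continuous (planeCoord n a) := by
  unfold planeCoord; fun_prop

include hn in
lemma measurePreserving_planeCoord :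
    MeasurePreserving (planeCoord n a) (volume : Measure (ℝ × (ℝ ∙ n)ᗮ)) volume ∧
      MeasurableEmbedding (planeCoord n a) := by
  have h1 := ((ℝ ∙ n).measurePreserving_measurableEquivProd a).symm
  rw [InnerProductSpace.euclideanHausdorffMeasure_eq_volume] at h1
  have h2 : MeasurePreserving (LinearIsometryEquiv.toSpanUnitSingleton (𝕜 := ℝ) n hn) volume volume :=
    LinearIsometryEquiv.measurePreserving _
  have h3 := h1.comp (h2.prod (MeasurePreserving.id (volume : Measure (ℝ ∙ n)ᗮ)))
  have e : ((ℝ ∙ n).measurableEquivProd a).symm ∘ Prod.map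
      (LinearIsometryEquiv.toSpanUnitSingleton (𝕜 := ℝ) n hn) id = planeCoord n a := by
    ext1 q
    simp [planeCoord, add_comm]
  rw [e] at h3
  refine ⟨h3, ?_⟩
  rw [← e]
  refine ((ℝ ∙ n).measurableEquivProd a).symm.measurableEmbedding.comp ?_
  exact MeasurableEmbedding.prodMap
    (LinearIsometryEquiv.toSpanUnitSingleton (𝕜 := ℝ) n hn).toHomeomorph.measurableEmbedding
    MeasurableEmbedding.id

lemma inner_orthogonal_eq_zero (z : (ℝ ∙ n)ᗮ) : inner ℝ n (z : Pt d) = 0 :=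
  Submodule.mem_orthogonal_singleton_iff_inner_right.1 z.2

include hn in
lemma inner_planeCoord_sub (q : ℝ × (ℝ ∙ n)ᗮ) : inner ℝ n (planeCoord n a q - a) = q.1 := by
  simp [planeCoord, inner_add_right, inner_smul_right, hn, inner_orthogonal_eq_zero]

/-- The trace of a set on the plane at distance `h` from `a`. -/
def planeSection (n a : Pt d) (h : ℝ) (F : Set (Pt d)) : Set (ℝ ∙ n)ᗮ :=
  {z | planeCoord n a (h, z) ∈ F}

lemma isCompact_planeSection (h : ℝ) {F : Set (Pt d)} (hF : IsCompact F) :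
    IsCompact (planeSection n a h F) := by
  have hcl : Topology.IsClosedEmbedding fun z : (ℝ ∙ n)ᗮ => planeCoord n a (h, z) := by
    have h1 : Isometry fun z : (ℝ ∙ n)ᗮ => planeCoord n a (h, z) :=
      Isometry.of_dist_eq fun z z' => by simp [planeCoord, Subtype.dist_eq]
    exact h1.isClosedEmbedding
  exact hcl.isCompact_preimage hF

include hn in
-- The slice of the cone at height `t` is the base scaled by `t / h` about the apex. The apex plane
-- `t = 0` is excluded; it is negligible in the integral.
lemma planeCoord_mem_convexHull_insert_iff {h : ℝ} (hh : 0 < h) {e : Set (Pt d)} (he : e.Nonempty)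
    (hplane : ∀ y ∈ convexHull ℝ e, inner ℝ n (y - a) = h) {t : ℝ} (ht : t ≠ 0) (z : (ℝ ∙ n)ᗮ) :
    planeCoord n a (t, z) ∈ convexHull ℝ (insert a e) ↔
      t ∈ Ioc 0 h ∧ z ∈ (t / h) • planeSection n a h (convexHull ℝ e) := by
  rw [convexHull_insert he]
  simp only [convexJoin_singleton_left, mem_iUnion, exists_prop]
  constructor
  · rintro ⟨y, hy, hseg⟩
    rw [segment_eq_image'] at hseg
    obtain ⟨s, hs, hsx⟩ := hseg
    simp only at hsx
    have h1 := inner_planeCoord_sub hn a (t, z)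
    rw [← hsx, add_sub_cancel_left, inner_smul_right, hplane y hy] at h1
    simp only at h1
    have hs0 : 0 < s := hs.1.lt_of_ne (by rintro rfl; simp at h1; exact ht h1.symm)
    have hst : t / h = s := by rw [← h1]; field_simp
    refine ⟨⟨by rw [← h1]; positivity, by rw [← h1]; nlinarith [hs.2]⟩, ?_⟩
    rw [hst, mem_smul_set_iff_inv_smul_mem₀ hs0.ne', planeSection, Set.mem_ofPred_eq]
    convert! hy using 1
    have h2 : y - a = s⁻¹ • (t • n + (z : Pt d)) := by
      rw [eq_inv_smul_iff₀ hs0.ne']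
      simpa [planeCoord] using hsx
    rw [← sub_add_cancel y a, h2, ← h1, planeCoord, smul_add, smul_smul, ← mul_assoc,
      inv_mul_cancel₀ hs0.ne', one_mul, add_comm]
    rfl
  · rintro ⟨ht', hz⟩
    have hs0 : 0 < t / h := div_pos ht'.1 hh
    rw [mem_smul_set_iff_inv_smul_mem₀ hs0.ne'] at hz
    refine ⟨_, hz, ?_⟩
    rw [segment_eq_image']
    refine ⟨t / h, ⟨hs0.le, (div_le_one hh).2 ht'.2⟩, ?_⟩
    simp only [planeCoord, add_sub_cancel_left, smul_add, smul_smul, Submodule.coe_smul]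
    rw [div_mul_cancel₀ _ hh.ne', mul_inv_cancel₀ hs0.ne', one_smul]

include hn in
-- Fubini in the height, followed by rescaling each slice to the base with Jacobian `(t / h) ^ (d -
-- 1)`; the substitution `t = h s` produces the outer factor `h`.
lemma setIntegral_cone {h : ℝ} (hh : 0 < h) {e : Set (Pt d)} (he : e.Nonempty)
    (hec : IsCompact (convexHull ℝ e)) (hcc : IsCompact (convexHull ℝ (insert a e)))
    (hplane : ∀ y ∈ convexHull ℝ e, inner ℝ n (y - a) = h) {G : Pt d → ℝ} (hG : Continuous G) :
    ∫ x in convexHull ℝ (insert a e), G x =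
      h * ∫ s in (0 : ℝ)..1, s ^ Module.finrank ℝ (ℝ ∙ n)ᗮ *
        ∫ y in planeSection n a h (convexHull ℝ e), G (a + s • (h • n + (y : Pt d))) := by
  set C := convexHull ℝ (insert a e)
  set F := planeSection n a h (convexHull ℝ e) with hF
  obtain ⟨hmp, hemb⟩ := measurePreserving_planeCoord hn a
  have hint : Integrable (fun q => C.indicator G (planeCoord n a q)) (volume : Measure (ℝ × (ℝ ∙ n)ᗮ)) :=
    (hmp.integrable_comp_emb hemb).2
      ((integrable_indicator_iff hcc.measurableSet).2 (hG.continuousOn.integrableOn_compact hcc))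
  have hFm : MeasurableSet F := (isCompact_planeSection a h hec).measurableSet
  have hslice : ∀ t : ℝ, t ≠ 0 → ∫ z, C.indicator G (planeCoord n a (t, z)) =
      (Ioc 0 h).indicator (fun t => (t / h) ^ Module.finrank ℝ (ℝ ∙ n)ᗮ *
        ∫ y in F, G (a + (t / h) • (h • n + (y : Pt d)))) t := fun t ht => by
    by_cases hmem : t ∈ Ioc 0 h
    · have hs : 0 < t / h := div_pos hmem.1 hh
      rw [indicator_of_mem hmem]
      have e1 : ∀ z, C.indicator G (planeCoord n a (t, z)) =
          ((t / h) • F).indicator (fun z => G (planeCoord n a (t, z))) z := fun z => by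
        have := planeCoord_mem_convexHull_insert_iff hn a hh he hplane ht z
        by_cases hz : z ∈ (t / h) • F
        · rw [indicator_of_mem hz, indicator_of_mem (this.2 ⟨hmem, hz⟩)]
        · rw [indicator_of_notMem hz, indicator_of_notMem fun hc => hz (this.1 hc).2]
      simp_rw [e1]
      rw [integral_indicator (hFm.const_smul₀ _)]
      have e2 := Measure.setIntegral_comp_smul_of_pos volume
        (fun z => G (planeCoord n a (t, z))) F hs
      rw [eq_inv_smul_iff₀ (by positivity)] at e2
      rw [← e2, smul_eq_mul]
      congr 1
      refine setIntegral_congr_fun hFm fun y _ => ?_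
      simp only [planeCoord, smul_add, smul_smul, Submodule.coe_smul, div_mul_cancel₀ t hh.ne']
    · rw [indicator_of_notMem hmem]
      have e1 : ∀ z, C.indicator G (planeCoord n a (t, z)) = 0 := fun z =>
        indicator_of_notMem (fun hc =>
          hmem ((planeCoord_mem_convexHull_insert_iff hn a hh he hplane ht z).1 hc).1) _
      simp [e1]
  calc ∫ x in C, G x = ∫ q, C.indicator G (planeCoord n a q) := by
        rw [hmp.integral_comp hemb, integral_indicator hcc.measurableSet]
    _ = ∫ t, ∫ z, C.indicator G (planeCoord n a (t, z)) := integral_prod _ hint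
    _ = ∫ t in Ioc 0 h, (t / h) ^ Module.finrank ℝ (ℝ ∙ n)ᗮ *
        ∫ y in F, G (a + (t / h) • (h • n + (y : Pt d))) := by
        rw [← integral_indicator measurableSet_Ioc]
        refine integral_congr_ae ?_
        filter_upwards [compl_mem_ae_iff.2 (measure_singleton (0 : ℝ))] with t ht
        exact hslice t ht
    _ = _ := by
        rw [← intervalIntegral.integral_of_le hh.le,
          intervalIntegral.integral_comp_div (fun s => s ^ Module.finrank ℝ (ℝ ∙ n)ᗮ *
            ∫ y in F, G (a + s • (h • n + (y : Pt d)))) hh.ne', zero_div, div_self hh.ne',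
          smul_eq_mul]

include hn in
lemma finrank_orthogonal_add_one : Module.finrank ℝ (ℝ ∙ n)ᗮ + 1 = d := by
  have h1 := (ℝ ∙ n).finrank_add_finrank_orthogonal
  have hn0 : n ≠ 0 := by rintro rfl; simp at hn
  rw [finrank_span_singleton hn0, finrank_euclideanSpace_fin] at h1
  omega

include hn in
/-- The surface measure on a plane, in orthogonal coordinates. -/
lemma map_planeCoord (h : ℝ) :
    (volume : Measure (ℝ ∙ n)ᗮ).map (fun z => planeCoord n a (h, z)) =
      (Measure.euclideanHausdorffMeasure (d - 1)).restrict
        (range fun z : (ℝ ∙ n)ᗮ => planeCoord n a (h, z)) := by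
  have h1 : Isometry fun z : (ℝ ∙ n)ᗮ => planeCoord n a (h, z) :=
    Isometry.of_dist_eq fun z z' => by simp [planeCoord, Subtype.dist_eq]
  have h2 : d - 1 = Module.finrank ℝ (ℝ ∙ n)ᗮ := by
    have := finrank_orthogonal_add_one hn
    omega
  rw [← h1.map_euclideanHausdorffMeasure, ← InnerProductSpace.euclideanHausdorffMeasure_eq_volume,
    h2]

include hn in
lemma subset_range_planeCoord {h : ℝ} {F : Set (Pt d)} (hF : ∀ y ∈ F, inner ℝ n (y - a) = h) :
    F ⊆ range fun z : (ℝ ∙ n)ᗮ => planeCoord n a (h, z) := fun y hy => by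
  refine ⟨⟨y - a - h • n, ?_⟩, ?_⟩
  · rw [Submodule.mem_orthogonal_singleton_iff_inner_right, inner_sub_right, hF y hy,
      inner_smul_right, real_inner_self_eq_norm_sq, hn]
    ring
  · simp [planeCoord]

include hn in
lemma euclideanHausdorffMeasure_eq_planeSection {h : ℝ} {F : Set (Pt d)} (hFc : IsCompact F)
    (hF : ∀ y ∈ F, inner ℝ n (y - a) = h) :
    Measure.euclideanHausdorffMeasure (d - 1) F = volume (planeSection n a h F) := by
  have hm : Measurable fun z : (ℝ ∙ n)ᗮ => planeCoord n a (h, z) := by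
    have := continuous_planeCoord (n := n) a
    fun_prop
  rw [planeSection, ← preimage, ← Measure.map_apply hm hFc.measurableSet, map_planeCoord hn,
    Measure.restrict_apply hFc.measurableSet, inter_eq_left.2 (subset_range_planeCoord hn a hF)]

include hn in
lemma setIntegral_face {h : ℝ} {F : Set (Pt d)} (hFc : IsCompact F)
    (hF : ∀ y ∈ F, inner ℝ n (y - a) = h) (f : Pt d → ℝ) :
    ∫ x in F, f x ∂(Measure.euclideanHausdorffMeasure (d - 1)) =
      ∫ z in planeSection n a h F, f (planeCoord n a (h, z)) := by
  have h1 : Isometry fun z : (ℝ ∙ n)ᗮ => planeCoord n a (h, z) :=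
    Isometry.of_dist_eq fun z z' => by simp [planeCoord, Subtype.dist_eq]
  have := h1.isClosedEmbedding.measurableEmbedding.setIntegral_map (μ := volume) f F
  rw [map_planeCoord hn, Measure.restrict_restrict hFc.measurableSet,
    inter_eq_left.2 (subset_range_planeCoord hn a hF)] at this
  exact this

include hn in
/-- The divergence theorem on a cone for a field that is radial from the apex. -/
lemma integral_cone_radial {h : ℝ} (hh : 0 < h) {e : Set (Pt d)} (he : e.Nonempty)
    (hec : IsCompact (convexHull ℝ e)) (hcc : IsCompact (convexHull ℝ (insert a e)))
    (hplane : ∀ y ∈ convexHull ℝ e, inner ℝ n (y - a) = h) {f : Pt d → ℝ} (hf : ContDiff ℝ 1 f) :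
    ∫ x in convexHull ℝ (insert a e), (d * f x + fderiv ℝ f x (x - a)) =
      h * ∫ x in convexHull ℝ e, f x ∂(Measure.euclideanHausdorffMeasure (d - 1)) := by
  have hf' : Continuous (fderiv ℝ f) := hf.continuous_fderiv one_ne_zero
  have hfc := hf.continuous
  rw [setIntegral_cone hn a hh he hec hcc hplane (by fun_prop), setIntegral_face hn a hec hplane]
  congr 1
  set F := planeSection n a h (convexHull ℝ e) with hF
  have hFc : IsCompact F := isCompact_planeSection a h hec
  set m := Module.finrank ℝ (ℝ ∙ n)ᗮ with hm
  have hmd : (d : ℝ) = m + 1 := by rw [← finrank_orthogonal_add_one hn]; simp [hm]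
  set g : ℝ → (ℝ ∙ n)ᗮ → ℝ := fun s y => s ^ m * (d * f (a + s • (h • n + (y : Pt d))) +
    fderiv ℝ f (a + s • (h • n + (y : Pt d))) (a + s • (h • n + (y : Pt d)) - a)) with hg
  have hgc : Continuous (Function.uncurry g) := by
    simp only [hg, Function.uncurry_def]
    fun_prop
  have hgi : Integrable (Function.uncurry g)
      ((volume.restrict (uIoc 0 1)).prod (volume.restrict F)) := by
    rw [Measure.prod_restrict, uIoc_of_le zero_le_one]
    exact (hgc.continuousOn.integrableOn_compact (isCompact_Icc.prod hFc)).mono_set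
      (prod_mono_left Ioc_subset_Icc_self)
  have hin : ∀ y : (ℝ ∙ n)ᗮ, ∫ s in (0 : ℝ)..1, g s y = f (planeCoord n a (h, y)) := fun y => by
    set w : Pt d := h • n + (y : Pt d) with hw
    -- Along a ray the integrand, with its Jacobian `s ^ m` and `m + 1 = d`, is the exact derivative
    -- of `s ^ d * f (a + s • w)`. The boundary term at the apex vanishes since `d > 0`.
    have hder : ∀ s : ℝ, HasDerivAt (fun s : ℝ => s ^ (m + 1) * f (a + s • w)) (g s y) s := fun s => by
      have h1 : HasDerivAt (fun s : ℝ => a + s • w) w s := by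
        simpa using ((hasDerivAt_id s).smul_const w).const_add a
      have h2 := ((hf.differentiable one_ne_zero (a + s • w)).hasFDerivAt).comp_hasDerivAt s h1
      have h3 := (hasDerivAt_pow (m + 1) s).mul h2
      convert! h3 using 1
      simp only [hg, ← hw, add_sub_cancel_left, map_smul, smul_eq_mul, hmd, Nat.add_sub_cancel,
        Function.comp_apply]
      push_cast
      ring
    rw [intervalIntegral.integral_eq_sub_of_hasDerivAt (fun s _ => hder s)
      ((by fun_prop : Continuous fun s => g s y).intervalIntegrable _ _)]
    simp [planeCoord, hw]
  calc _ = ∫ s in (0 : ℝ)..1, ∫ y in F, g s y := by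
        refine intervalIntegral.integral_congr fun s _ => ?_
        simp only [hg, integral_const_mul]
    _ = ∫ y in F, ∫ s in (0 : ℝ)..1, g s y := intervalIntegral_integral_swap hgi
    _ = _ := by simp_rw [hin]

end cone

/-! ### Outward normals of a simplex -/

/-- `n` is the outward unit normal of the simplex `K` on the facet opposite to the vertex `a`, and
`h` is the corresponding height. -/
structure IsOutwardNormal (K : Finset (Pt d)) (a n : Pt d) (h : ℝ) : Prop where
  norm_eq : ‖n‖ = 1
  pos : 0 < h
  inner_eq : ∀ y ∈ K, y ≠ a → inner ℝ n (y - a) = h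

/-- Together with `sum_coord_linear`, this treats the vertices and the gradients of the barycentric
coordinates as a pair of dual frames. -/
lemma coord_linear_eq_sum (hK : K ∈ 𝒯.cells) (v : Pt d) :
    v = ∑ i : K, ((cellBasis hK).coord i).linear v • (i : Pt d) := by
  set b := cellBasis hK
  have h := fun x : Pt d => (b.linear_combination_coord_eq_self x)
  have h1 : ∀ i, (b.coord i).linear v = b.coord i v - b.coord i 0 := fun i => by
    simpa using coord_linear_sub b i v 0
  simp_rw [h1, sub_smul, Finset.sum_sub_distrib]
  have h2 := h v
  have h3 := h 0
  simp only [b, cellBasis_apply] at h2 h3 ⊢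
  rw [h2, h3, sub_zero]

lemma sum_coord_linear (hK : K ∈ 𝒯.cells) (v : Pt d) :
    ∑ i : K, ((cellBasis hK).coord i).linear v = 0 := by
  set b := cellBasis hK
  have h1 : ∀ i, (b.coord i).linear v = b.coord i v - b.coord i 0 := fun i => by
    simpa using coord_linear_sub b i v 0
  simp_rw [h1, Finset.sum_sub_distrib, b.sum_coord_apply_eq_one, sub_self]

/-- The barycentric coordinate of `a` falls from 1 at `a` to 0 on the opposite facet, so its
gradient `w` points inwards: `n = -w / ‖w‖` and `h = 1 / ‖w‖`. -/
lemma exists_isOutwardNormal (hd : 1 ≤ d) (hK : K ∈ 𝒯.cells) {a : Pt d} (ha : a ∈ K) :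
    ∃ n h, IsOutwardNormal K a n h := by
  set b := cellBasis hK
  set ℓ := (b.coord ⟨a, ha⟩).linear
  set w : Pt d := (InnerProductSpace.toDual ℝ (Pt d)).symm (LinearMap.toContinuousLinearMap ℓ)
  have hw : ∀ v, inner ℝ w v = ℓ v := fun v => by
    simp [w, InnerProductSpace.toDual_symm_apply]
  have hval : ∀ y ∈ K, y ≠ a → ℓ (y - a) = -1 := fun y hy hya => by
    have h1 := coord_linear_sub b ⟨a, ha⟩ y a
    have h2 := b.coord_apply_ne (i := ⟨a, ha⟩) (j := ⟨y, hy⟩) (by simpa using hya.symm)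
    have h3 := b.coord_apply_eq ⟨a, ha⟩
    simp only [b, cellBasis_apply] at h2 h3
    rw [h1, h2, h3]; norm_num
  have hw0 : w ≠ 0 := by
    intro h0
    have hcard : 1 < K.card := by rw [(Mesh.mem_cells.1 hK).2]; omega
    obtain ⟨y, hy, hya⟩ := Finset.exists_mem_ne hcard a
    have := hval y hy hya
    rw [← hw, h0, inner_zero_left] at this
    norm_num at this
  have hpos : 0 < ‖w‖ := norm_pos_iff.2 hw0
  refine ⟨-(‖w‖⁻¹ • w), ‖w‖⁻¹, ?_, inv_pos.2 hpos, fun y hy hya => ?_⟩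
  · rw [norm_neg, norm_smul, norm_inv, norm_norm, inv_mul_cancel₀ hpos.ne']
  · rw [inner_neg_left, real_inner_smul_left, hw, hval y hy hya]; ring

namespace IsOutwardNormal

variable {a n : Pt d} {h : ℝ}

/-- In the expansion of `v` over the vectors `i - a`, pairing with `n` gives `h` at every vertex
other than `a`, and the coefficients sum to zero. -/
lemma coord_linear (hn : IsOutwardNormal K a n h) (hK : K ∈ 𝒯.cells) (ha : a ∈ K) (v : Pt d) :
    ((cellBasis hK).coord ⟨a, ha⟩).linear v = -(h⁻¹ * inner ℝ n v) := by
  classical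
  have h1 : inner ℝ n v = ∑ i : K, ((cellBasis hK).coord i).linear v * inner ℝ n ((i : Pt d) - a) := by
    conv_lhs => rw [coord_linear_eq_sum hK v]
    simp_rw [inner_sum, inner_sub_right, mul_sub, Finset.sum_sub_distrib, ← Finset.sum_mul,
      sum_coord_linear, zero_mul, sub_zero, inner_smul_right]
  have h2 := sum_coord_linear hK v
  rw [← Finset.add_sum_erase _ _ (Finset.mem_univ ⟨a, ha⟩)] at h1 h2
  have h3 : ∀ i ∈ Finset.univ.erase (⟨a, ha⟩ : K),
      ((cellBasis hK).coord i).linear v * inner ℝ n ((i : Pt d) - a) =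
        ((cellBasis hK).coord i).linear v * h := fun i hi => by
    rw [hn.inner_eq i i.2 (fun hia => (Finset.ne_of_mem_erase hi) (Subtype.ext hia))]
  rw [Finset.sum_congr rfl h3, ← Finset.sum_mul, sub_self, inner_zero_right, mul_zero, zero_add] at h1
  have := hn.pos
  rw [h1]
  field_simp
  linarith

lemma inner_eq_of_mem_convexHull [DecidableEq (Pt d)] (hn : IsOutwardNormal K a n h) {y : Pt d}
    (hy : y ∈ convexHull ℝ (K.erase a : Set (Pt d))) : inner ℝ n (y - a) = h := by
  have hsub : (K.erase a : Set (Pt d)) ⊆ {y | inner ℝ n (y - a) = h} := fun y hy =>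
    hn.inner_eq y (Finset.mem_of_mem_erase hy) (Finset.ne_of_mem_erase hy)
  have hconv : Convex ℝ {y : Pt d | inner ℝ n (y - a) = h} := by
    have : {y : Pt d | inner ℝ n (y - a) = h} = {y | innerSL ℝ n y = h + inner ℝ n a} := by
      ext y
      simp [inner_sub_right, sub_eq_iff_eq_add]
    rw [this]
    exact convex_hyperplane (innerSL ℝ n).isLinear _
  exact convexHull_min hsub hconv hy

end IsOutwardNormal

/-- The outward unit normal on the facet opposite to `a`. -/
def outNormal (K : Finset (Pt d)) (a : Pt d) : Pt d :=
  Classical.epsilon fun n => ∃ h, IsOutwardNormal K a n h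

lemma exists_isOutwardNormal_outNormal (hd : 1 ≤ d) (hK : K ∈ 𝒯.cells) {a : Pt d} (ha : a ∈ K) :
    ∃ h, IsOutwardNormal K a (outNormal K a) h :=
  Classical.epsilon_spec (exists_isOutwardNormal hd hK ha)

/-! ### The divergence theorem on a simplex -/

/-- The divergence is a trace, which may be computed in the dual frames of vertices and barycentric
gradients instead of the standard basis. -/
lemma diverg_eq_sum_coord (hK : K ∈ 𝒯.cells) (u : Pt d → Pt d) (x : Pt d) :
    diverg u x = ∑ i : K, ((cellBasis hK).coord i).linear (fderiv ℝ u x i) := by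
  set A := fderiv ℝ u x
  have h1 : ∀ v : Pt d, v = ∑ j, v j • EuclideanSpace.single j (1 : ℝ) := fun v => by
    conv_lhs => rw [← (EuclideanSpace.basisFun (Fin d) ℝ).sum_repr v]
    simp
  have h2 : ∀ j, A (EuclideanSpace.single j 1) j =
      ∑ i : K, ((cellBasis hK).coord i).linear (EuclideanSpace.single j 1) * A i j := fun j => by
    conv_lhs => rw [coord_linear_eq_sum hK (EuclideanSpace.single j 1)]
    simp [map_sum]
  have h3 : diverg u x = ∑ j, A (EuclideanSpace.single j 1) j := rfl
  rw [h3]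
  simp_rw [h2]
  rw [Finset.sum_comm]
  refine Finset.sum_congr rfl fun i _ => ?_
  conv_rhs => rw [h1 (A i)]
  simp [map_sum, mul_comm]

open Classical in
/-- The divergence theorem on a simplex. -/
lemma integral_diverg_simplex (hd : 1 ≤ d) (hK : K ∈ 𝒯.cells) {u : Pt d → Pt d}
    (hu : ContDiff ℝ 1 u) :
    ∑ a ∈ K, ∫ x in convexHull ℝ (K.erase a : Set (Pt d)), inner ℝ (outNormal K a) (u x)
        ∂(Measure.euclideanHausdorffMeasure (d - 1)) =
      ∫ x in convexHull ℝ (K : Set (Pt d)), diverg u x := by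
  set b := cellBasis hK
  set ℓ : K → Pt d →L[ℝ] ℝ := fun i => LinearMap.toContinuousLinearMap (b.coord i).linear
  have hℓ : ∀ i v, ℓ i v = (b.coord i).linear v := fun i v => rfl
  -- With these coefficients `u(x) = ∑ fₐ(x) (x - a)` over the vertices. Each summand is radial from
  -- `a`, hence tangent to the facets through `a`, and its flux crosses only the opposite facet. The
  -- divergence of a summand is `d fₐ + ∇fₐ · (x - a)`, and `h fₐ = n · u`.
  set f : K → Pt d → ℝ := fun i x => -ℓ i (u x) with hf
  have hfc : ∀ i, ContDiff ℝ 1 (f i) := fun i => ((ℓ i).contDiff.comp hu).neg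
  have hfd : ∀ i x v, fderiv ℝ (f i) x v = -ℓ i (fderiv ℝ u x v) := fun i x v => by
    have h1 : HasFDerivAt (f i) (-(ℓ i ∘L fderiv ℝ u x)) x :=
      ((ℓ i).hasFDerivAt.comp x (hu.differentiable one_ne_zero x).hasFDerivAt).neg
    rw [h1.fderiv]; rfl
  have hdiv : ∀ x, diverg u x = ∑ i : K, (d * f i x + fderiv ℝ (f i) x (x - i)) := fun x => by
    have e1 : ∑ i : K, f i x = 0 := by
      simp only [hf, hℓ, Finset.sum_neg_distrib, b, sum_coord_linear, neg_zero]
    have e2 : ∑ i : K, ℓ i (fderiv ℝ u x x) = 0 := by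
      simp only [hℓ, b, sum_coord_linear]
    rw [diverg_eq_sum_coord hK, Finset.sum_add_distrib, ← Finset.mul_sum, e1, mul_zero, zero_add]
    simp_rw [hfd, map_sub, neg_sub, Finset.sum_sub_distrib, e2, sub_zero]
    rfl
  have hcont : ∀ i, Continuous fun x => d * f i x + fderiv ℝ (f i) x (x - i) := fun i => by
    have h1 := (hfc i).continuous
    have h2 := (hfc i).continuous_fderiv one_ne_zero
    fun_prop
  simp_rw [hdiv]
  rw [integral_finsetSum _ fun i _ => (hcont i).continuousOn.integrableOn_compact
    (isCompact_convexHull K), ← Finset.sum_coe_sort K]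
  refine Finset.sum_congr rfl fun a _ => ?_
  obtain ⟨h, hn⟩ := exists_isOutwardNormal_outNormal hd hK a.2
  have hins : insert (a : Pt d) (K.erase a : Set (Pt d)) = K := by
    rw [← Finset.coe_insert, Finset.insert_erase a.2]
  have hne : (K.erase a : Set (Pt d)).Nonempty := by
    rw [Finset.coe_nonempty, ← Finset.card_pos, Finset.card_erase_of_mem a.2,
      (Mesh.mem_cells.1 hK).2]
    omega
  have key := integral_cone_radial hn.norm_eq a hn.pos hne (isCompact_convexHull _)
    (by rw [hins]; exact isCompact_convexHull K) (fun y hy => hn.inner_eq_of_mem_convexHull hy)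
    (hfc a)
  rw [hins] at key
  rw [key, ← integral_const_mul]
  refine integral_congr_ae (.of_forall fun x => ?_)
  have := hn.pos
  simp only [hf, hℓ, b, hn.coord_linear hK a.2]
  field_simp

/-! ### Facets of the mesh -/

lemma coord_eq_of_weights [DecidableEq (Pt d)] (hK : K ∈ 𝒯.cells) {s : Finset (Pt d)} (hs : s ⊆ K)
    {w : Pt d → ℝ} (hw : ∑ y ∈ s, w y = 1) (i : K) :
    (cellBasis hK).coord i (∑ y ∈ s, w y • y) = if (i : Pt d) ∈ s then w i else 0 := by
  set b := cellBasis hK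
  have h1 : ∀ x, b.coord i x = (b.coord i).linear x + b.coord i 0 := fun x => by
    have := coord_linear_sub b i x 0
    rw [sub_zero] at this
    linarith
  have h2 : ∀ y ∈ s, b.coord i y = if (i : Pt d) = y then 1 else 0 := fun y hy => by
    have := b.coord_apply i ⟨y, hs hy⟩
    simpa [b, Subtype.ext_iff] using this
  calc b.coord i (∑ y ∈ s, w y • y) = ∑ y ∈ s, w y * b.coord i y := by
        rw [h1, map_sum, ← one_mul (b.coord i 0), ← hw, Finset.sum_mul, ← Finset.sum_add_distrib]
        refine Finset.sum_congr rfl fun y _ => ?_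
        rw [h1 y, map_smul, smul_eq_mul, mul_add]
    _ = ∑ y ∈ s, if (i : Pt d) = y then w y else 0 := Finset.sum_congr rfl fun y hy => by
        rw [h2 y hy]; split_ifs <;> simp
    _ = _ := by simp

/-- The relative interior of the simplex with vertices `e`. -/
def openFace (e : Finset (Pt d)) : Set (Pt d) :=
  {x | ∃ w : Pt d → ℝ, (∀ y ∈ e, 0 < w y) ∧ ∑ y ∈ e, w y = 1 ∧ ∑ y ∈ e, w y • y = x}

lemma openFace_nonempty {e : Finset (Pt d)} (he : e.Nonempty) : (openFace e).Nonempty := by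
  have : (0 : ℝ) < e.card := by exact_mod_cast he.card_pos
  refine ⟨_, fun _ => (e.card : ℝ)⁻¹, fun _ _ => by positivity, ?_, rfl⟩
  rw [Finset.sum_const, nsmul_eq_mul, mul_inv_cancel₀ this.ne']

lemma openFace_subset_convexHull (e : Finset (Pt d)) :
    openFace e ⊆ convexHull ℝ (e : Set (Pt d)) := by
  rintro x ⟨w, h0, h1, h2⟩
  exact Finset.mem_convexHull'.2 ⟨w, fun y hy => (h0 y hy).le, h1, h2⟩

lemma exists_weights_of_coord (hK : K ∈ 𝒯.cells) {s : Finset (Pt d)} (hs : s ⊆ K) {x : Pt d}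
    (hx : ∀ i : K, (i : Pt d) ∉ s → (cellBasis hK).coord i x = 0) :
    ∃ w : Pt d → ℝ, (∀ i : K, w i = (cellBasis hK).coord i x) ∧ ∑ y ∈ s, w y = 1 ∧
      ∑ y ∈ s, w y • y = x := by
  classical
  set b := cellBasis hK
  refine ⟨fun y => if h : y ∈ K then b.coord ⟨y, h⟩ x else 0, fun i => by simp, ?_, ?_⟩
  · rw [← b.sum_coord_apply_eq_one x, Finset.sum_subset hs fun y hy hys => by
      simpa [hy] using hx ⟨y, hy⟩ hys, ← Finset.sum_coe_sort K]
    simp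
  · have := b.linear_combination_coord_eq_self x
    conv_rhs => rw [← this]
    rw [Finset.sum_subset hs fun y hy hys => by
      have := hx ⟨y, hy⟩ hys
      simp [hy, this], ← Finset.sum_coe_sort K]
    simp [b]

lemma coord_of_mem_openFace (hK : K ∈ 𝒯.cells) {s : Finset (Pt d)} (hs : s ⊆ K) {x : Pt d}
    (hx : x ∈ openFace s) (i : K) :
    ((i : Pt d) ∈ s → 0 < (cellBasis hK).coord i x) ∧
      ((i : Pt d) ∉ s → (cellBasis hK).coord i x = 0) := by
  classical
  obtain ⟨w, h0, h1, rfl⟩ := hx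
  rw [coord_eq_of_weights hK hs h1]
  exact ⟨fun h => by rw [if_pos h]; exact h0 _ h, fun h => if_neg h⟩

lemma coord_of_mem_convexHull (hK : K ∈ 𝒯.cells) {s : Finset (Pt d)} (hs : s ⊆ K) {x : Pt d}
    (hx : x ∈ convexHull ℝ (s : Set (Pt d))) {i : K} (hi : (i : Pt d) ∉ s) :
    (cellBasis hK).coord i x = 0 := by
  classical
  obtain ⟨w, h0, h1, rfl⟩ := Finset.mem_convexHull'.1 hx
  rw [coord_eq_of_weights hK hs h1, if_neg hi]

lemma mem_openFace_of_coord (hK : K ∈ 𝒯.cells) {s : Finset (Pt d)} (hs : s ⊆ K) {x : Pt d}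
    (hx : x ∈ convexHull ℝ (s : Set (Pt d)))
    (h : ∀ i : K, (i : Pt d) ∈ s → (cellBasis hK).coord i x ≠ 0) : x ∈ openFace s := by
  obtain ⟨w, hw, h1, h2⟩ := exists_weights_of_coord hK hs fun i hi =>
    coord_of_mem_convexHull hK hs hx hi
  refine ⟨w, fun y hy => ?_, h1, h2⟩
  have := hw ⟨y, hs hy⟩
  simp only at this
  rw [this]
  exact ((mem_closedCell_iff hK).1 (convexHull_mono (by exact_mod_cast hs) hx) _).lt_of_ne'
    (h ⟨y, hs hy⟩ hy)

open Classical in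
-- In the plane of the facet this is contained in the zero set of an affine function that equals 1
-- at the vertex `i`: a proper affine subspace, hence null.
lemma euclideanHausdorffMeasure_face_inter_coord_eq_zero (hd : 1 ≤ d) (hK : K ∈ 𝒯.cells) {a : Pt d}
    (ha : a ∈ K) {i : K} (hi : (i : Pt d) ≠ a) :
    Measure.euclideanHausdorffMeasure (d - 1)
      (convexHull ℝ (K.erase a : Set (Pt d)) ∩ {x | (cellBasis hK).coord i x = 0}) = 0 := by
  obtain ⟨h, hn⟩ := exists_isOutwardNormal_outNormal hd hK ha
  set n := outNormal K a
  set b := cellBasis hK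
  have hcl : IsClosed {x | b.coord i x = 0} :=
    isClosed_eq (b.coord i).continuous_of_finiteDimensional continuous_const
  have hpl : ∀ y ∈ convexHull ℝ (K.erase a : Set (Pt d)), inner ℝ n (y - a) = h := fun y hy =>
    hn.inner_eq_of_mem_convexHull hy
  rw [euclideanHausdorffMeasure_eq_planeSection hn.norm_eq a
    ((isCompact_convexHull _).inter_right hcl) fun y hy => hpl y hy.1]
  set f : (ℝ ∙ n)ᗮ →ᵃ[ℝ] ℝ := (b.coord i).comp
    ((ℝ ∙ n)ᗮ.subtype.toAffineMap + AffineMap.const ℝ _ (a + h • n)) with hf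
  have hfz : ∀ z, f z = b.coord i (planeCoord n a (h, z)) := fun z => by
    simp only [hf, planeCoord, AffineMap.coe_comp, Function.comp_apply, AffineMap.coe_add,
      Pi.add_apply, LinearMap.coe_toAffineMap, Submodule.coe_subtype, AffineMap.coe_const,
      Function.const_apply]
    congr 1
    abel
  refine measure_mono_null (t := ((affineSpan ℝ {(0 : ℝ)}).comap f : Set (ℝ ∙ n)ᗮ)) ?_
    (Measure.addHaar_affineSubspace _ _ ?_)
  · rintro z ⟨_, hz⟩
    simp only [Set.mem_ofPred_eq] at hz
    simp [hfz, hz]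
  · intro htop
    have hie : (i : Pt d) ∈ convexHull ℝ (K.erase a : Set (Pt d)) :=
      subset_convexHull _ _ (Finset.mem_coe.2 (Finset.mem_erase.2 ⟨hi, i.2⟩))
    obtain ⟨z, hz⟩ := subset_range_planeCoord hn.norm_eq a hpl hie
    have h1 : z ∈ (affineSpan ℝ {(0 : ℝ)}).comap f := by rw [htop]; exact AffineSubspace.mem_top _ _ _
    have h2 := b.coord_apply_eq i
    simp only at hz
    rw [AffineSubspace.mem_comap, AffineSubspace.mem_affineSpan_singleton, hfz, hz] at h1
    simp only [b, cellBasis_apply] at h2 h1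
    rw [h1] at h2
    norm_num at h2

open Classical in
-- Upstream and downstream limits are identified only in the relative interior of a facet; the lower
-- dimensional faces are negligible.
lemma ae_mem_openFace (hd : 1 ≤ d) (hK : K ∈ 𝒯.cells) {a : Pt d} (ha : a ∈ K) :
    ∀ᵐ x ∂((Measure.euclideanHausdorffMeasure (d - 1)).restrict
      (convexHull ℝ (K.erase a : Set (Pt d)))), x ∈ openFace (K.erase a) := by
  rw [ae_restrict_iff' (isClosed_convexHull _).measurableSet]
  have h : ∀ᵐ x ∂(Measure.euclideanHausdorffMeasure (d - 1) : Measure (Pt d)), ∀ i : K,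
      (i : Pt d) ≠ a →
      x ∉ convexHull ℝ (K.erase a : Set (Pt d)) ∩ {x | (cellBasis hK).coord i x = 0} := by
    rw [ae_all_iff]
    intro i
    by_cases hi : (i : Pt d) = a
    · simp [hi]
    · filter_upwards [measure_eq_zero_iff_ae_notMem.1
        (euclideanHausdorffMeasure_face_inter_coord_eq_zero hd hK ha hi)] with x hx _ using hx
  filter_upwards [h] with x hx hxe
  exact mem_openFace_of_coord hK (Finset.erase_subset _ _) hxe fun i hi h0 =>
    hx i (Finset.ne_of_mem_erase hi) ⟨hxe, h0⟩

section facet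

open Classical

variable {a b : Pt d}

lemma coord_eq_zero_of_mem_openFace (hK : K ∈ 𝒯.cells) (ha : a ∈ K) {x : Pt d}
    (hx : x ∈ openFace (K.erase a)) : (cellBasis hK).coord ⟨a, ha⟩ x = 0 :=
  (coord_of_mem_openFace hK (Finset.erase_subset _ _) hx ⟨a, ha⟩).2 (by simp)

/-- The coordinate of `a` starts at 0 and grows at rate `-(n · v) / h > 0`; the other coordinates
start positive and stay so for small `δ`. -/
lemma eventually_mem_openCell (hd : 1 ≤ d) (hK : K ∈ 𝒯.cells) (ha : a ∈ K) {x v : Pt d}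
    (hx : x ∈ openFace (K.erase a)) (hv : inner ℝ (outNormal K a) v < 0) :
    ∀ᶠ δ : ℝ in 𝓝[>] 0, x + δ • v ∈ openCell K := by
  obtain ⟨h, hn⟩ := exists_isOutwardNormal_outNormal hd hK ha
  simp_rw [mem_openCell_iff hK]
  rw [eventually_all]
  intro i
  simp_rw [coord_add_smul]
  by_cases hi : (i : Pt d) = a
  · obtain rfl : i = ⟨a, ha⟩ := Subtype.ext hi
    rw [coord_eq_zero_of_mem_openFace hK ha hx, hn.coord_linear hK ha]
    filter_upwards [self_mem_nhdsWithin] with δ hδ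
    have h1 := mul_pos (inv_pos.2 hn.pos) (neg_pos.2 hv)
    have h2 : 0 < δ := hδ
    nlinarith
  · have h0 := (coord_of_mem_openFace hK (Finset.erase_subset _ _) hx i).1 (by simp [hi])
    refine Filter.Eventually.filter_mono nhdsWithin_le_nhds ?_
    have hc : ContinuousAt (fun δ : ℝ => (cellBasis hK).coord i x +
        δ * ((cellBasis hK).coord i).linear v) 0 := by fun_prop
    exact hc.eventually_const_lt (by simpa using h0)

/-- A small outward displacement leaves `K` at once. By conformity any cell containing `x` contains
the whole facet, so `x` has positive distance to every other cell and the displaced point is outside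
the mesh. -/
lemma notMem_domain_of_mem_openFace (hd : 1 ≤ d) (hK : K ∈ 𝒯.cells) (ha : a ∈ K)
    (hb : ∀ L ∈ 𝒯.cells, K.erase a ⊆ L → L = K) {x : Pt d} (hx : x ∈ openFace (K.erase a)) :
    x ∉ 𝒯.domain := by
  intro hxd
  obtain ⟨h, hn⟩ := exists_isOutwardNormal_outNormal hd hK ha
  set n := outNormal K a
  have hlim : Tendsto (fun δ : ℝ => x + δ • n) (𝓝[>] 0) (𝓝 x) := by
    have : ContinuousAt (fun δ : ℝ => x + δ • n) 0 := by fun_prop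
    have h1 := this.tendsto
    simp only [zero_smul, add_zero] at h1
    exact h1.mono_left nhdsWithin_le_nhds
  have hout : ∀ L ∈ 𝒯.cells, ∀ᶠ δ : ℝ in 𝓝[>] 0, x + δ • n ∉ convexHull ℝ (L : Set (Pt d)) := by
    intro L hL
    by_cases hLK : L = K
    · subst hLK
      filter_upwards [self_mem_nhdsWithin] with δ hδ hmem
      have h1 := (mem_closedCell_iff hK).1 hmem ⟨a, ha⟩
      rw [coord_add_smul, coord_eq_zero_of_mem_openFace hK ha hx, hn.coord_linear hK ha,
        real_inner_self_eq_norm_sq, hn.norm_eq] at h1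
      have h2 := mul_pos (Set.mem_Ioi.1 hδ) (inv_pos.2 hn.pos)
      linarith
    · refine hlim.eventually ((isClosed_convexHull L).isOpen_compl.mem_nhds fun hxL => hLK ?_)
      refine hb L hL fun y hy => ?_
      have hxK : x ∈ convexHull ℝ (K : Set (Pt d)) := convexHull_mono
        (by exact_mod_cast Finset.erase_subset _ _) (openFace_subset_convexHull _ hx)
      have hxi : x ∈ convexHull ℝ ((K ∩ L : Finset (Pt d)) : Set (Pt d)) := by
        rw [Finset.coe_inter, ← 𝒯.convexHull_inter_convexHull (Mesh.mem_cells.1 hK).1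
          (Mesh.mem_cells.1 hL).1]
        exact ⟨hxK, hxL⟩
      by_contra hyL
      have h1 := coord_of_mem_convexHull hK Finset.inter_subset_left hxi
        (i := ⟨y, Finset.mem_of_mem_erase hy⟩) (by simp [hyL])
      have h2 := (coord_of_mem_openFace hK (Finset.erase_subset _ _) hx
        ⟨y, Finset.mem_of_mem_erase hy⟩).1 hy
      exact h2.ne' h1
  have hin : ∀ᶠ δ : ℝ in 𝓝[>] 0, x + δ • n ∈ 𝒯.domain :=
    hlim.eventually ((isOpen_domain 𝒯).mem_nhds hxd)
  have hall : ∀ᶠ δ : ℝ in 𝓝[>] 0, ∀ L ∈ 𝒯.cells, x + δ • n ∉ convexHull ℝ (L : Set (Pt d)) := by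
    rw [Filter.eventually_all_finset]
    exact hout
  obtain ⟨δ, h1, h2⟩ := (hin.and hall).exists
  have h3 := domain_subset_space 𝒯 h1
  rw [space_eq] at h3
  simp only [mem_iUnion, exists_prop] at h3
  obtain ⟨L, hL, h3⟩ := h3
  exact h2 L hL h3

/-- The flux of `u` through the facet of `K` opposite to `a`. -/
def flux (u : Pt d → Pt d) (K : Finset (Pt d)) (a : Pt d) : ℝ :=
  ∫ x in convexHull ℝ (K.erase a : Set (Pt d)), inner ℝ (outNormal K a) (u x)
    ∂(Measure.euclideanHausdorffMeasure (d - 1))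

lemma flux_eq_zero_of_boundary (hd : 1 ≤ d) {u : Pt d → Pt d} (hu : u ∈ velocitySpace 𝒯)
    (hK : K ∈ 𝒯.cells) (ha : a ∈ K) (hb : ∀ L ∈ 𝒯.cells, K.erase a ⊆ L → L = K) :
    flux u K a = 0 := by
  refine integral_eq_zero_of_ae ?_
  filter_upwards [ae_mem_openFace hd hK ha] with x hx
  have h1 : u x = 0 := hu.2.2 x (by
    rw [frontier_domain]
    refine ⟨?_, notMem_domain_of_mem_openFace hd hK ha hb hx⟩
    exact 𝒯.convexHull_subset_space (Mesh.mem_cells.1 hK).1 (convexHull_mono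
        (by exact_mod_cast Finset.erase_subset _ _) (openFace_subset_convexHull _ hx)))
  simp [h1]

/-- The divergence theorem is applied to the polynomial that agrees with `u` on the closed cell,
since `u` itself need not be differentiable across facets. -/
lemma sum_flux_eq_zero (hd : 1 ≤ d) {u : Pt d → Pt d} (hu : u ∈ velocitySpace 𝒯)
    (hdiv : IsDiscretelyDivFree 𝒯 u) (hK : K ∈ 𝒯.cells) : ∑ a ∈ K, flux u K a = 0 := by
  obtain ⟨P, -, hP⟩ := exists_polyField_of_mem_velocitySpace hu hK
  have h1 := integral_diverg_simplex hd hK (contDiff_polyField P 1)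
  have h2 : ∫ x in convexHull ℝ (K : Set (Pt d)), diverg (polyField P) x = 0 := by
    rw [← setIntegral_congr_set (openCell_ae_eq K)]
    refine integral_eq_zero_of_ae ?_
    have h3 : ∀ᵐ x ∂(volume.restrict (openCell K)), diverg u x = 0 :=
      ae_restrict_of_ae_restrict_of_subset (openCell_subset_domain hK)
        (hdiv.diverg_ae_eq_zero hu)
    filter_upwards [h3, ae_restrict_mem (isOpen_openCell K).measurableSet] with x hx hxK
    rw [diverg, grad_eq_of_eqOn_openCell (hP.mono (openCell_subset K)) hxK] at hx
    exact hx
  rw [h2] at h1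
  rw [← h1]
  refine Finset.sum_congr rfl fun a ha => ?_
  refine setIntegral_congr_fun (isClosed_convexHull _).measurableSet fun x hx => ?_
  rw [hP (convexHull_mono (by exact_mod_cast Finset.erase_subset _ _) hx)]

/-- Expanding an arbitrary vector over the vertices, only the term of `a` pairs nontrivially with
`ν`; so `ν` is a multiple of the outward normal. -/
lemma eq_or_eq_neg_outNormal (hd : 1 ≤ d) (hK : K ∈ 𝒯.cells) (ha : a ∈ K) {ν : Pt d}
    (hν : ‖ν‖ = 1) (horth : ∀ x ∈ K.erase a, ∀ y ∈ K.erase a, inner ℝ (x - y) ν = 0) :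
    ν = outNormal K a ∨ ν = -outNormal K a := by
  obtain ⟨h, hn⟩ := exists_isOutwardNormal_outNormal hd hK ha
  set n := outNormal K a
  have hcard : 1 < K.card := by rw [(Mesh.mem_cells.1 hK).2]; omega
  obtain ⟨y, hy, hya⟩ := Finset.exists_mem_ne hcard a
  have hye : y ∈ K.erase a := Finset.mem_erase.2 ⟨hya, hy⟩
  have h1 : ∀ v, inner ℝ ν v = inner ℝ ((-(h⁻¹ * inner ℝ (a - y) ν)) • n) v := fun v => by
    have h2 : inner ℝ v ν =
        ∑ i : K, ((cellBasis hK).coord i).linear v * inner ℝ ((i : Pt d) - y) ν := by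
      conv_lhs => rw [coord_linear_eq_sum hK v]
      simp_rw [sum_inner, inner_sub_left, mul_sub, Finset.sum_sub_distrib, ← Finset.sum_mul,
        sum_coord_linear, zero_mul, sub_zero, real_inner_smul_left]
    rw [Finset.sum_eq_single (⟨a, ha⟩ : K) (fun i _ hi => by
      rw [horth i (Finset.mem_erase.2 ⟨fun hia => hi (Subtype.ext hia), i.2⟩) y hye, mul_zero])
      (by simp), hn.coord_linear hK ha] at h2
    rw [real_inner_comm, h2, real_inner_smul_left]
    ring
  have h2 := ext_inner_right ℝ h1
  set c := -(h⁻¹ * inner ℝ (a - y) ν)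
  rw [h2, norm_smul, hn.norm_eq, mul_one, Real.norm_eq_abs, abs_eq zero_le_one] at hν
  rcases hν with hc | hc
  · left; rw [h2, hc, one_smul]
  · right; rw [h2, hc, neg_one_smul]

lemma outNormal_orthogonal (hd : 1 ≤ d) (hK : K ∈ 𝒯.cells) (ha : a ∈ K) :
    ∀ x ∈ K.erase a, ∀ y ∈ K.erase a, inner ℝ (x - y) (outNormal K a) = 0 := fun x hx y hy => by
  obtain ⟨h, hn⟩ := exists_isOutwardNormal_outNormal hd hK ha
  have h1 := hn.inner_eq x (Finset.mem_of_mem_erase hx) (Finset.ne_of_mem_erase hx)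
  have h2 := hn.inner_eq y (Finset.mem_of_mem_erase hy) (Finset.ne_of_mem_erase hy)
  rw [real_inner_comm, show x - y = (x - a) - (y - a) by abel, inner_sub_right, h1, h2, sub_self]

lemma erase_nonempty (hd : 1 ≤ d) (hK : K ∈ 𝒯.cells) (ha : a ∈ K) : (K.erase a).Nonempty := by
  rw [← Finset.card_pos, Finset.card_erase_of_mem ha, (Mesh.mem_cells.1 hK).2]
  omega

/-- The outward normals of two elements on their common facet are opposite. -/
lemma outNormal_eq_neg (hd : 1 ≤ d) (hK : K ∈ 𝒯.cells) (hL : L ∈ 𝒯.cells) (hKL : K ≠ L)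
    (ha : a ∈ K) (hb : b ∈ L) (he : L.erase b = K.erase a) : outNormal L b = -outNormal K a := by
  obtain ⟨h, hn⟩ := exists_isOutwardNormal_outNormal hd hL hb
  have horth := outNormal_orthogonal hd hL hb
  rw [he] at horth
  refine (eq_or_eq_neg_outNormal hd hK ha hn.norm_eq horth).resolve_left fun heq => ?_
  obtain ⟨x, hx⟩ := openFace_nonempty (erase_nonempty hd hK ha)
  -- If the normals agreed, a small step in the direction `-n` would enter both open cells, which
  -- are disjoint.
  have hneg : inner ℝ (outNormal L b) (-outNormal L b) < 0 := by
    rw [inner_neg_right, real_inner_self_eq_norm_sq, hn.norm_eq]; norm_num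
  have h1 := eventually_mem_openCell hd hL hb (he ▸ hx) hneg
  have h2 := eventually_mem_openCell hd hK ha hx (heq ▸ hneg)
  obtain ⟨δ, h3, h4⟩ := (h1.and (heq ▸ h2)).exists
  exact (disjoint_openCell hK hL hKL).le_bot ⟨h4, h3⟩

lemma exists_eq_erase_of_subset {e : Finset (Pt d)} (he : e.card = d) (hK : K ∈ 𝒯.cells)
    (heK : e ⊆ K) : ∃ a ∈ K, K.erase a = e := by
  have hc : (K \ e).card = 1 := by
    rw [Finset.card_sdiff_of_subset heK, he, (Mesh.mem_cells.1 hK).2]; omega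
  obtain ⟨a, ha⟩ := Finset.card_eq_one.1 hc
  refine ⟨a, (Finset.mem_sdiff.1 (ha ▸ Finset.mem_singleton_self a)).1, ?_⟩
  rw [Finset.erase_eq, ← ha, Finset.sdiff_sdiff_eq_self heK]

lemma exists_cells_of_mem_internalFaces {e : Finset (Pt d)} (he : e ∈ 𝒯.internalFaces) :
    ∃ K ∈ 𝒯.cells, ∃ a ∈ K, ∃ L ∈ 𝒯.cells, ∃ b ∈ L, K ≠ L ∧ K.erase a = e ∧ L.erase b = e := by
  obtain ⟨-, hc, K, hK, L, hL, hKL, h1, h2⟩ := Finset.mem_filter.1 he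
  obtain ⟨a, ha, hae⟩ := exists_eq_erase_of_subset hc hK h1
  obtain ⟨b, hb, hbe⟩ := exists_eq_erase_of_subset hc hL h2
  exact ⟨K, hK, a, ha, L, hL, b, hb, hKL, hae, hbe⟩

lemma mem_internalFaces (hd : 1 ≤ d) (hK : K ∈ 𝒯.cells) (ha : a ∈ K) (hL : L ∈ 𝒯.cells)
    (hKL : K ≠ L) (he : K.erase a ⊆ L) : K.erase a ∈ 𝒯.internalFaces := by
  refine Finset.mem_filter.2 ⟨?_, ?_, K, hK, L, hL, hKL, Finset.erase_subset _ _, he⟩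
  · rw [Set.Finite.mem_toFinset]
    exact 𝒯.down_closed (Mesh.mem_cells.1 hK).1 (Finset.erase_subset _ _) (erase_nonempty hd hK ha)
  · rw [Finset.card_erase_of_mem ha, (Mesh.mem_cells.1 hK).2, Nat.add_sub_cancel]

/-- The pairs of an element and an opposite vertex that define a given facet. -/
def facetPairs (𝒯 : Mesh d) (e : Finset (Pt d)) : Finset (Σ _ : Finset (Pt d), Pt d) :=
  (𝒯.cells.sigma id).filter fun q => q.1.erase q.2 = e

/-- A facet has at most two cells: the normal of a third would be opposite to two mutually opposite
unit vectors. -/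
lemma facetPairs_eq (hd : 1 ≤ d) (hK : K ∈ 𝒯.cells) (hL : L ∈ 𝒯.cells) (hKL : K ≠ L)
    (ha : a ∈ K) (hb : b ∈ L) (he : L.erase b = K.erase a) :
    facetPairs 𝒯 (K.erase a) = {⟨K, a⟩, ⟨L, b⟩} := by
  have huniq : ∀ M ∈ 𝒯.cells, ∀ c ∈ M, ∀ c' ∈ M, M.erase c = M.erase c' → c = c' := by
    intro M _ c hc c' hc' h
    by_contra hcc
    have : c ∈ M.erase c' := Finset.mem_erase.2 ⟨hcc, hc⟩
    rw [← h] at this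
    simp at this
  ext ⟨M, c⟩
  simp only [facetPairs, Finset.mem_filter, Finset.mem_sigma, id_eq, Finset.mem_insert,
    Finset.mem_singleton]
  constructor
  · rintro ⟨⟨hM, hc⟩, hMe⟩
    by_cases hMK : M = K
    · subst hMK
      left
      rw [huniq M hM c hc a ha hMe]
    by_cases hML : M = L
    · subst hML
      right
      rw [huniq M hM c hc b hb (hMe.trans he.symm)]
    exfalso
    have h1 := outNormal_eq_neg hd hK hL hKL ha hb he
    have h2 := outNormal_eq_neg hd hK hM (Ne.symm hMK) ha hc hMe
    have h3 := outNormal_eq_neg hd hL hM (Ne.symm hML) hb hc (hMe.trans he.symm)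
    obtain ⟨h, hn⟩ := exists_isOutwardNormal_outNormal hd hM hc
    have h4 : outNormal M c = 0 := by
      rw [h1, neg_neg] at h3
      rw [h3] at h2
      rw [eq_neg_iff_add_eq_zero, ← two_smul ℝ, smul_eq_zero] at h2
      rw [h3]
      exact h2.resolve_left two_ne_zero
    have := hn.norm_eq
    rw [h4, norm_zero] at this
    norm_num at this
  · rintro (h | h) <;> cases h
    · exact ⟨⟨hK, ha⟩, rfl⟩
    · exact ⟨⟨hL, hb⟩, he⟩

/-- Elementwise constant multiples of a discretely divergence free field have no total flux through
the internal faces. -/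
lemma sum_internalFaces_flux (hd : 1 ≤ d) {u : Pt d → Pt d} (hu : u ∈ velocitySpace 𝒯)
    (hdiv : IsDiscretelyDivFree 𝒯 u) (g : Finset (Pt d) → ℝ) :
    ∑ e ∈ 𝒯.internalFaces, ∑ q ∈ facetPairs 𝒯 e, g q.1 * flux u q.1 q.2 = 0 := by
  have h1 : ∑ q ∈ 𝒯.cells.sigma id, g q.1 * flux u q.1 q.2 = 0 := by
    rw [Finset.sum_sigma]
    refine Finset.sum_eq_zero fun K hK => ?_
    simp only [id_eq]
    rw [← Finset.mul_sum, sum_flux_eq_zero hd hu hdiv hK, mul_zero]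
  -- The sum over pairs of a cell and an opposite vertex is regrouped by the facet they define.
  have h2 := Finset.sum_fiberwise_of_maps_to (s := (𝒯.cells.sigma id).filter
    fun q => q.1.erase q.2 ∈ 𝒯.internalFaces) (t := 𝒯.internalFaces)
    (g := fun q => q.1.erase q.2) (fun q hq => (Finset.mem_filter.1 hq).2)
    (fun q => g q.1 * flux u q.1 q.2)
  rw [Finset.sum_filter_of_ne] at h2
  · rw [h1] at h2
    rw [← h2]
    refine Finset.sum_congr rfl fun e he => ?_
    rw [Finset.filter_filter, facetPairs]
    refine Finset.sum_congr (Finset.filter_congr fun q _ => ?_) fun _ _ => rfl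
    exact ⟨fun h => ⟨h ▸ he, h⟩, fun h => h.2⟩
  -- Restricting to internal facets loses nothing: the no-slip condition kills the flux through the
  -- others.
  · rintro ⟨K, a⟩ hq hne
    obtain ⟨hK, ha⟩ := Finset.mem_sigma.1 hq
    by_contra hint
    refine hne ?_
    simp only
    rw [flux_eq_zero_of_boundary hd hu hK ha, mul_zero]
    intro L hL hsub
    by_contra hLK
    exact hint (mem_internalFaces hd hK ha hL (Ne.symm hLK) hsub)

end facet

/-! ### The jump terms of the discontinuous Galerkin scheme -/

section jump

open Classical

variable {a b : Pt d} {u : Pt d → Pt d}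

/-- Where `u` points into `K`, the displaced point lies in the open cell for small `δ`, so the limit
is that of a constant. -/
lemma downstream_piH (hd : 1 ≤ d) (hK : K ∈ 𝒯.cells) (ha : a ∈ K) {x : Pt d}
    (hx : x ∈ openFace (K.erase a)) (hv : inner ℝ (outNormal K a) (u x) < 0)
    (f : Pt d → Tensor d) : downstream u (piH 𝒯 f) x = f (barycenter K) := by
  refine Tendsto.limUnder_eq (tendsto_const_nhds.congr' ?_)
  filter_upwards [eventually_mem_openCell hd hK ha hx hv] with δ hδ
  exact (piH_eq hK f hδ).symm

lemma upstream_piH (hd : 1 ≤ d) (hK : K ∈ 𝒯.cells) (ha : a ∈ K) {x : Pt d}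
    (hx : x ∈ openFace (K.erase a)) (hv : 0 < inner ℝ (outNormal K a) (u x))
    (f : Pt d → Tensor d) : upstream u (piH 𝒯 f) x = f (barycenter K) := by
  refine Tendsto.limUnder_eq (tendsto_const_nhds.congr' ?_)
  have h1 := eventually_mem_openCell hd hK ha hx (v := -u x) (by rwa [inner_neg_right, neg_lt_zero])
  have h2 : Tendsto (fun δ : ℝ => -δ) (𝓝[<] 0) (𝓝[>] 0) := by
    simpa using tendsto_neg_nhdsLT (a := (0 : ℝ))
  filter_upwards [h2.eventually h1] with δ hδ
  rw [smul_neg, neg_smul, neg_neg] at hδ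
  exact (piH_eq hK f hδ).symm

lemma euclideanHausdorffMeasure_facet_lt_top (hd : 1 ≤ d) (hK : K ∈ 𝒯.cells) (ha : a ∈ K) :
    Measure.euclideanHausdorffMeasure (d - 1) (convexHull ℝ (K.erase a : Set (Pt d))) < ⊤ := by
  obtain ⟨h, hn⟩ := exists_isOutwardNormal_outNormal hd hK ha
  rw [euclideanHausdorffMeasure_eq_planeSection hn.norm_eq a (isCompact_convexHull _)
    fun y hy => hn.inner_eq_of_mem_convexHull hy]
  exact (isCompact_planeSection a h (isCompact_convexHull _)).measure_lt_top

lemma integrableOn_facet (hd : 1 ≤ d) (hK : K ∈ 𝒯.cells) (ha : a ∈ K) {f : Pt d → ℝ}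
    (hf : ContinuousOn f 𝒯.space) :
    IntegrableOn f (convexHull ℝ (K.erase a : Set (Pt d)))
      (Measure.euclideanHausdorffMeasure (d - 1)) := by
  have hc := isCompact_convexHull (K.erase a)
  have hsub : convexHull ℝ (K.erase a : Set (Pt d)) ⊆ 𝒯.space :=
    (convexHull_mono (by exact_mod_cast Finset.erase_subset _ _)).trans
      (𝒯.convexHull_subset_space (Mesh.mem_cells.1 hK).1)
  obtain ⟨B, hB⟩ := hc.exists_bound_of_continuousOn (hf.mono hsub)
  refine IntegrableOn.of_bound (euclideanHausdorffMeasure_facet_lt_top hd hK ha)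
    ((hf.mono hsub).aestronglyMeasurable hc.isClosed.measurableSet) B ?_
  exact ae_restrict_of_forall_mem hc.isClosed.measurableSet hB

/-- The jump term of an internal face dominates the flux of the entropy through the face. -/
lemma le_integral_jump (hd : 1 ≤ d) (hu : u ∈ velocitySpace 𝒯) {ν : Finset (Pt d) → Pt d}
    (hν : IsUnitNormal 𝒯 ν) {κ : ℝ} (hκ : 0 ≤ κ) {s : Pt d → Tensor d}
    (hpos : ∀ K ∈ 𝒯.cells, (s (barycenter K)).PosDef) {e : Finset (Pt d)}
    (he : e ∈ 𝒯.internalFaces) :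
    -(κ * ∑ q ∈ facetPairs 𝒯 e, traceSubLogDet (s (barycenter q.1)) * flux u q.1 q.2) ≤
      ∫ x in convexHull ℝ (e : Set (Pt d)), |inner ℝ (u x) (ν e)| *
        ddot (jump u (piH 𝒯 s) x) (downstream u (testTensor 𝒯 κ s) x)
          ∂(Measure.euclideanHausdorffMeasure (d - 1)) := by
  obtain ⟨hν1, hν2⟩ := hν e he
  obtain ⟨K, hK, a, ha, L, hL, b, hb, hKL, rfl, hbe⟩ := exists_cells_of_mem_internalFaces he
  have hop := outNormal_eq_neg hd hK hL hKL ha hb hbe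
  set n := outNormal K a with hn
  set A := s (barycenter K)
  set B := s (barycenter L)
  -- Here `c₁` is the jump against the downstream test value when the flow goes from `K` to `L`, and
  -- `c₂` the same for the flow from `L` to `K`.
  set c₁ := κ * ddot (B - A) (1 - B⁻¹)
  set c₂ := κ * ddot (A - B) (1 - A⁻¹)
  set m : Measure (Pt d) := (Measure.euclideanHausdorffMeasure (d - 1)).restrict
    (convexHull ℝ (K.erase a : Set (Pt d)))
  have hfl : flux u L b = -flux u K a := by
    rw [flux, flux, hbe, hop, ← hn, ← integral_neg]
    simp_rw [inner_neg_left]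
  have hne : (⟨K, a⟩ : Σ _ : Finset (Pt d), Pt d) ≠ ⟨L, b⟩ := fun h => hKL (congrArg Sigma.fst h)
  rw [facetPairs_eq hd hK hL hKL ha hb hbe, Finset.sum_pair hne, hfl]
  have habs : ∀ x, |inner ℝ (u x) (ν (K.erase a))| = |inner ℝ n (u x)| := fun x => by
    rcases eq_or_eq_neg_outNormal hd hK ha hν1 hν2 with h | h
    · rw [h, real_inner_comm]
    · rw [h, inner_neg_right, abs_neg, real_inner_comm]
  have hpw : (fun x => |inner ℝ (u x) (ν (K.erase a))| *
      ddot (jump u (piH 𝒯 s) x) (downstream u (testTensor 𝒯 κ s) x)) =ᵐ[m]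
      fun x => c₁ * max (inner ℝ n (u x)) 0 + c₂ * max (-inner ℝ n (u x)) 0 := by
    filter_upwards [ae_mem_openFace hd hK ha] with x hx
    have hx' : x ∈ openFace (L.erase b) := hbe ▸ hx
    rw [habs]
    rcases lt_trichotomy (inner ℝ n (u x)) 0 with h | h | h
    · have hL' : 0 < inner ℝ (outNormal L b) (u x) := by rw [hop, inner_neg_left]; linarith
      rw [jump, downstream_piH hd hK ha hx h, upstream_piH hd hL hb hx' hL', testTensor,
        downstream_piH hd hK ha hx h, ddot_smul_right, abs_of_neg h, max_eq_right h.le,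
        max_eq_left (by linarith)]
      simp only [c₂, A, B]
      ring
    -- Where the flow is tangential the one-sided limits may be meaningless, but the factor `|u ·
    -- n|` vanishes.
    · rw [h]; simp
    · have hL' : inner ℝ (outNormal L b) (u x) < 0 := by rw [hop, inner_neg_left]; linarith
      rw [jump, downstream_piH hd hL hb hx' hL', upstream_piH hd hK ha hx h, testTensor,
        downstream_piH hd hL hb hx' hL', ddot_smul_right, abs_of_pos h, max_eq_left h.le,
        max_eq_right (by linarith)]
      simp only [c₁, A, B]
      ring
  have hin : ContinuousOn (fun x => inner ℝ n (u x)) 𝒯.space := 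
    (innerSL ℝ n).continuous.comp_continuousOn hu.1
  have i1 : Integrable (fun x => inner ℝ n (u x)) m := integrableOn_facet hd hK ha hin
  have i2 : Integrable (fun x => c₁ * max (inner ℝ n (u x)) 0 + c₂ * max (-inner ℝ n (u x)) 0) m :=
    ((i1.pos_part).const_mul c₁).add ((i1.neg_part).const_mul c₂)
  have h1 := traceSubLogDet_sub_le (hpos L hL) (hpos K hK)
  have h2 := traceSubLogDet_sub_le (hpos K hK) (hpos L hL)
  rw [integral_congr_ae hpw]
  -- The fluxes out of the two cells are opposite, so the entropy flux becomes the entropy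
  -- difference times `n · u`. Convexity is then used in the direction of the flow, according to the
  -- sign of `n · u`.
  calc _ = ∫ x, κ * (traceSubLogDet B - traceSubLogDet A) * inner ℝ n (u x) ∂m := by
        rw [integral_const_mul, flux]
        simp only [A, B]
        ring
    _ ≤ _ := by
        refine integral_mono (i1.const_mul _) i2 fun x => ?_
        simp only [c₁, c₂]
        rcases le_total (inner ℝ n (u x)) 0 with h | h
        · rw [max_eq_right h, max_eq_left (by linarith)]
          have := mul_le_mul_of_nonneg_left h2 (mul_nonneg hκ (neg_nonneg.2 h))
          simp only [A, B]
          linarith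
        · rw [max_eq_left h, max_eq_right (by linarith)]
          have := mul_le_mul_of_nonneg_left h1 (mul_nonneg hκ h)
          simp only [A, B]
          linarith

lemma sum_integral_jump_nonneg (hd : 1 ≤ d) (hu : u ∈ velocitySpace 𝒯)
    (hdiv : IsDiscretelyDivFree 𝒯 u) {ν : Finset (Pt d) → Pt d}
    (hν : IsUnitNormal 𝒯 ν) {κ : ℝ} (hκ : 0 ≤ κ) {s : Pt d → Tensor d}
    (hpos : ∀ K ∈ 𝒯.cells, (s (barycenter K)).PosDef) :
    0 ≤ ∑ e ∈ 𝒯.internalFaces, ∫ x in convexHull ℝ (e : Set (Pt d)), |inner ℝ (u x) (ν e)| *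
        ddot (jump u (piH 𝒯 s) x) (downstream u (testTensor 𝒯 κ s) x)
          ∂(Measure.euclideanHausdorffMeasure (d - 1)) := by
  refine le_trans (le_of_eq ?_) (Finset.sum_le_sum fun e he => le_integral_jump hd hu hν hκ hpos he)
  rw [Finset.sum_neg_distrib, ← Finset.mul_sum,
    sum_internalFaces_flux hd hu hdiv fun K => traceSubLogDet (s (barycenter K)), mul_zero, neg_zero]

end jump

/-! ### One step of each scheme -/

lemma isPiecewiseCont_schemeDensity (Re Wi ε dt : ℝ) {uo u v : Pt d → Pt d} {p q : Pt d → ℝ}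
    {so s φ : Pt d → Tensor d} (huo : uo ∈ velocitySpace 𝒯) (hu : u ∈ velocitySpace 𝒯)
    (hv : v ∈ velocitySpace 𝒯) (hp : IsPiecewiseCont 𝒯 p) (hq : IsPiecewiseCont 𝒯 q)
    (hso : IsPiecewiseCont 𝒯 so) (hs : IsPiecewiseCont 𝒯 s) (hφ : IsPiecewiseCont 𝒯 φ) :
    IsPiecewiseCont 𝒯 (schemeDensity 𝒯 Re Wi ε dt uo so u p s v q φ) := by
  have h1 : IsPiecewiseCont 𝒯 fun x => dt⁻¹ • (u x - uo x) :=
    ((isPiecewiseCont_velocity hu).sub (isPiecewiseCont_velocity huo)).comp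
      (H := fun y => dt⁻¹ • y) (by fun_prop)
  have h2 : IsPiecewiseCont 𝒯 fun x => fderiv ℝ u x (uo x) :=
    (isPiecewiseCont_fderiv hu).comp₂ (isPiecewiseCont_velocity huo) (H := fun A y => A y)
      isBoundedBilinearMap_apply.continuous
  have h3 : IsPiecewiseCont 𝒯 fun x => inner ℝ (dt⁻¹ • (u x - uo x) + fderiv ℝ u x (uo x)) (v x) :=
    (h1.add h2).comp₂ (isPiecewiseCont_velocity hv) (H := fun y z => inner ℝ y z) continuous_inner
  have hπ : IsPiecewiseCont 𝒯 (piH 𝒯 s) := IsPiecewiseCont.piH s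
  have hgu := isPiecewiseCont_grad hu
  have hgv := isPiecewiseCont_grad hv
  have h4 : IsPiecewiseCont 𝒯 fun x => dt⁻¹ • (s x - so x) :=
    (hs.sub hso).comp (H := fun y => dt⁻¹ • y) (by fun_prop)
  have h5 : IsPiecewiseCont 𝒯 fun x => (grad u x)ᵀ :=
    hgu.comp (H := fun A => Aᵀ) (by fun_prop)
  exact ((((((((h3.const_mul Re).sub (hp.mul (isPiecewiseCont_diverg hv))).add
    (hq.mul (isPiecewiseCont_diverg hu))).add
    ((isPiecewiseCont_ddot hgu hgv).const_mul (1 - ε))).add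
    ((isPiecewiseCont_ddot hπ hgv).const_mul (ε / Wi))).add (isPiecewiseCont_ddot h4 hφ)).sub
    (isPiecewiseCont_ddot ((hgu.mul hπ).add (hπ.mul h5)) hφ)).add
    ((isPiecewiseCont_ddot (hs.sub (IsPiecewiseCont.const 1)) hφ).const_mul (1 / Wi)))

/-- Reconciles the sum over closed cells in the discontinuous Galerkin scheme with the integral over
the domain; they differ by the null skeleton. -/
lemma IsPiecewiseCont.sum_setIntegral_convexHull {f : Pt d → ℝ} (hf : IsPiecewiseCont 𝒯 f) :
    ∑ K ∈ 𝒯.cells, ∫ x in convexHull ℝ (K : Set (Pt d)), f x = ∫ x in 𝒯.domain, f x := by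
  rw [hf.setIntegral_domain]
  exact Finset.sum_congr rfl fun K _ => (setIntegral_congr_set (openCell_ae_eq K)).symm

section steps

variable {Re Wi ε dt : ℝ} {S : Set (Pt d → Tensor d)} {uo u : Pt d → Pt d} {so s : Pt d → Tensor d}
  {p : Pt d → ℝ} {ν : Finset (Pt d) → Pt d}

/-- As for characteristics; the face terms also drop out because the downstream value of the zero
test tensor is zero. -/
lemma DGStep.isDiscretelyDivFree (hS : S = symTensorDisc 𝒯 1 ∨ S = symTensorP1P0 𝒯)
    (hu : u ∈ velocitySpace 𝒯) (h : DGStep 𝒯 Re Wi ε dt S ν uo so u p s) :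
    IsDiscretelyDivFree 𝒯 u := by
  intro q hq
  have h1 := h _ (zero_mem_velocitySpace 𝒯) q hq _
    (piH_mem_stressSpace (f := fun _ => 0) hS fun _ _ => Matrix.isSymm_zero)
  have h2 : ∀ x, downstream uo (fun _ => (0 : Tensor d)) x = 0 := fun x =>
    Tendsto.limUnder_eq tendsto_const_nhds
  have h3 : IsPiecewiseCont 𝒯 fun x => q x * diverg u x :=
    (IsPiecewisePoly.isPiecewiseCont hq).mul (isPiecewiseCont_diverg hu)
  rw [← h3.sum_setIntegral_convexHull]
  simpa [piH_zero, schemeDensity_zero_test, h2, ddot] using h1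

/-- The free energy estimate for one step of the discontinuous Galerkin scheme. -/
lemma DGStep.free_energy_le (hd : 1 ≤ d) (hWi : 0 < Wi) (hε : 0 ≤ ε) (hdt : 0 < dt)
    (hS : S = symTensorDisc 𝒯 1 ∨ S = symTensorP1P0 𝒯) (hν : IsUnitNormal 𝒯 ν)
    (hu : u ∈ velocitySpace 𝒯) (huo : uo ∈ velocitySpace 𝒯) (hp : p ∈ pressureSpace 𝒯)
    (hs : s ∈ S) (hso : so ∈ S) (hdivo : IsDiscretelyDivFree 𝒯 uo)
    (hpos : ∀ K ∈ 𝒯.cells, (s (barycenter K)).PosDef)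
    (hposo : ∀ K ∈ 𝒯.cells, (so (barycenter K)).PosDef)
    (h : DGStep 𝒯 Re Wi ε dt S ν uo so u p s) :
    freeEnergy 𝒯 Re Wi ε u (piH 𝒯 s) - freeEnergy 𝒯 Re Wi ε uo (piH 𝒯 so)
      + (∫ x in 𝒯.domain, Re / 2 * ‖u x - uo x‖ ^ 2)
      + dt * (∫ x in 𝒯.domain, ((1 - ε) * ddot (grad u x) (grad u x)
          + ε / (2 * Wi ^ 2) * (piH 𝒯 s x + (piH 𝒯 s x)⁻¹ - (2 : ℝ) • 1).trace)) ≤ 0 := by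
  have hκ : 0 ≤ ε / (2 * Wi) := by positivity
  have hsp := isPiecewisePoly_of_mem_stressSpace hS hs
  have hsop := isPiecewisePoly_of_mem_stressSpace hS hso
  have hsc : IsPiecewiseCont 𝒯 s := IsPiecewiseCont.matrix fun i j => (hsp i j).isPiecewiseCont
  have hsoc : IsPiecewiseCont 𝒯 so := IsPiecewiseCont.matrix fun i j => (hsop i j).isPiecewiseCont
  have hpc : IsPiecewiseCont 𝒯 p := IsPiecewisePoly.isPiecewiseCont hp
  have hφc : IsPiecewiseCont 𝒯 (testTensor 𝒯 (ε / (2 * Wi)) s) := IsPiecewiseCont.piH _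
  have hstep := h u hu p hp _ (testTensor_mem hS (ε / (2 * Wi)) hpos)
  rw [(isPiecewiseCont_schemeDensity Re Wi ε dt huo hu hu hpc hpc hsoc hsc
    hφc).sum_setIntegral_convexHull] at hstep
  refine free_energy_step hWi hdt hu huo ((h.isDiscretelyDivFree hS hu).diverg_ae_eq_zero hu)
    (hdivo.diverg_ae_eq_zero huo) hsp hpos hposo
    (isPiecewiseCont_ddot hsoc hφc).integrableOn_domain hstep ?_
  -- The jumps only help, so what remains is convexity between old and new stress on each cell
  -- separately.
  have hJ := mul_nonneg hdt.le (sum_integral_jump_nonneg hd huo hdivo hν hκ hpos)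
  rw [integral_ddot_testTensor hsop, ← mul_sub, ← Finset.sum_sub_distrib]
  refine le_add_of_le_of_nonneg (mul_le_mul_of_nonneg_left ?_ hκ) hJ
  rw [entropy, entropy, ← Finset.sum_sub_distrib]
  refine Finset.sum_le_sum fun K hK => ?_
  rw [← mul_sub, ← mul_sub, ← ddot_sub_left]
  exact mul_le_mul_of_nonneg_left (traceSubLogDet_sub_le (hpos K hK) (hposo K hK))
    measureReal_nonneg

/-- The free energy estimate for one step of the scheme with characteristics. -/
lemma CharacteristicStep.free_energy_le {t₀ t₁ : ℝ} {X : ℝ → Pt d → Pt d} (ht : t₀ ≤ t₁)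
    (hWi : 0 < Wi) (hε : 0 ≤ ε) (hdt : 0 < dt)
    (hS : S = symTensorDisc 𝒯 1 ∨ S = symTensorP1P0 𝒯) (hX : IsBackwardFlow 𝒯 uo t₀ t₁ X)
    (hu : u ∈ velocitySpace 𝒯) (huo : uo ∈ velocitySpace 𝒯) (hp : p ∈ pressureSpace 𝒯)
    (hs : s ∈ S) (hdivo : IsDiscretelyDivFree 𝒯 uo)
    (hpos : ∀ K ∈ 𝒯.cells, (s (barycenter K)).PosDef)
    (hposo : ∀ K ∈ 𝒯.cells, (so (barycenter K)).PosDef)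
    (h : CharacteristicStep 𝒯 Re Wi ε dt S (X t₀) uo so u p s) :
    freeEnergy 𝒯 Re Wi ε u (piH 𝒯 s) - freeEnergy 𝒯 Re Wi ε uo (piH 𝒯 so)
      + (∫ x in 𝒯.domain, Re / 2 * ‖u x - uo x‖ ^ 2)
      + dt * (∫ x in 𝒯.domain, ((1 - ε) * ddot (grad u x) (grad u x)
          + ε / (2 * Wi ^ 2) * (piH 𝒯 s x + (piH 𝒯 s x)⁻¹ - (2 : ℝ) • 1).trace)) ≤ 0 := by
  have hκ : 0 ≤ ε / (2 * Wi) := by positivity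
  have hY := hX.isVolumeNonincreasing huo ht (hdivo.diverg_ae_eq_zero huo)
  have hYX : ∀ x ∈ 𝒯.domain, reversedFlow 𝒯 t₁ X (t₁ - t₀) x = X t₀ x := fun x hx =>
    reversedFlow_of_mem hx
  have hstep := h u hu p hp _ (testTensor_mem hS (ε / (2 * Wi)) hpos)
  -- There are no face terms here, so the energy balance is used with `J = 0`.
  rw [← add_zero (∫ x in 𝒯.domain, _)] at hstep
  refine free_energy_step hWi hdt hu huo ((h.isDiscretelyDivFree hS).diverg_ae_eq_zero hu)
    (hdivo.diverg_ae_eq_zero huo) (isPiecewisePoly_of_mem_stressSpace hS hs) hpos hposo ?_ hstep ?_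
  · refine (integrableOn_ddot_piH_comp hY.measurable so
      fun y => (ε / (2 * Wi)) • (1 - (s y)⁻¹)).congr_fun (fun x hx => ?_)
      (isOpen_domain 𝒯).measurableSet
    simp only [hYX x hx]
    rfl
  · rw [mul_zero, add_zero]
    refine entropy_transport_le hκ hY (fun x hx => ?_) hpos hposo fun x hx => by rw [hYX x hx]
    rw [hYX x hx]
    exact ((hX x hx).2 t₀ ⟨le_rfl, ht⟩).1

end steps

/-- The one-step estimates imply that the free energies decrease. -/
lemma freeEnergyDissipation_of_step {Re Wi ε dt : ℝ} (hRe : 0 ≤ Re) (hε₀ : 0 ≤ ε) (hε₁ : ε < 1)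
    (hdt : 0 < dt) {NT : ℕ} {u : ℕ → Pt d → Pt d} {σ : ℕ → Pt d → Tensor d}
    (hpos : ∀ n ≤ NT, ∀ K ∈ 𝒯.cells, (σ n (barycenter K)).PosDef)
    (hstep : ∀ n < NT, freeEnergy 𝒯 Re Wi ε (u (n + 1)) (piH 𝒯 (σ (n + 1)))
      - freeEnergy 𝒯 Re Wi ε (u n) (piH 𝒯 (σ n))
      + (∫ x in 𝒯.domain, Re / 2 * ‖u (n + 1) x - u n x‖ ^ 2)
      + dt * (∫ x in 𝒯.domain,
          ((1 - ε) * ddot (grad (u (n + 1)) x) (grad (u (n + 1)) x)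
            + ε / (2 * Wi ^ 2) *
              (piH 𝒯 (σ (n + 1)) x + (piH 𝒯 (σ (n + 1)) x)⁻¹ - (2 : ℝ) • 1).trace)) ≤ 0) :
    FreeEnergyDissipation 𝒯 Re Wi ε dt NT u σ := by
  refine ⟨hstep, fun m n hmn => ?_⟩
  induction n, hmn using Nat.le_induction with
  | base => exact fun _ => le_rfl
  | succ n _ ih =>
    intro hn
    have h1 := hstep n hn
    have h2 : 0 ≤ ∫ x in 𝒯.domain, Re / 2 * ‖u (n + 1) x - u n x‖ ^ 2 :=
      integral_nonneg fun x => by positivity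
    have h3 : 0 ≤ ∫ x in 𝒯.domain, ((1 - ε) * ddot (grad (u (n + 1)) x) (grad (u (n + 1)) x)
        + ε / (2 * Wi ^ 2) *
          (piH 𝒯 (σ (n + 1)) x + (piH 𝒯 (σ (n + 1)) x)⁻¹ - (2 : ℝ) • 1).trace) := by
      refine integral_nonneg_of_ae ?_
      filter_upwards [ae_mem_openCell 𝒯] with x ⟨K, hK, hx⟩
      rw [piH_eq hK _ hx]
      have e1 := trace_add_inv_nonneg (hpos (n + 1) hn K hK)
      have e2 := ddot_self_nonneg (grad (u (n + 1)) x)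
      have e3 : 0 ≤ 1 - ε := by linarith
      exact add_nonneg (mul_nonneg e3 e2) (mul_nonneg (by positivity) e1)
    have h4 := mul_nonneg hdt.le h3
    have h5 := ih (by omega)
    linarith

end OldroydB

end

theorem mainTheorem5 {d : ℕ} (hd : d = 2 ∨ d = 3) (𝒯 : OldroydB.Mesh d)
    (Re Wi ε T : ℝ) (hRe : 0 ≤ Re) (hWi : 0 < Wi) (hε₀ : 0 ≤ ε) (hε₁ : ε < 1) (hT : 0 < T)
    (NT : ℕ) (hNT : 0 < NT)
    (S : Set (OldroydB.Pt d → OldroydB.Tensor d))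
    (hS : S = OldroydB.symTensorDisc 𝒯 1 ∨ S = OldroydB.symTensorP1P0 𝒯)
    (u : ℕ → OldroydB.Pt d → OldroydB.Pt d) (p : ℕ → OldroydB.Pt d → ℝ)
    (σ : ℕ → OldroydB.Pt d → OldroydB.Tensor d)
    (hu : ∀ n ≤ NT, u n ∈ OldroydB.velocitySpace 𝒯)
    (hp : ∀ n ≤ NT, p n ∈ OldroydB.pressureSpace 𝒯)
    (hσ : ∀ n ≤ NT, σ n ∈ S)
    (hu₀ : OldroydB.IsDiscretelyDivFree 𝒯 (u 0))
    (hpos : ∀ n ≤ NT, ∀ K ∈ 𝒯.cells, ∀ x ∈ OldroydB.openCell K,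
      (OldroydB.piH 𝒯 (σ n) x).PosDef) :
    (∀ X : ℕ → ℝ → OldroydB.Pt d → OldroydB.Pt d,
      (∀ n < NT, OldroydB.IsBackwardFlow 𝒯 (u n) (n * (T / NT)) ((n + 1) * (T / NT)) (X n)) →
      (∀ n < NT, OldroydB.CharacteristicStep 𝒯 Re Wi ε (T / NT) S (X n (n * (T / NT)))
        (u n) (σ n) (u (n + 1)) (p (n + 1)) (σ (n + 1))) →
      OldroydB.FreeEnergyDissipation 𝒯 Re Wi ε (T / NT) NT u σ) ∧
    (∀ ν : Finset (OldroydB.Pt d) → OldroydB.Pt d,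
      OldroydB.IsUnitNormal 𝒯 ν →
      (∀ n < NT, OldroydB.DGStep 𝒯 Re Wi ε (T / NT) S ν
        (u n) (σ n) (u (n + 1)) (p (n + 1)) (σ (n + 1))) →
      OldroydB.FreeEnergyDissipation 𝒯 Re Wi ε (T / NT) NT u σ) := by
  have hd1 : 1 ≤ d := by omega
  have hNT' : (0 : ℝ) < NT := by exact_mod_cast hNT
  have hdt : 0 < T / NT := div_pos hT hNT'
  -- Since `π_h(σ)` is constant on a cell, positivity there is positivity of `σ` at the barycenter,
  -- the only value the argument uses.
  have hpos' : ∀ n ≤ NT, ∀ K ∈ 𝒯.cells, (σ n (OldroydB.barycenter K)).PosDef := by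
    intro n hn K hK
    have h := hpos n hn K hK _ (OldroydB.barycenter_mem_openCell hK)
    rwa [OldroydB.piH_eq hK _ (OldroydB.barycenter_mem_openCell hK)] at h
  constructor
  · intro X hX hstep
    have hdiv : ∀ n ≤ NT, OldroydB.IsDiscretelyDivFree 𝒯 (u n) := by
      rintro (_ | n) hn
      · exact hu₀
      · exact (hstep n hn).isDiscretelyDivFree hS
    refine OldroydB.freeEnergyDissipation_of_step hRe hε₀ hε₁ hdt hpos' fun n hn => ?_
    exact (hstep n hn).free_energy_le (by gcongr; linarith) hWi hε₀ hdt hS (hX n hn)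
      (hu _ hn) (hu _ hn.le) (hp _ hn) (hσ _ hn) (hdiv _ hn.le) (hpos' _ hn) (hpos' _ hn.le)
  · intro ν hν hstep
    have hdiv : ∀ n ≤ NT, OldroydB.IsDiscretelyDivFree 𝒯 (u n) := by
      rintro (_ | n) hn
      · exact hu₀
      · exact (hstep n hn).isDiscretelyDivFree hS (hu _ hn)
    refine OldroydB.freeEnergyDissipation_of_step hRe hε₀ hε₁ hdt hpos' fun n hn => ?_
    exact (hstep n hn).free_energy_le hd1 hWi hε₀ hdt hS hν (hu _ hn) (hu _ hn.le) (hp _ hn)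
      (hσ _ hn) (hσ _ hn.le) (hdiv _ hn.le) (hpos' _ hn) (hpos' _ hn.le)
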